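/- **Setting.** Equip $\mathbb R^4$ with $\omega_0=\sum_{i=1}^2 dy_i\wedge dx_i$. Let $H:\mathbb R^4\to\mathbb R$ be smooth with a saddle-center equilibrium $p_c\in H^{-1}(0)$ near which there are smooth symplectic coordinates $\varphi:(V,0)\to(U,p_c)$, $(q_1,q_2,p_1,p_2)\in V$, with $$K:=H\circ\varphi=-\alpha I_1+\omega I_2+R(I_1,I_2),\qquad I_1=q_1p_1,\quad I_2=\tfrac{q_2^2+p_2^2}{2},$$ where $\alpha,\omega>0$ and $R$ is smooth near $0$ with $R=O(I_1^2+I_2^2)$. Work in a sufficiently small ball $B_\delta(0)\subset V$; level sets of $K$ below are taken inside this ball. Put $T(q_1,q_2,p_1,p_2)=(-q_1,q_2,-p_1,p_2)$. For $E>0$ let $S_E\subset H^{-1}(E)$ be any smoothly embedded closed $3$-ball which in local coordinates is $\{q_1+p_1\ge 0\}\cap K^{-1}(E)$ and has boundary $\partial S_E=\{q_1+p_1=0\}\cap K^{-1}(E)$. Let $W_E$ be the closed $3$-manifold obtained by gluing two copies of $S_E$ along their boundaries by $T$, with the smooth structure for which a neighbourhood of the common boundary is parametrized by $K^{-1}(E)$,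 the points with $q_1+p_1\ge0$ lying in the first copy and the points $z$ with $q_1+p_1\le 0$ representing the points $Tz$ of the second copy. Let $\lambda_E$ be any contact form on $W_E$ which near $\partial S_E$ coincides with $\frac12\sum_{i}(p_i\,dq_i-q_i\,dp_i)|_{K^{-1}(E)}$. Let $$U_{1,E}=\{q_1+p_1=0,\ q_1<0\}\cap K^{-1}(E),\qquad U_{2,E}=\{q_1+p_1=0,\ q_1>0\}\cap K^{-1}(E)$$ be the hemispheres of $\partial S_E$. For a contact form $\lambda$ with Reeb field $X_\lambda$ and $\xi=\ker\lambda$, $\mathcal J(\lambda)$ is the set of smooth complex structures $J$ on $\xi$ for which $d\lambda(\cdot,J\cdot)$ is a positive definite inner product on $\xi$, and $\tilde J=(\lambda,J)$ is the almost complex structure on $\mathbb R\times W$ with $\tilde J|_\xi=J$ and $\tilde J\partial_a=X_\lambda$. A finite energy plane is a smooth map $\tilde u=(a,u):\mathbb C\to\mathbb R\times W$ with $\tilde J\circ d\tilde u=d\tilde u\circ i$ and $0<\sup_\psi\int_{\mathbb C}\tilde u^*d(\psi(a)\lambda)<\infty$, the supremum being over smooth $\psi:\mathbb R\to[0,1]$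 with $\psi'\ge0$. It is asymptotic to a periodic Reeb orbit $P=(w,T)$ if $a\to+\infty$ at $\infty$ and, for a constant $c$, the loops $t\mapsto u(e^{2\pi(s+it)})$ converge in $C^\infty(S^1,W)$ to $t\mapsto w(Tt+c)$ as $s\to+\infty$. **Proposition.** For every sufficiently small $\delta>0$ there is $E_0>0$, depending only on $H,\varphi,\alpha,\omega,R$ and $\delta$, such that for all $0<E<E_0$ and all $S_E,W_E,\lambda_E$ as above the following holds. The set $\{q_1=p_1=0\}\cap K^{-1}(E)$ is a circle $\{q_1=p_1=0,\ q_2^2+p_2^2=r_E^2\}$ with $0<r_E<\delta$, and $$P_{2,E}=(x_{2,E},T_{2,E}),\quad x_{2,E}(t)=\bigl(0,\ r_E\cos\tfrac{2\pi t}{T_{2,E}},\ 0,\ -r_E\sin\tfrac{2\pi t}{T_{2,E}}\bigr),\quad T_{2,E}=\pi r_E^2,$$ is a hyperbolic periodic orbit of the Reeb flow of $\lambda_E$ (the linearized return map on $\ker\lambda_E$ has no eigenvalue on the unit circle). There exists $J_E\in\mathcal J(\lambda_E)$ such that $\tilde J_E=(\lambda_E,J_E)$ admits finite energy planes $\tilde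 u_{1,E}=(a_{1,E},u_{1,E})$ and $\tilde u_{2,E}=(a_{2,E},u_{2,E}):\mathbb C\to\mathbb R\times W_E$, both asymptotic to $P_{2,E}$, with $$u_{1,E}(\mathbb C)=U_{1,E},\qquad u_{2,E}(\mathbb C)=U_{2,E}.$$ Moreover the planes are explicit: each is given by $$u(e^{2\pi(s+it)})=(-h(s),\,f(s)\cos2\pi t,\,h(s),\,-f(s)\sin2\pi t)\in K^{-1}(E),\qquad a(e^{2\pi(s+it)})=\pi\int_0^s f(\tau)^2\,d\tau,$$ with smooth functions $f>0$ and $h$, where $h$ solves the one-dimensional ODE $$h'=-\frac{2\pi\,\bar\alpha\,\bar\omega\,h f^2}{\bar\omega^2f^2+2\bar\alpha^2h^2},\qquad \bar\alpha=\alpha-\partial_{I_1}R,\quad \bar\omega=\omega+\partial_{I_2}R\ \text{ at } (I_1,I_2)=(-h^2,f^2/2).$$ -/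

import Mathlib

open Set Filter
open scoped Manifold ContDiff Topology

noncomputable section

/-- The model space of 3-manifolds. -/
abbrev E3 : Type := EuclideanSpace ℝ (Fin 3)

/-- `ℝ⁴`. The coordinates are ordered `(q₁, q₂, p₁, p₂)`, respectively `(x₁, x₂, y₁, y₂)`, and
numbered `0, 1, 2, 3`. -/
abbrev E4 : Type := EuclideanSpace ℝ (Fin 4)

namespace Contact

/-! ### Contact forms, Reeb fields and pseudo-holomorphic planes over a 3-manifold -/

section Manifold

variable {M : Type*} [TopologicalSpace M] [ChartedSpace E3 M]

/-- A field of linear functionals on the tangent spaces (a not necessarily smooth 1-form). -/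
abbrev OneForm (M : Type*) [TopologicalSpace M] [ChartedSpace E3 M] : Type _ :=
  (x : M) → (TangentSpace (𝓡 3) x →L[ℝ] ℝ)

/-- A field of endomorphisms of the tangent spaces. -/
abbrev EndField (M : Type*) [TopologicalSpace M] [ChartedSpace E3 M] : Type _ :=
  (x : M) → (TangentSpace (𝓡 3) x →L[ℝ] TangentSpace (𝓡 3) x)

/-- Smoothness of a 1-form, as a section of the cotangent bundle. -/
def SmoothOneForm [IsManifold (𝓡 3) ∞ M] (lam : OneForm M) : Prop :=
  ContMDiff (𝓡 3) ((𝓡 3).prod 𝓘(ℝ, E3 →L[ℝ] ℝ)) ∞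
    (fun x ↦ Bundle.TotalSpace.mk' (E3 →L[ℝ] ℝ)
      (E := fun x : M ↦ (TangentSpace (𝓡 3) x →L[ℝ] Bundle.Trivial M ℝ x)) x (lam x))

/-- Smoothness of a field of endomorphisms, as a section of `Hom(TM, TM)`. -/
def SmoothEndField [IsManifold (𝓡 3) ∞ M] (J : EndField M) : Prop :=
  ContMDiff (𝓡 3) ((𝓡 3).prod 𝓘(ℝ, E3 →L[ℝ] E3)) ∞
    (fun x ↦ Bundle.TotalSpace.mk' (E3 →L[ℝ] E3)
      (E := fun x : M ↦ (TangentSpace (𝓡 3) x →L[ℝ] TangentSpace (𝓡 3) x)) x (J x))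

/-- The expression `(e⁻¹)^* lam` of a 1-form in the chart `e` of `M` centred at `x`. -/
def chartForm (lam : OneForm M) (x : M) (y : E3) : E3 →L[ℝ] ℝ :=
  (lam ((extChartAt (𝓡 3) x).symm y)).comp
    (mfderiv 𝓘(ℝ, E3) (𝓡 3) (extChartAt (𝓡 3) x).symm y)

/-- The exterior derivative `(d lam)_x (v, w)`, computed in the chart of `M` at `x`. -/
def extD (lam : OneForm M) (x : M) (v w : TangentSpace (𝓡 3) x) : ℝ :=
  fderiv ℝ (chartForm lam x) (extChartAt (𝓡 3) x x)
      (mfderiv (𝓡 3) 𝓘(ℝ, E3) (extChartAt (𝓡 3) x) x v)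
      (mfderiv (𝓡 3) 𝓘(ℝ, E3) (extChartAt (𝓡 3) x) x w)
    - fderiv ℝ (chartForm lam x) (extChartAt (𝓡 3) x x)
      (mfderiv (𝓡 3) 𝓘(ℝ, E3) (extChartAt (𝓡 3) x) x w)
      (mfderiv (𝓡 3) 𝓘(ℝ, E3) (extChartAt (𝓡 3) x) x v)

/-- A contact form: a smooth 1-form for which `lam ∧ d lam` vanishes nowhere. -/
structure IsContactForm [IsManifold (𝓡 3) ∞ M] (lam : OneForm M) : Prop where
  smooth : SmoothOneForm lam
  nondeg : ∀ x, ∃ v₁ v₂ v₃ : TangentSpace (𝓡 3) x,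
    lam x v₁ * extD lam x v₂ v₃ + lam x v₂ * extD lam x v₃ v₁
      + lam x v₃ * extD lam x v₁ v₂ ≠ 0

/-- The Reeb vector field: the unique `X` with `lam X = 1` and `d lam (X, ·) = 0`
(for a contact form these equations have exactly one solution at each point). -/
def reeb (lam : OneForm M) (x : M) : TangentSpace (𝓡 3) x :=
  Classical.epsilon fun X ↦ lam x X = 1 ∧ ∀ v, extD lam x X v = 0

/-- The set `𝒥(lam)` of `d lam`-compatible complex structures on `ξ = ker lam`. The bundle map
`J : ξ → ξ` is recorded as an endomorphism of `TM` by putting `J = 0` on the Reeb direction. -/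
structure IsCompatible [IsManifold (𝓡 3) ∞ M] (lam : OneForm M) (J : EndField M) : Prop where
  smooth : SmoothEndField J
  reeb : ∀ x, J x (reeb lam x) = 0
  mem_ker : ∀ x v, lam x v = 0 → lam x (J x v) = 0
  sq : ∀ x v, lam x v = 0 → J x (J x v) = -v
  symm : ∀ x v w, lam x v = 0 → lam x w = 0 → extD lam x v (J x w) = extD lam x w (J x v)
  pos : ∀ x v, lam x v = 0 → v ≠ 0 → 0 < extD lam x v (J x v)

/-- `(w, T)` is a periodic orbit of the Reeb flow. -/
def IsPeriodicOrbit (lam : OneForm M) (w : ℝ → M) (T : ℝ) : Prop :=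
  IsMIntegralCurve (I := 𝓡 3) w (reeb lam) ∧ 0 < T ∧ ∀ t, w (t + T) = w t

/-- The contact plane `ξ = ker lam` at `x`, as a subspace of the model space of `T_x M`. -/
def contactPlane (lam : OneForm M) (x : M) : Submodule ℝ E3 :=
  LinearMap.ker (R := ℝ) (M := E3) (lam x).toLinearMap

/-- A periodic orbit `(w, T)` is hyperbolic if the linearised time-`T` map of the Reeb flow at
`w 0`, restricted to the contact plane, has no eigenvalue on the unit circle. Here `F` is the
time-`T` map of the Reeb flow, near `w 0`, and `A` is the restriction of its derivative. -/
def IsHyperbolicOrbit (lam : OneForm M) (w : ℝ → M) (T : ℝ) : Prop :=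
  ∃ F : M → M,
    (∀ᶠ y in 𝓝 (w 0), ∃ γ : ℝ → M, γ 0 = y ∧ γ T = F y ∧
      IsMIntegralCurveOn (I := 𝓡 3) γ (reeb lam) (Icc 0 T)) ∧
    MDifferentiableAt (𝓡 3) (𝓡 3) F (w 0) ∧
    ∃ A : contactPlane lam (w 0) →ₗ[ℝ] contactPlane lam (w 0),
      (∀ v, (A v : E3) = mfderiv (𝓡 3) (𝓡 3) F (w 0) (v : E3)) ∧
      ∀ μ : ℂ, (A.charpoly.map (algebraMap ℝ ℂ)).IsRoot μ → ‖μ‖ ≠ 1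

/-- The almost complex structure `J̃ = (lam, J)` of the symplectization `ℝ × M`,
`J̃ (h, k) = (-lam k, J (π k) + h X)`, where `π k = k - (lam k) X` and `X` is the Reeb field. -/
def symplectizationJ (lam : OneForm M) (J : EndField M) (x : M)
    (hk : ℝ × TangentSpace (𝓡 3) x) : ℝ × TangentSpace (𝓡 3) x :=
  (-lam x hk.2, J x (hk.2 - lam x hk.2 • reeb lam x) + hk.1 • reeb lam x)

/-- `(a, u) : ℂ → ℝ × M` is smooth and `J̃ ∘ d(a, u) = d(a, u) ∘ i`. -/
structure IsHolomorphicPlane [IsManifold (𝓡 3) ∞ M] (lam : OneForm M) (J : EndField M)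
    (a : ℂ → ℝ) (u : ℂ → M) : Prop where
  smooth_fst : ContDiff ℝ ∞ a
  smooth_snd : ContMDiff 𝓘(ℝ, ℂ) (𝓡 3) ∞ u
  holo : ∀ z ζ : ℂ,
    symplectizationJ lam J (u z) (fderiv ℝ a z ζ, mfderiv 𝓘(ℝ, ℂ) (𝓡 3) u z ζ) =
      (fderiv ℝ a z (Complex.I * ζ), mfderiv 𝓘(ℝ, ℂ) (𝓡 3) u z (Complex.I * ζ))

/-- The coefficient of `ds ∧ dt` in the pull-back by `(a, u)` of
`d (ψ(a) lam) = ψ'(a) da ∧ lam + ψ(a) d lam`. -/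
def energyDensity (lam : OneForm M) (ψ : ℝ → ℝ) (a : ℂ → ℝ) (u : ℂ → M) (z : ℂ) : ℝ :=
  deriv ψ (a z) *
      (fderiv ℝ a z 1 * lam (u z) (mfderiv 𝓘(ℝ, ℂ) (𝓡 3) u z Complex.I)
        - fderiv ℝ a z Complex.I * lam (u z) (mfderiv 𝓘(ℝ, ℂ) (𝓡 3) u z (1 : ℂ)))
    + ψ (a z) * extD lam (u z) (mfderiv 𝓘(ℝ, ℂ) (𝓡 3) u z (1 : ℂ))
        (mfderiv 𝓘(ℝ, ℂ) (𝓡 3) u z Complex.I)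

/-- The Hofer energy `sup_ψ ∫ (a, u)^* d(ψ lam)` over smooth `ψ : ℝ → [0, 1]` with `ψ' ≥ 0`.
The density is nonnegative for pseudo-holomorphic maps. -/
def energy (lam : OneForm M) (a : ℂ → ℝ) (u : ℂ → M) : ENNReal :=
  ⨆ (ψ : ℝ → ℝ) (_ : ContDiff ℝ ∞ ψ ∧ (∀ x, ψ x ∈ Icc (0 : ℝ) 1) ∧ ∀ x, 0 ≤ deriv ψ x),
    ∫⁻ z : ℂ, ENNReal.ofReal (energyDensity lam ψ a u z)

/-- A finite energy plane `(a, u) : ℂ → ℝ × M` for `J̃ = (lam, J)`. -/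
structure IsFiniteEnergyPlane [IsManifold (𝓡 3) ∞ M] (lam : OneForm M) (J : EndField M)
    (a : ℂ → ℝ) (u : ℂ → M) : Prop extends IsHolomorphicPlane lam J a u where
  energy_pos : 0 < energy lam a u
  energy_lt_top : energy lam a u < ⊤

/-- The cylindrical coordinates `(s, t) ↦ e^{2π(s + it)}` on `ℂ \ {0}`. -/
def cyl (s t : ℝ) : ℂ := Complex.exp (2 * Real.pi * (s + t * Complex.I))

/-- The plane `(a, u)` is asymptotic to `(w, T)` at its positive puncture `∞`: `a → +∞`, and the
loops `t ↦ u(e^{2π(s + it)})` converge in `C^∞(S¹, M)` to `t ↦ w(T t)`, up to a shift of `w`,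
as `s → +∞`. Convergence in `C^∞` is tested by the smooth functions on `M`. -/
def IsAsymptoticTo (a : ℂ → ℝ) (u : ℂ → M) (w : ℝ → M) (T : ℝ) : Prop :=
  Tendsto a (cocompact ℂ) atTop ∧
  ∃ c : ℝ, ∀ g : M → ℝ, ContMDiff (𝓡 3) 𝓘(ℝ, ℝ) ∞ g → ∀ k : ℕ,
    TendstoUniformly (fun s t : ℝ ↦ iteratedDeriv k (fun t' : ℝ ↦ g (u (cyl s t'))) t)
      (fun t : ℝ ↦ iteratedDeriv k (fun t' : ℝ ↦ g (w (T * t' + c))) t) atTop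

end Manifold

/-! ### The Hamiltonian near a saddle-center -/

/-- The symplectic form `ω₀ = ∑ dpᵢ ∧ dqᵢ`. -/
def omega0 (v w : E4) : ℝ := v 2 * w 0 - v 0 * w 2 + (v 3 * w 1 - v 1 * w 3)

/-- The Liouville form `½ ∑ (pᵢ dqᵢ - qᵢ dpᵢ)` at `z`. -/
def liouville (z v : E4) : ℝ := (z 2 * v 0 - z 0 * v 2 + (z 3 * v 1 - z 1 * v 3)) / 2

/-- The involution `T (q₁, q₂, p₁, p₂) = (-q₁, q₂, -p₁, p₂)`. -/
def flipT (z : E4) : E4 := !₂[-z 0, z 1, -z 2, z 3]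

/-- `φ` gives canonical coordinates near the saddle-center `pc ∈ H⁻¹(0)` in which `H` equals
`-α I₁ + om I₂ + R(I₁, I₂)`, where `I₁ = q₁ p₁`, `I₂ = (q₂² + p₂²) / 2`, `R = O(I₁² + I₂²)`. -/
structure IsSaddleCenterNormalForm (H : E4 → ℝ) (pc : E4) (φ : OpenPartialHomeomorph E4 E4)
    (α om : ℝ) (R : ℝ × ℝ → ℝ) : Prop where
  zero_mem : (0 : E4) ∈ φ.source
  map_zero : φ 0 = pc
  smooth : ContDiffOn ℝ ∞ φ φ.source
  smooth_symm : ContDiffOn ℝ ∞ φ.symm φ.target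
  symplectic : ∀ z ∈ φ.source, ∀ v w, omega0 (fderiv ℝ φ z v) (fderiv ℝ φ z w) = omega0 v w
  alpha_pos : 0 < α
  omega_pos : 0 < om
  smooth_R : ∃ O ∈ 𝓝 (0 : ℝ × ℝ), ContDiffOn ℝ ∞ R O
  isBigO_R : R =O[𝓝 0] fun I : ℝ × ℝ ↦ I.1 ^ 2 + I.2 ^ 2
  normal_form : ∀ z ∈ φ.source, H (φ z) =
    -α * (z 0 * z 2) + om * ((z 1 ^ 2 + z 3 ^ 2) / 2) + R (z 0 * z 2, (z 1 ^ 2 + z 3 ^ 2) / 2)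

/-- The part of the energy level `K⁻¹(E)`, `K = H ∘ φ`, in the ball of radius `δ` about `0`. -/
def localLevel (H : E4 → ℝ) (φ : E4 → E4) (E δ : ℝ) : Set E4 :=
  {z | z ∈ Metric.ball (0 : E4) δ ∧ H (φ z) = E}

/-- `∂S_E` in local coordinates: `{q₁ + p₁ = 0} ∩ K⁻¹(E)`. -/
def boundarySphere (H : E4 → ℝ) (φ : E4 → E4) (E δ : ℝ) : Set E4 :=
  {z | z ∈ localLevel H φ E δ ∧ z 0 + z 2 = 0}

/-- The hemisphere `U_{1,E} = {q₁ + p₁ = 0, q₁ < 0} ∩ K⁻¹(E)` in local coordinates. -/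
def hemisphere₁ (H : E4 → ℝ) (φ : E4 → E4) (E δ : ℝ) : Set E4 :=
  {z | z ∈ localLevel H φ E δ ∧ z 0 + z 2 = 0 ∧ z 0 < 0}

/-- The hemisphere `U_{2,E} = {q₁ + p₁ = 0, q₁ > 0} ∩ K⁻¹(E)` in local coordinates. -/
def hemisphere₂ (H : E4 → ℝ) (φ : E4 → E4) (E δ : ℝ) : Set E4 :=
  {z | z ∈ localLevel H φ E δ ∧ z 0 + z 2 = 0 ∧ 0 < z 0}

/-- `S` is a smoothly embedded closed 3-ball in `ℝ⁴` with boundary sphere `B`. -/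
def IsEmbeddedClosedBall (S B : Set E4) : Prop :=
  ∃ e : E3 → E4, ContDiffOn ℝ ∞ e (Metric.closedBall 0 1) ∧
    InjOn e (Metric.closedBall 0 1) ∧
    (∀ x ∈ Metric.closedBall (0 : E3) 1,
      Function.Injective (fderivWithin ℝ e (Metric.closedBall 0 1) x)) ∧
    e '' Metric.closedBall 0 1 = S ∧ e '' Metric.sphere 0 1 = B

/-- `S = S_E` is an embedded closed 3-ball in `H⁻¹(E)` which in the local coordinates (the ball of
radius `δ`) is `{q₁ + p₁ ≥ 0} ∩ K⁻¹(E)`, and whose boundary is `{q₁ + p₁ = 0} ∩ K⁻¹(E)`. -/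
structure IsEnergyBall (H : E4 → ℝ) (φ : E4 → E4) (E δ : ℝ) (S : Set E4) : Prop where
  level : ∀ x ∈ S, H x = E
  ball : IsEmbeddedClosedBall S (φ '' boundarySphere H φ E δ)
  local_eq : S ∩ φ '' Metric.ball 0 δ = φ '' {z | z ∈ localLevel H φ E δ ∧ 0 ≤ z 0 + z 2}

/-! ### The closed manifold `W_E`, glued from two copies of `S_E` -/

section Gluing

variable {W : Type*} [TopologicalSpace W] [ChartedSpace E3 W]

/-- `f`, defined on the hypersurface `C ⊆ ℝ⁴`, is a diffeomorphism of `C` onto an open subset of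
the 3-manifold `W`, with inverse `g`; the latter is a smooth embedding of this open set into
`ℝ⁴`, with image `C`. -/
structure IsDiffeoOnto (C : Set E4) (f : E4 → W) (g : W → E4) : Prop where
  isOpen_image : IsOpen (f '' C)
  leftInv : ∀ z ∈ C, g (f z) = z
  continuousOn : ContinuousOn f C
  smooth_inv : ContMDiffOn (𝓡 3) 𝓘(ℝ, E4) ∞ g (f '' C)
  immersion : ∀ x ∈ f '' C, Function.Injective (mfderiv (𝓡 3) 𝓘(ℝ, E4) g x)

/-- The local coordinates near `∂S_E` in `W_E`: the points with `q₁ + p₁ ≥ 0` lie in the first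
copy of `S_E`; the points with `q₁ + p₁ ≤ 0` lie in the second copy and represent the points `T z`
of `S_E`. -/
def neck (φ : E4 → E4) (ι₀ ι₁ : E4 → W) (z : E4) : W :=
  open Classical in if 0 ≤ z 0 + z 2 then ι₀ (φ z) else ι₁ (φ (flipT z))

/-- `W` is the manifold `W_E`: the union of two copies `ι₀(S)`, `ι₁(S)` of `S`, whose boundaries are
identified by `T` (in local coordinates), with the smooth structure for which the inclusions of
the two copies of the open ball, and the local coordinates near the common boundary, are
diffeomorphisms onto open sets. The map `κ` is the inverse of the local coordinates. -/
structure IsGluedDouble (H : E4 → ℝ) (φ : E4 → E4) (E δ : ℝ) (S : Set E4)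
    (ι₀ ι₁ : E4 → W) (κ : W → E4) : Prop where
  cover : ι₀ '' S ∪ ι₁ '' S = univ
  inj₀ : InjOn ι₀ S
  inj₁ : InjOn ι₁ S
  glue : ∀ x ∈ S, ∀ y ∈ S, ι₀ x = ι₁ y ↔
    ∃ z ∈ boundarySphere H φ E δ, x = φ z ∧ y = φ (flipT z)
  interior₀ : ∃ g, IsDiffeoOnto (S \ φ '' boundarySphere H φ E δ) ι₀ g
  interior₁ : ∃ g, IsDiffeoOnto (S \ φ '' boundarySphere H φ E δ) ι₁ g
  collar : IsDiffeoOnto (localLevel H φ E δ) (neck φ ι₀ ι₁) κ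

/-- Near `∂S_E`, the 1-form `lam` on `W` is the restriction to `K⁻¹(E)` of the Liouville form in
the local coordinates `κ`. -/
def IsLiouvilleNearBoundary (H : E4 → ℝ) (φ : E4 → E4) (E δ : ℝ) (ι₀ ι₁ : E4 → W) (κ : W → E4)
    (lam : OneForm W) : Prop :=
  ∀ᶠ x in 𝓝ˢ (neck φ ι₀ ι₁ '' boundarySphere H φ E δ), ∀ v : TangentSpace (𝓡 3) x,
    lam x v = liouville (κ x) (mfderiv (𝓡 3) 𝓘(ℝ, E4) κ x v)

/-- The orbit `t ↦ (0, r cos(2πt/T), 0, -r sin(2πt/T))` in local coordinates. -/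
def equatorOrbit (φ : E4 → E4) (ι₀ ι₁ : E4 → W) (r T : ℝ) (t : ℝ) : W :=
  neck φ ι₀ ι₁ !₂[0, r * Real.cos (2 * Real.pi * (t / T)), 0,
    -(r * Real.sin (2 * Real.pi * (t / T)))]

/-- The plane `(a, u)` is given in cylindrical coordinates by
`u = (-h(s), f(s) cos 2πt, h(s), -f(s) sin 2πt)` (in local coordinates, on the level `K = E`) and
`a = π ∫₀ˢ f²`, where `f > 0` and `h` solves the equation
`h' = -2π A B h f² / (B² f² + 2 A² h²)`, with `A = α - ∂R/∂I₁`, `B = om + ∂R/∂I₂` evaluated at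
`(I₁, I₂) = (-h², f²/2)`. -/
def IsExplicitPlane (H : E4 → ℝ) (φ : E4 → E4) (α om : ℝ) (R : ℝ × ℝ → ℝ) (E δ : ℝ)
    (ι₀ ι₁ : E4 → W) (a : ℂ → ℝ) (u : ℂ → W) : Prop :=
  ∃ h f A B : ℝ → ℝ, ContDiff ℝ ∞ h ∧ ContDiff ℝ ∞ f ∧
    (∀ s, 0 < f s) ∧
    (∀ s, A s = α - fderiv ℝ R (-(h s) ^ 2, (f s) ^ 2 / 2) (1, 0)) ∧
    (∀ s, B s = om + fderiv ℝ R (-(h s) ^ 2, (f s) ^ 2 / 2) (0, 1)) ∧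
    (∀ s, B s ^ 2 * f s ^ 2 + 2 * A s ^ 2 * h s ^ 2 ≠ 0) ∧
    (∀ s, HasDerivAt h (-(2 * Real.pi * A s * B s * h s * f s ^ 2) /
      (B s ^ 2 * f s ^ 2 + 2 * A s ^ 2 * h s ^ 2)) s) ∧
    ∀ s t : ℝ,
      !₂[-h s, f s * Real.cos (2 * Real.pi * t), h s, -(f s * Real.sin (2 * Real.pi * t))] ∈
        localLevel H φ E δ ∧
      u (cyl s t) = neck φ ι₀ ι₁ !₂[-h s, f s * Real.cos (2 * Real.pi * t), h s,
        -(f s * Real.sin (2 * Real.pi * t))] ∧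
      a (cyl s t) = Real.pi * ∫ τ in (0 : ℝ)..s, f τ ^ 2

end Gluing

end Contact

end

open Set Filter
open scoped Manifold ContDiff Topology

noncomputable section

namespace Contact

/-! ### Linear algebra of a contact structure on a 3-dimensional vector space -/

section LinearAlgebra

/-! Near the saddle-center the energy depends on the actions alone, so on {q₁ + p₁ = 0} everything
is governed by the curve K = E in the quadrant x = h² ≥ 0, y = f² ≥ 0, where I₁ = -x and I₂ = y/2.
The bounds on the derivatives of R in `IsGoodBox` make K strictly increasing in x and in y, and for
small E the curve is a graph y = Y(x) running from (0, r²), which is the orbit, to (x₀, 0), which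
gives the poles of the two hemispheres (`IsGoodBox.exists_levelGraph`).

The orbit. The Reeb field is the Hamiltonian field divided by the value of the Liouville form on it.
The actions are conserved, so the flow has the closed form `flowModel`. On the equator it is a
rotation of period πr². The contact plane there is the (q₁, p₁)-plane, and the return map on it is
diag(e^{-c}, e^c) with c > 0.

The planes. In the rotationally symmetric ansatz u_s lies in ξ and a_s = λ(u_t) = πf², so
holomorphicity reduces to J u_s = π u_t, with π the projection to ξ along the Reeb field. Now J may
be chosen, and a compatible J on an oriented plane is the same thing as a conformal class of inner
products (`conformalJ`). Hence it suffices to find a metric for which u_s and π u_t are orthogonal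
and of equal length on both hemispheres, and to know that dλ(u_s, u_t) > 0
(`IsPlaneModel.area_pos`). In the diagonal metric `neckMetric` orthogonality comes from the equal
coefficients of dq₁², dp₁² and of dq₂², dp₂². Equality of the lengths, once h solves the prescribed
equation, is a single condition on the ratio of the two coefficients, and it has a smooth positive
solution (`plane_coeff`, `plane_metric`). A cut-off function extends the metric to W
(`IsLevelCollar.exists_metric`), so nothing has to be known about λ away from the neck.

Smoothness at z = 0. With y = Y(h²) inserted, the equation for h is separable. Solving for τ = |z|²
= e^{4πs} as a function of h and inverting gives h = ±η(τ) and f = |z| m(τ) with η and m smooth up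
to τ = 0 (`IsLevelGraph.exists_profile`), so the cylinder closes up to a smooth plane.

Energy and asymptotics. The energy density is radial and is the τ-derivative of ψ(a) f², which
bounds the energy. The loops form a family that is smooth in (h, t) up to h = 0, where it is the
orbit; since h → 0, they converge with all derivatives. -/

/-- The value of `l ∧ Ω`. -/
def wedge (l : E3 →L[ℝ] ℝ) (Ω : E3 →L[ℝ] E3 →L[ℝ] ℝ) (u v w : E3) : ℝ :=
  l u * Ω v w + l v * Ω w u + l w * Ω u v

/-- `Ω` is alternating and `l ∧ Ω ≠ 0`. -/
structure IsContactPair (l : E3 →L[ℝ] ℝ) (Ω : E3 →L[ℝ] E3 →L[ℝ] ℝ) : Prop where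
  alt : ∀ v w, Ω v w = -Ω w v
  nondeg : ∃ u v w, wedge l Ω u v w ≠ 0

variable {l : E3 →L[ℝ] ℝ} {Ω G : E3 →L[ℝ] E3 →L[ℝ] ℝ}

/-- Cramer's rule for the alternating trilinear form l ∧ Ω. Its nonvanishing makes u, v, w a basis,
and both sides are compared in the coordinates of x. -/
lemma wedge_cramer (hΩ : ∀ v w, Ω v w = -Ω w v) {u v w : E3} (h : wedge l Ω u v w ≠ 0) (x : E3) :
    wedge l Ω u v w • x =
      wedge l Ω x v w • u + wedge l Ω u x w • v + wedge l Ω u v x • w := by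
  have h0 : ∀ v, Ω v v = 0 := fun v ↦ by linarith [hΩ v v]
  have hli : LinearIndependent ℝ ![u, v, w] := by
    rw [Fintype.linearIndependent_iff]
    intro c hc
    simp only [Fin.sum_univ_three, Matrix.cons_val_zero, Matrix.cons_val_one,
      Matrix.cons_val_two, Matrix.head_cons, Matrix.tail_cons] at hc
    have e1 : wedge l Ω (c 0 • u + c 1 • v + c 2 • w) v w = 0 := by
      rw [hc]; simp [wedge]
    have e2 : wedge l Ω u (c 0 • u + c 1 • v + c 2 • w) w = 0 := by
      rw [hc]; simp [wedge]
    have e3 : wedge l Ω u v (c 0 • u + c 1 • v + c 2 • w) = 0 := by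
      rw [hc]; simp [wedge]
    have k1 : c 0 * wedge l Ω u v w = 0 := by
      rw [← e1]; simp [wedge, h0]; rw [hΩ w v]; ring
    have k2 : c 1 * wedge l Ω u v w = 0 := by
      rw [← e2]; simp [wedge, h0]; rw [hΩ u w]; ring
    have k3 : c 2 * wedge l Ω u v w = 0 := by
      rw [← e3]; simp [wedge, h0]; rw [hΩ v u]; ring
    intro i
    fin_cases i
    · exact (mul_eq_zero.1 k1).resolve_right h
    · exact (mul_eq_zero.1 k2).resolve_right h
    · exact (mul_eq_zero.1 k3).resolve_right h
  let b := basisOfLinearIndependentOfCardEqFinrank hli (by simp)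
  have hb : ⇑b = ![u, v, w] := coe_basisOfLinearIndependentOfCardEqFinrank _ _
  have hx := b.sum_repr x
  set c := b.repr x
  simp only [Fin.sum_univ_three, hb, Matrix.cons_val_zero, Matrix.cons_val_one,
      Matrix.cons_val_two, Matrix.head_cons, Matrix.tail_cons] at hx
  have k1 : wedge l Ω x v w = c 0 * wedge l Ω u v w := by
    rw [← hx]; simp [wedge, h0]; rw [hΩ w v]; ring
  have k2 : wedge l Ω u x w = c 1 * wedge l Ω u v w := by
    rw [← hx]; simp [wedge, h0]; rw [hΩ u w]; ring
  have k3 : wedge l Ω u v x = c 2 * wedge l Ω u v w := by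
    rw [← hx]; simp [wedge, h0]; rw [hΩ v u]; ring
  rw [k1, k2, k3]
  nth_rewrite 1 [← hx]
  module

lemma eq_zero_of_wedge (hΩ : ∀ v w, Ω v w = -Ω w v) {u v w : E3} (h : wedge l Ω u v w ≠ 0)
    {x : E3} (hl : l x = 0) (hx : ∀ y, Ω x y = 0) : x = 0 := by
  have hx' : ∀ y, Ω y x = 0 := fun y ↦ by rw [hΩ, hx, neg_zero]
  have := wedge_cramer hΩ h x
  simp only [wedge, hl, hx, hx'] at this h
  simpa [h] using this

/-- The map `v ↦ Ω(·, v) + l(v) l`, an isomorphism for a contact pair. -/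
def musical (l : E3 →L[ℝ] ℝ) (Ω : E3 →L[ℝ] E3 →L[ℝ] ℝ) : E3 →L[ℝ] E3 →L[ℝ] ℝ :=
  l.smulRight l - Ω

lemma musical_apply (x v : E3) : musical l Ω x v = l x * l v - Ω x v := by
  simp [musical]

/-- If x is in the kernel then `l x * l y = Ω x y` for all y; taking y = x gives l x = 0, hence Ω x
= 0, hence x = 0. Invertibility lets the Reeb vector and J be written through operator inversion,
which is smooth. -/
lemma IsContactPair.exists_equiv (h : IsContactPair l Ω) :
    ∃ e : E3 ≃L[ℝ] (E3 →L[ℝ] ℝ), (e : E3 →L[ℝ] E3 →L[ℝ] ℝ) = musical l Ω := by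
  obtain ⟨u, v, w, hw⟩ := h.nondeg
  have hinj : Function.Injective (musical l Ω : E3 →ₗ[ℝ] E3 →L[ℝ] ℝ) := by
    rw [← LinearMap.ker_eq_bot, LinearMap.ker_eq_bot']
    intro x hx
    have h1 : ∀ y, l x * l y - Ω x y = 0 := fun y ↦ by
      rw [← musical_apply]
      exact DFunLike.congr_fun hx y
    have h0 : l x = 0 := by
      have := h1 x
      have h2 := h.alt x x
      nlinarith
    exact eq_zero_of_wedge h.alt hw h0 fun y ↦ by have := h1 y; rw [h0] at this; linarith
  have hd : Module.finrank ℝ E3 = Module.finrank ℝ (E3 →L[ℝ] ℝ) := by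
    rw [← (LinearMap.toContinuousLinearMap (𝕜 := ℝ) (E := E3) (F' := ℝ)).finrank_eq]
    simp
  refine ⟨(LinearEquiv.ofInjectiveOfFinrankEq _ hinj hd).toContinuousLinearEquiv, ?_⟩
  ext x y
  rfl

/-- The Reeb vector of a contact pair. -/
def reebVec (l : E3 →L[ℝ] ℝ) (Ω : E3 →L[ℝ] E3 →L[ℝ] ℝ) : E3 := (musical l Ω).inverse l

lemma IsContactPair.musical_inverse (h : IsContactPair l Ω) (f : E3 →L[ℝ] ℝ) :
    musical l Ω ((musical l Ω).inverse f) = f := by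
  obtain ⟨e, he⟩ := h.exists_equiv
  rw [← he]; simp

lemma IsContactPair.musical_injective (h : IsContactPair l Ω) :
    Function.Injective (musical l Ω) := by
  obtain ⟨e, he⟩ := h.exists_equiv
  rw [← he]
  exact e.injective

lemma IsContactPair.eq_reebVec (h : IsContactPair l Ω) {x : E3} (h1 : l x = 1)
    (h2 : ∀ v, Ω x v = 0) : x = reebVec l Ω := by
  apply h.musical_injective
  rw [reebVec, h.musical_inverse]
  ext v
  rw [musical_apply, h1, h2]; ring

/-- Evaluating the defining equation on the Reeb vector itself gives l(X)² = l(X), so only the value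
0 has to be excluded. -/
lemma IsContactPair.reebVec_spec (h : IsContactPair l Ω) :
    l (reebVec l Ω) = 1 ∧ ∀ v, Ω (reebVec l Ω) v = 0 := by
  obtain ⟨u, v, w, hw⟩ := h.nondeg
  have h1 : ∀ v, l (reebVec l Ω) * l v - Ω (reebVec l Ω) v = l v := fun v ↦ by
    rw [← musical_apply, reebVec, h.musical_inverse]
  have h2 : l (reebVec l Ω) * l (reebVec l Ω) = l (reebVec l Ω) := by
    have := h1 (reebVec l Ω)
    have := h.alt (reebVec l Ω) (reebVec l Ω)
    linarith
  have h3 : l (reebVec l Ω) = 1 := by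
    rcases eq_or_ne (l (reebVec l Ω)) 0 with h0 | h0
    -- With l X = 0 the equation reads Ω(X, ·) = -l. Then l ∧ Ω vanishes whenever X is one of the
    -- arguments, so X = 0 by Cramer's rule, and l = 0.
    · exfalso
      have hΩ : ∀ v, Ω (reebVec l Ω) v = -l v := fun v ↦ by have := h1 v; rw [h0] at this; linarith
      have hΩ' : ∀ v, Ω v (reebVec l Ω) = l v := fun v ↦ by rw [h.alt, hΩ, neg_neg]
      have := wedge_cramer h.alt hw (reebVec l Ω)
      have e1 : ∀ a b, wedge l Ω (reebVec l Ω) a b = 0 := fun a b ↦ by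
        simp only [wedge, h0, hΩ, hΩ']; ring
      have e2 : ∀ a b, wedge l Ω a (reebVec l Ω) b = 0 := fun a b ↦ by
        simp only [wedge, h0, hΩ, hΩ']; ring
      have e3 : ∀ a b, wedge l Ω a b (reebVec l Ω) = 0 := fun a b ↦ by
        simp only [wedge, h0, hΩ, hΩ']; ring
      rw [e1, e2, e3] at this
      simp only [zero_smul, add_zero, smul_eq_zero, hw, false_or] at this
      have hl : ∀ v, l v = 0 := fun v ↦ by rw [← hΩ', this]; simp
      exact hw (by simp [wedge, hl])
    · exact mul_left_cancel₀ h0 (by linarith)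
  exact ⟨h3, fun v ↦ by have := h1 v; rw [h3] at this; linarith⟩

/-- The projection to `ker l` along the Reeb vector. -/
def contactProj (l : E3 →L[ℝ] ℝ) (Ω : E3 →L[ℝ] E3 →L[ℝ] ℝ) : E3 →L[ℝ] E3 :=
  ContinuousLinearMap.id ℝ E3 - l.smulRight (reebVec l Ω)

lemma contactProj_apply (x : E3) : contactProj l Ω x = x - l x • reebVec l Ω := by
  simp [contactProj]

/-- The endomorphism of `ker l` relating `G` and `Ω`: `Ω(v, A w) = G(v, w)` on `ker l`. -/
def relEnd (l : E3 →L[ℝ] ℝ) (Ω G : E3 →L[ℝ] E3 →L[ℝ] ℝ) : E3 →L[ℝ] E3 :=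
  (musical l Ω).inverse.comp
    (((ContinuousLinearMap.compL ℝ E3 E3 ℝ).flip (contactProj l Ω)).comp
      (G.comp (contactProj l Ω)))

/-- The trace of `A²`. -/
def traceSq (A : E3 →L[ℝ] E3) : ℝ :=
  LinearMap.trace ℝ E3 ((A.comp A : E3 →L[ℝ] E3) : E3 →ₗ[ℝ] E3)

/-- The complex structure on `ker l` for which `G` is conformal to `Ω(·, J ·)`. -/
def conformalJ (l : E3 →L[ℝ] ℝ) (Ω G : E3 →L[ℝ] E3 →L[ℝ] ℝ) : E3 →L[ℝ] E3 :=
  Real.sqrt (-2 / traceSq (relEnd l Ω G)) • relEnd l Ω G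

/-- The projection kills the Reeb vector, so testing the defining equation against it leaves l(A w)
= 0; the rest of that equation is the relation between Ω and G. -/
lemma IsContactPair.relEnd_spec (h : IsContactPair l Ω) (w : E3) :
    l (relEnd l Ω G w) = 0 ∧
    ∀ v, Ω v (relEnd l Ω G w) = G (contactProj l Ω w) (contactProj l Ω v) := by
  have h1 : ∀ v, l (relEnd l Ω G w) * l v + Ω v (relEnd l Ω G w) =
      G (contactProj l Ω w) (contactProj l Ω v) := fun v ↦ by
    rw [h.alt v, ← sub_eq_add_neg, ← musical_apply]
    simp only [relEnd, ContinuousLinearMap.comp_apply, h.musical_inverse]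
    simp
  have hR := h.reebVec_spec
  have h2 : l (relEnd l Ω G w) = 0 := by
    have := h1 (reebVec l Ω)
    rw [h.alt _ (relEnd l Ω G w), ← neg_neg (Ω _ _), ← h.alt, hR.2, hR.1, contactProj_apply (reebVec l Ω), hR.1] at this
    simpa using this
  exact ⟨h2, fun v ↦ by rw [← h1, h2]; ring⟩

lemma IsContactPair.eq_relEnd (h : IsContactPair l Ω) {w x : E3} (hx : l x = 0)
    (hΩ : ∀ v, Ω v x = G (contactProj l Ω w) (contactProj l Ω v)) : x = relEnd l Ω G w := by
  apply h.musical_injective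
  ext v
  have := h.relEnd_spec (G := G) w
  rw [musical_apply, musical_apply, hx, this.1, h.alt x, h.alt (relEnd l Ω G w), hΩ, this.2]

lemma contactProj_of_ker {v : E3} (hv : l v = 0) : contactProj l Ω v = v := by
  simp [contactProj_apply, hv]

lemma IsContactPair.contactProj_mem (h : IsContactPair l Ω) (v : E3) :
    l (contactProj l Ω v) = 0 := by
  simp [contactProj_apply, h.reebVec_spec.1]

lemma IsContactPair.relEnd_contactProj (h : IsContactPair l Ω) (w : E3) :
    relEnd l Ω G (contactProj l Ω w) = relEnd l Ω G w := by
  apply h.eq_relEnd (h.relEnd_spec _).1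
  intro v
  rw [(h.relEnd_spec _).2, contactProj_of_ker (h.contactProj_mem w)]

lemma IsContactPair.relEnd_reebVec (h : IsContactPair l Ω) :
    relEnd l Ω G (reebVec l Ω) = 0 := by
  rw [← h.relEnd_contactProj, contactProj_apply, h.reebVec_spec.1]
  simp

/-- `G` is an inner product on `ker l`. -/
structure IsKerMetric (l : E3 →L[ℝ] ℝ) (G : E3 →L[ℝ] E3 →L[ℝ] ℝ) : Prop where
  symm : ∀ v w, G v w = G w v
  pos : ∀ v, l v = 0 → v ≠ 0 → 0 < G v v

lemma IsContactPair.relEnd_form (h : IsContactPair l Ω) {v w : E3} (hv : l v = 0)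
    (hw : l w = 0) : Ω v (relEnd l Ω G w) = G w v := by
  rw [(h.relEnd_spec w).2, contactProj_of_ker hv, contactProj_of_ker hw]

/-- `v` and `A v` span `ker l`. -/
lemma IsContactPair.ker_expand (h : IsContactPair l Ω) {v w x : E3} (hv : l v = 0)
    (hw : l w = 0) (hvw : Ω v w ≠ 0) (hx : l x = 0) :
    x = (Ω x w / Ω v w) • v + (Ω v x / Ω v w) • w := by
  have hR := h.reebVec_spec
  have h1 : wedge l Ω (reebVec l Ω) v w = Ω v w := by
    simp [wedge, hR.1, hv, hw]
  have := wedge_cramer h.alt (h1 ▸ hvw) x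
  rw [h1] at this
  have e1 : wedge l Ω x v w = 0 := by simp [wedge, hv, hw, hx]
  have e2 : wedge l Ω (reebVec l Ω) x w = Ω x w := by simp [wedge, hR.1, hw, hx]
  have e3 : wedge l Ω (reebVec l Ω) v x = Ω v x := by simp [wedge, hR.1, hv, hx]
  rw [e1, e2, e3, zero_smul, zero_add] at this
  rw [div_eq_inv_mul, div_eq_inv_mul, mul_smul, mul_smul, ← smul_add, ← this, smul_smul,
    inv_mul_cancel₀ hvw, one_smul]

lemma IsContactPair.exists_ker_ne_zero (h : IsContactPair l Ω) : ∃ v, l v = 0 ∧ v ≠ 0 := by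
  obtain ⟨u, v, w, hw⟩ := h.nondeg
  by_contra! hc
  have hp : ∀ x, x = l x • reebVec l Ω := fun x ↦ by
    have := hc _ (h.contactProj_mem x)
    rwa [contactProj_apply, sub_eq_zero] at this
  apply hw
  have h0 : ∀ x y, Ω x y = 0 := fun x y ↦ by
    rw [hp x]; simp [h.reebVec_spec.2]
  simp [wedge, h0]

/-- Since G(v, A v) = Ω(A v, A v) = 0, the vectors v and A v form an orthogonal basis of the plane,
and A² is the scalar -G(A v, A v) / G(v, v). -/
lemma IsContactPair.exists_relEnd_sq (h : IsContactPair l Ω) (hG : IsKerMetric l G) :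
    ∃ q : ℝ, 0 < q ∧ ∀ v, l v = 0 → relEnd l Ω G (relEnd l Ω G v) = -q • v := by
  obtain ⟨v, hv, hv0⟩ := h.exists_ker_ne_zero
  set A := relEnd l Ω G with hA
  have hAl : ∀ w, l (A w) = 0 := fun w ↦ (h.relEnd_spec w).1
  have hform : ∀ {v w}, l v = 0 → l w = 0 → Ω v (A w) = G w v := fun hv hw ↦ h.relEnd_form hv hw
  have h0 : ∀ v, Ω v v = 0 := fun v ↦ by linarith [h.alt v v]
  have hpos := hG.pos v hv hv0
  have hvA : Ω v (A v) ≠ 0 := by rw [hform hv hv]; exact hpos.ne'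
  have hAv0 : A v ≠ 0 := fun h0 ↦ hvA (by rw [h0]; simp)
  have hposA := hG.pos (A v) (hAl v) hAv0
  have hort : G (A v) v = 0 := by rw [hG.symm, ← hform (hAl v) hv, h0]
  have hsq : A (A v) = -(G (A v) (A v) / G v v) • v := by
    rw [h.ker_expand hv (hAl v) hvA (hAl (A v)), hform hv (hAl v), hort, h.alt (A (A v)),
      hform (hAl v) (hAl v), hform hv hv]
    simp [neg_div]
  refine ⟨_, div_pos hposA hpos, fun w hw ↦ ?_⟩
  rw [h.ker_expand hv (hAl v) hvA hw]
  simp only [map_add, map_smul, hsq]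
  module

/-- A kills the Reeb vector, so A² is -q times the projection to the plane and has trace -2q. The
trace expresses the normalising factor smoothly in A, without choosing a vector. -/
lemma IsContactPair.relEnd_sq (h : IsContactPair l Ω) (hG : IsKerMetric l G) :
    traceSq (relEnd l Ω G) < 0 ∧ ∀ v, l v = 0 →
      relEnd l Ω G (relEnd l Ω G v) = (traceSq (relEnd l Ω G) / 2) • v := by
  obtain ⟨q, hq, hsq⟩ := h.exists_relEnd_sq hG
  have key : traceSq (relEnd l Ω G) = -2 * q := by
    have : (((relEnd l Ω G).comp (relEnd l Ω G) : E3 →L[ℝ] E3) : E3 →ₗ[ℝ] E3) =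
        -q • (LinearMap.id - (l : E3 →ₗ[ℝ] ℝ).smulRight (reebVec l Ω)) := by
      ext1 x
      have := hsq _ (h.contactProj_mem x)
      rw [h.relEnd_contactProj, contactProj_apply] at this
      simpa using this
    rw [traceSq, this, map_smul, map_sub, LinearMap.trace_smulRight]
    have : LinearMap.trace ℝ E3 LinearMap.id = 3 := by
      rw [LinearMap.trace_id]; simp
    rw [this]
    simp [h.reebVec_spec.1]; ring
  refine ⟨by rw [key]; linarith, fun v hv ↦ ?_⟩
  rw [hsq v hv, key]
  congr 1; ring

lemma IsContactPair.conformalJ_reebVec (h : IsContactPair l Ω) :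
    conformalJ l Ω G (reebVec l Ω) = 0 := by
  simp [conformalJ, h.relEnd_reebVec]

lemma IsContactPair.conformalJ_mem_ker (h : IsContactPair l Ω) (v : E3) :
    l (conformalJ l Ω G v) = 0 := by
  simp [conformalJ, (h.relEnd_spec v).1]

lemma IsContactPair.conformalJ_sq (h : IsContactPair l Ω) (hG : IsKerMetric l G) {v : E3}
    (hv : l v = 0) : conformalJ l Ω G (conformalJ l Ω G v) = -v := by
  obtain ⟨h1, h2⟩ := h.relEnd_sq hG
  have h3 : (0 : ℝ) ≤ -2 / traceSq (relEnd l Ω G) :=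
    div_nonneg_of_nonpos (by norm_num) h1.le
  simp only [conformalJ, smul_apply, map_smul, h2 v hv, smul_smul]
  rw [← mul_assoc, Real.mul_self_sqrt h3]
  have : -2 / traceSq (relEnd l Ω G) * (traceSq (relEnd l Ω G) / 2) = -1 := by
    field_simp [h1.ne]
  rw [this]; simp

lemma IsContactPair.conformalJ_symm (h : IsContactPair l Ω) (hG : IsKerMetric l G) {v w : E3}
    (hv : l v = 0) (hw : l w = 0) : Ω v (conformalJ l Ω G w) = Ω w (conformalJ l Ω G v) := by
  simp [conformalJ, h.relEnd_form hv hw, h.relEnd_form hw hv, hG.symm v w]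

lemma IsContactPair.conformalJ_pos (h : IsContactPair l Ω) (hG : IsKerMetric l G) {v : E3}
    (hv : l v = 0) (h0 : v ≠ 0) : 0 < Ω v (conformalJ l Ω G v) := by
  simp only [conformalJ, smul_apply, map_smul, h.relEnd_form hv hv, smul_eq_mul]
  exact mul_pos (Real.sqrt_pos.2 (div_pos_of_neg_of_neg (by norm_num) (h.relEnd_sq hG).1))
    (hG.pos v hv h0)

/-- `J v` is the vector orthogonal to `v`, of the same length, with `Ω (v, J v) > 0`. -/
lemma IsContactPair.conformalJ_eq (h : IsContactPair l Ω) (hG : IsKerMetric l G) {v w : E3}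
    (hv : l v = 0) (hw : l w = 0) (hort : G v w = 0) (hlen : G v v = G w w) (hpos : 0 < Ω v w) :
    conformalJ l Ω G v = w := by
  have hv0 : v ≠ 0 := by rintro rfl; simp at hpos
  obtain ⟨h1, h2⟩ := h.relEnd_sq hG
  set A := relEnd l Ω G with hA
  have hGv := hG.pos v hv hv0
  have hAl : l (A v) = 0 := (h.relEnd_spec v).1
  have h0 : Ω (A v) (A v) = 0 := by linarith [h.alt (A v) (A v)]
  have hvA : Ω v (A v) = G v v := h.relEnd_form hv hv
  have hGA : G v (A v) = 0 := by rw [← h.relEnd_form hAl hv, ← hA, h0]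
  have hGAA : G (A v) (A v) = -(traceSq A / 2) * G v v := by
    rw [← h.relEnd_form hAl hAl, ← hA, h2 v hv, map_smul, h.alt, hvA, smul_eq_mul]; ring
  -- In the basis v, A v orthogonality removes the first coefficient of w, equality of lengths fixes
  -- the square of the second, and Ω(v, w) > 0 fixes its sign.
  have hex := h.ker_expand hv hAl (by rw [hvA]; exact hGv.ne') hw
  set a := Ω w (A v) / Ω v (A v)
  set b := Ω v w / Ω v (A v) with hb
  have hbpos : 0 < b := div_pos hpos (by rw [hvA]; exact hGv)
  have ha : a = 0 := by
    rw [hex] at hort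
    simp only [map_add, map_smul, smul_eq_mul, hGA, mul_zero, add_zero] at hort
    exact (mul_eq_zero.1 hort).resolve_right hGv.ne'
  rw [ha, zero_smul, zero_add] at hex
  have hb2 : b * b = -2 / traceSq A := by
    rw [hex] at hlen
    simp only [map_smul, smul_apply, smul_eq_mul, hGAA] at hlen
    rw [eq_div_iff h1.ne]
    have : G v v * (1 - b * (b * -(traceSq A / 2))) = 0 := by linarith
    have := (mul_eq_zero.1 this).resolve_left hGv.ne'
    linarith
  rw [conformalJ, ← hA, ← hb2, Real.sqrt_mul_self hbpos.le, smul_apply, ← hex]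

/-- The pull-back of a bilinear form. -/
def bilinPull (Ω : E3 →L[ℝ] E3 →L[ℝ] ℝ) (D : E3 →L[ℝ] E3) : E3 →L[ℝ] E3 →L[ℝ] ℝ :=
  ((ContinuousLinearMap.compL ℝ E3 E3 ℝ).flip D).comp (Ω.comp D)

@[simp] lemma bilinPull_apply (D : E3 →L[ℝ] E3) (v w : E3) :
    bilinPull Ω D v w = Ω (D v) (D w) := by
  simp [bilinPull]

lemma IsContactPair.pull (h : IsContactPair l Ω) (D : E3 ≃L[ℝ] E3) :
    IsContactPair (l.comp (D : E3 →L[ℝ] E3)) (bilinPull Ω D) := by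
  refine ⟨fun v w ↦ by simp [h.alt (D v)], ?_⟩
  obtain ⟨u, v, w, hw⟩ := h.nondeg
  exact ⟨D.symm u, D.symm v, D.symm w, by simpa [wedge] using hw⟩

lemma IsContactPair.reebVec_pull (h : IsContactPair l Ω) (D : E3 ≃L[ℝ] E3) :
    D (reebVec (l.comp (D : E3 →L[ℝ] E3)) (bilinPull Ω D)) = reebVec l Ω := by
  obtain ⟨h1, h2⟩ := (h.pull D).reebVec_spec
  refine h.eq_reebVec (by simpa using h1) fun v ↦ ?_
  simpa using h2 (D.symm v)

lemma IsContactPair.relEnd_pull (h : IsContactPair l Ω) (D : E3 ≃L[ℝ] E3) (w : E3) :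
    D (relEnd (l.comp (D : E3 →L[ℝ] E3)) (bilinPull Ω D) (bilinPull G D) w) =
      relEnd l Ω G (D w) := by
  obtain ⟨h1, h2⟩ := (h.pull D).relEnd_spec (G := bilinPull G D) w
  have hp : ∀ v, D (contactProj (l.comp (D : E3 →L[ℝ] E3)) (bilinPull Ω D) v) =
      contactProj l Ω (D v) := fun v ↦ by
    simp [contactProj_apply, h.reebVec_pull D]
  refine h.eq_relEnd (by simpa using h1) fun v ↦ ?_
  have := h2 (D.symm v)
  simpa [hp] using this

/-- The trace is invariant under conjugation, so the normalising factor does not change. This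
naturality allows J to be computed in a chart. -/
lemma IsContactPair.conformalJ_pull (h : IsContactPair l Ω) (D : E3 ≃L[ℝ] E3) (w : E3) :
    D (conformalJ (l.comp (D : E3 →L[ℝ] E3)) (bilinPull Ω D) (bilinPull G D) w) =
      conformalJ l Ω G (D w) := by
  have key : traceSq (relEnd (l.comp (D : E3 →L[ℝ] E3)) (bilinPull Ω D) (bilinPull G D)) =
      traceSq (relEnd l Ω G) := by
    rw [traceSq, traceSq, ← LinearMap.trace_conj' _ D.toLinearEquiv]
    congr 1
    ext1 x
    simp [LinearEquiv.conj_apply, h.relEnd_pull D]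
  simp [conformalJ, key, h.relEnd_pull D]

/-- Smooth dependence of `conformalJ` on the data. -/
lemma contDiffAt_conformalJ {X : Type*} [NormedAddCommGroup X] [NormedSpace ℝ X]
    {l : X → E3 →L[ℝ] ℝ} {Ω G : X → E3 →L[ℝ] E3 →L[ℝ] ℝ} {x : X} (hl : ContDiffAt ℝ ∞ l x)
    (hΩ : ContDiffAt ℝ ∞ Ω x) (hG : ContDiffAt ℝ ∞ G x) (h : IsContactPair (l x) (Ω x))
    (hG' : IsKerMetric (l x) (G x)) :
    ContDiffAt ℝ ∞ (fun y ↦ conformalJ (l y) (Ω y) (G y)) x := by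
  have hsr : ContDiffAt ℝ ∞ (fun y ↦ (l y).smulRight (l y)) x := by
    have : ContDiffAt ℝ ∞ (fun y ↦ ContinuousLinearMap.smulRightL ℝ E3 (E3 →L[ℝ] ℝ) (l y) (l y)) x :=
      (hl.continuousLinearMap_comp _).clm_apply hl
    exact this
  have hB : ContDiffAt ℝ ∞ (fun y ↦ musical (l y) (Ω y)) x := hsr.sub hΩ
  obtain ⟨e, he⟩ := h.exists_equiv
  have hI : ContDiffAt ℝ ∞ (fun y ↦ (musical (l y) (Ω y)).inverse) x := by
    have := contDiffAt_map_inverse (𝕜 := ℝ) (n := ∞) e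
    rw [he] at this
    exact this.comp x hB
  have hR : ContDiffAt ℝ ∞ (fun y ↦ reebVec (l y) (Ω y)) x := hI.clm_apply hl
  have hP : ContDiffAt ℝ ∞ (fun y ↦ contactProj (l y) (Ω y)) x := by
    have : ContDiffAt ℝ ∞ (fun y ↦ ContinuousLinearMap.smulRightL ℝ E3 E3 (l y)
        (reebVec (l y) (Ω y))) x :=
      (hl.continuousLinearMap_comp _).clm_apply hR
    exact contDiffAt_const.sub this
  have hA : ContDiffAt ℝ ∞ (fun y ↦ relEnd (l y) (Ω y) (G y)) x := by
    have : ContDiffAt ℝ ∞ (fun y ↦ (ContinuousLinearMap.compL ℝ E3 E3 ℝ).flip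
        (contactProj (l y) (Ω y))) x := contDiffAt_const.clm_apply hP
    exact hI.clm_comp (this.clm_comp (hG.clm_comp hP))
  have hT : ContDiffAt ℝ ∞ (fun y ↦ traceSq (relEnd (l y) (Ω y) (G y))) x := by
    have h1 := hA.clm_comp hA
    exact h1.continuousLinearMap_comp (LinearMap.toContinuousLinearMap
      ((LinearMap.trace ℝ E3).comp (ContinuousLinearMap.coeLM ℝ)))
  have h1 := (h.relEnd_sq hG').1
  refine ContDiffAt.smul (ContDiffAt.sqrt (contDiffAt_const.div hT h1.ne) ?_) hA
  exact (div_pos_of_neg_of_neg (by norm_num) h1).ne'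

end LinearAlgebra

/-! ### Naturality of the exterior derivative of 1-forms -/

section ExteriorDerivative

variable {V V' : Type*} [NormedAddCommGroup V] [NormedSpace ℝ V] [NormedAddCommGroup V']
  [NormedSpace ℝ V']

/-- The exterior derivative of a 1-form on a normed space. -/
def dForm (m : V → V →L[ℝ] ℝ) (y v w : V) : ℝ := fderiv ℝ m y v w - fderiv ℝ m y w v

/-- The second derivative of Θ enters symmetrically and cancels in the antisymmetrisation. -/
lemma dForm_pullback {Θ : V → V'} {y : V} (hΘ : ContDiffAt ℝ 2 Θ y) {l : V' → V' →L[ℝ] ℝ}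
    (hl : DifferentiableAt ℝ l (Θ y)) {m : V → V →L[ℝ] ℝ}
    (hm : m =ᶠ[𝓝 y] fun y' ↦ (l (Θ y')).comp (fderiv ℝ Θ y')) (v w : V) :
    dForm m y v w = dForm l (Θ y) (fderiv ℝ Θ y v) (fderiv ℝ Θ y w) := by
  have h1 : HasFDerivAt Θ (fderiv ℝ Θ y) y := (hΘ.differentiableAt (by norm_num)).hasFDerivAt
  have h2 : HasFDerivAt (fderiv ℝ Θ) (fderiv ℝ (fderiv ℝ Θ) y) y :=
    ((hΘ.fderiv_right (m := 1) (by norm_num)).differentiableAt (by norm_num)).hasFDerivAt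
  have h3 : HasFDerivAt (fun y' ↦ l (Θ y')) ((fderiv ℝ l (Θ y)).comp (fderiv ℝ Θ y)) y :=
    hl.hasFDerivAt.comp y h1
  have h4 := (h3.clm_comp h2).congr_of_eventuallyEq hm
  have hs : IsSymmSndFDerivAt ℝ Θ y := hΘ.isSymmSndFDerivAt (by simp)
  rw [dForm, dForm, h4.fderiv]
  simp [hs v w]

end ExteriorDerivative

/-! ### Implicitly defined functions -/

/-- No continuity of Y is assumed: the implicit function stays in S near x₀, and uniqueness of
solutions in S identifies it with Y. -/
lemma contDiffAt_of_implicit {f : ℝ × ℝ → ℝ} {Y : ℝ → ℝ} {x₀ f₂ : ℝ} {S : Set ℝ}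
    (hf : ContDiffAt ℝ ∞ f (x₀, Y x₀)) (h2 : HasDerivAt (fun y ↦ f (x₀, y)) f₂ (Y x₀))
    (h0 : f₂ ≠ 0) (hS : S ∈ 𝓝 (Y x₀))
    (huniq : ∀ᶠ x in 𝓝 x₀, ∀ y ∈ S, f (x, y) = f (x₀, Y x₀) → y = Y x) :
    ContDiffAt ℝ ∞ Y x₀ := by
  have hn : (∞ : ℕ∞ω) ≠ 0 := by simp
  have hd : HasDerivAt (fun y ↦ f (x₀, y))
      ((fderiv ℝ f (x₀, Y x₀) ∘L .inr ℝ ℝ ℝ) 1) (Y x₀) := by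
    have h1 := (hf.differentiableAt (by simp)).hasFDerivAt
    have h3 : HasFDerivAt (fun y : ℝ ↦ (x₀, y)) (ContinuousLinearMap.inr ℝ ℝ ℝ) (Y x₀) :=
      hasFDerivAt_prodMk_right x₀ (Y x₀)
    exact (h1.comp (Y x₀) h3).hasDerivAt
  have he : (fderiv ℝ f (x₀, Y x₀) ∘L .inr ℝ ℝ ℝ) 1 = f₂ := hd.unique h2
  have hinv : (fderiv ℝ f (x₀, Y x₀) ∘L .inr ℝ ℝ ℝ).IsInvertible := by
    refine ⟨ContinuousLinearEquiv.unitsEquivAut ℝ (Units.mk0 f₂ h0), ?_⟩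
    ext
    rw [he]
    simp
  have h1 := hf.contDiffAt_implicitFunction hn hinv
  have h3 := hf.eventually_apply_implicitFunction hn hinv
  have h4 := hf.implicitFunction_apply_self hn hinv
  refine h1.congr_of_eventuallyEq ?_
  have h5 : Tendsto (hf.implicitFunction hn hinv) (𝓝 x₀) (𝓝 (Y x₀)) := by
    have := h1.continuousAt.tendsto
    simp only at this h4
    rwa [h4] at this
  filter_upwards [h3, huniq, h5 hS] with x hx hu hxS
  exact (hu _ hxS hx).symm

/-! ### The Hamiltonian as a function of the actions -/

/-- The value of `K` at a point with `I₁ = -x` and `I₂ = y / 2`. -/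
def actionEnergy (α om : ℝ) (R : ℝ × ℝ → ℝ) (x y : ℝ) : ℝ := α * x + om * (y / 2) + R (-x, y / 2)

/-- `α - ∂R/∂I₁` at `I₁ = -x`, `I₂ = y / 2`. -/
def abar (α : ℝ) (R : ℝ × ℝ → ℝ) (x y : ℝ) : ℝ := α - fderiv ℝ R (-x, y / 2) (1, 0)

/-- `om + ∂R/∂I₂` at `I₁ = -x`, `I₂ = y / 2`. -/
def obar (om : ℝ) (R : ℝ × ℝ → ℝ) (x y : ℝ) : ℝ := om + fderiv ℝ R (-x, y / 2) (0, 1)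

/-- On the box of half-size `b`, the remainder `R` is smooth and its derivatives are small. -/
structure IsGoodBox (α om : ℝ) (R : ℝ × ℝ → ℝ) (b : ℝ) : Prop where
  alpha_pos : 0 < α
  om_pos : 0 < om
  b_pos : 0 < b
  zero : R 0 = 0
  smooth : ∀ p : ℝ × ℝ, |p.1| < b → |p.2| < b → ContDiffAt ℝ ∞ R p
  bound₁ : ∀ p : ℝ × ℝ, |p.1| < b → |p.2| < b → |fderiv ℝ R p (1, 0)| ≤ α / 2
  bound₂ : ∀ p : ℝ × ℝ, |p.1| < b → |p.2| < b → |fderiv ℝ R p (0, 1)| ≤ om / 2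

section Actions

variable {α om : ℝ} {R : ℝ × ℝ → ℝ} {b : ℝ}

lemma abs_half_lt {y : ℝ} (hy : |y| < b) : |y / 2| < b := by
  rw [abs_div, abs_two]; linarith [abs_nonneg y]

namespace IsGoodBox

variable (h : IsGoodBox α om R b)
include h

lemma contDiffAt_R {x y : ℝ} (hx : |x| < b) (hy : |y| < b) : ContDiffAt ℝ ∞ R (-x, y / 2) :=
  h.smooth _ (by simpa using hx) (abs_half_lt hy)

lemma abar_mem {x y : ℝ} (hx : |x| < b) (hy : |y| < b) :
    α / 2 ≤ abar α R x y ∧ abar α R x y ≤ 3 * α / 2 := by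
  have := abs_le.1 (h.bound₁ (-x, y / 2) (by simpa using hx) (abs_half_lt hy))
  unfold abar; constructor <;> linarith

lemma obar_mem {x y : ℝ} (hx : |x| < b) (hy : |y| < b) :
    om / 2 ≤ obar om R x y ∧ obar om R x y ≤ 3 * om / 2 := by
  have := abs_le.1 (h.bound₂ (-x, y / 2) (by simpa using hx) (abs_half_lt hy))
  unfold obar; constructor <;> linarith

lemma abar_pos {x y : ℝ} (hx : |x| < b) (hy : |y| < b) : 0 < abar α R x y := by
  linarith [(h.abar_mem hx hy).1, h.alpha_pos]

lemma obar_pos {x y : ℝ} (hx : |x| < b) (hy : |y| < b) : 0 < obar om R x y := by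
  linarith [(h.obar_mem hx hy).1, h.om_pos]

lemma contDiffAt_fderiv {x y : ℝ} (hx : |x| < b) (hy : |y| < b) (v : ℝ × ℝ) :
    ContDiffAt ℝ ∞ (fun p : ℝ × ℝ ↦ fderiv ℝ R (-p.1, p.2 / 2) v) (x, y) := by
  have h1 : ContDiffAt ℝ ∞ (fderiv ℝ R) (-x, y / 2) :=
    (h.contDiffAt_R hx hy).fderiv_right (by simp)
  have h2 : ContDiffAt ℝ ∞ (fun p : ℝ × ℝ ↦ (-p.1, p.2 / 2)) (x, y) := by fun_prop
  exact (h1.comp (x, y) h2).clm_apply contDiffAt_const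

lemma contDiffAt_abar {x y : ℝ} (hx : |x| < b) (hy : |y| < b) :
    ContDiffAt ℝ ∞ (fun p : ℝ × ℝ ↦ abar α R p.1 p.2) (x, y) :=
  contDiffAt_const.sub (h.contDiffAt_fderiv hx hy _)

lemma contDiffAt_obar {x y : ℝ} (hx : |x| < b) (hy : |y| < b) :
    ContDiffAt ℝ ∞ (fun p : ℝ × ℝ ↦ obar om R p.1 p.2) (x, y) :=
  contDiffAt_const.add (h.contDiffAt_fderiv hx hy _)

lemma contDiffAt_actionEnergy {x y : ℝ} (hx : |x| < b) (hy : |y| < b) :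
    ContDiffAt ℝ ∞ (fun p : ℝ × ℝ ↦ actionEnergy α om R p.1 p.2) (x, y) := by
  have h2 : ContDiffAt ℝ ∞ (fun p : ℝ × ℝ ↦ (-p.1, p.2 / 2)) (x, y) := by fun_prop
  have h3 := (h.contDiffAt_R hx hy).comp (x, y) h2
  unfold actionEnergy
  exact ContDiffAt.add (by fun_prop) h3

lemma hasFDerivAt_actionEnergy {x y : ℝ} (hx : |x| < b) (hy : |y| < b) :
    HasFDerivAt (fun p : ℝ × ℝ ↦ actionEnergy α om R p.1 p.2)
      (abar α R x y • ContinuousLinearMap.fst ℝ ℝ ℝ +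
        (obar om R x y / 2) • ContinuousLinearMap.snd ℝ ℝ ℝ) (x, y) := by
  have h1 := ((h.contDiffAt_R hx hy).differentiableAt (by simp)).hasFDerivAt
  have e1 : HasFDerivAt (fun p : ℝ × ℝ ↦ (-p.1, p.2 / 2))
      ((-ContinuousLinearMap.fst ℝ ℝ ℝ).prod ((2 : ℝ)⁻¹ • ContinuousLinearMap.snd ℝ ℝ ℝ))
      (x, y) := by
    refine HasFDerivAt.prodMk hasFDerivAt_fst.neg ?_
    simpa [div_eq_inv_mul] using (hasFDerivAt_snd (𝕜 := ℝ) (p := (x, y))).const_mul (2 : ℝ)⁻¹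
  have e2 : HasFDerivAt (fun p : ℝ × ℝ ↦ α * p.1 + om * (p.2 / 2))
      (α • ContinuousLinearMap.fst ℝ ℝ ℝ + om • (2 : ℝ)⁻¹ • ContinuousLinearMap.snd ℝ ℝ ℝ)
      (x, y) := by
    refine (hasFDerivAt_fst.const_mul α).add ?_
    simpa [div_eq_inv_mul] using
      ((hasFDerivAt_snd (𝕜 := ℝ) (p := (x, y))).const_mul (2 : ℝ)⁻¹).const_mul om
  have e3 := e2.add (HasFDerivAt.comp (x, y) (f := fun p : ℝ × ℝ ↦ (-p.1, p.2 / 2)) h1 e1)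
  refine e3.congr_fderiv ?_
  have hlin : ∀ u v : ℝ, fderiv ℝ R (-x, y / 2) (u, v) =
      u * fderiv ℝ R (-x, y / 2) (1, 0) + v * fderiv ℝ R (-x, y / 2) (0, 1) := fun u v ↦ by
    rw [← smul_eq_mul, ← smul_eq_mul, ← map_smul, ← map_smul, ← map_add]; simp
  ext
  · simp [abar, hlin (-1) 0, sub_eq_add_neg]
  · simp [obar, hlin 0 2⁻¹]; ring

lemma hasDerivAt_fst {x y : ℝ} (hx : |x| < b) (hy : |y| < b) :
    HasDerivAt (fun x ↦ actionEnergy α om R x y) (abar α R x y) x := by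
  have := (h.hasFDerivAt_actionEnergy hx hy).comp_hasDerivAt x
    ((hasDerivAt_id x).prodMk (hasDerivAt_const x y))
  exact HasDerivAt.congr_deriv this (by simp)

lemma hasDerivAt_snd {x y : ℝ} (hx : |x| < b) (hy : |y| < b) :
    HasDerivAt (fun y ↦ actionEnergy α om R x y) (obar om R x y / 2) y := by
  have := (h.hasFDerivAt_actionEnergy hx hy).comp_hasDerivAt y
    ((hasDerivAt_const y x).prodMk (hasDerivAt_id y))
  exact HasDerivAt.congr_deriv this (by simp)

lemma zero_apply : actionEnergy α om R 0 0 = 0 := by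
  have := h.zero
  simp only [actionEnergy, mul_zero, neg_zero, zero_div, zero_add]
  exact this

/-- Mean value inequality: the y-derivative is half of `obar`, and `obar` is at least om / 2. -/
lemma sub_snd {x y y' : ℝ} (hx : |x| < b) (hy : |y| < b) (hy' : |y'| < b) (hyy : y ≤ y') :
    om / 4 * (y' - y) ≤ actionEnergy α om R x y' - actionEnergy α om R x y := by
  have hd : ∀ t ∈ Icc y y', |t| < b := fun t ht ↦
    abs_lt.2 ⟨by linarith [(abs_lt.1 hy).1, ht.1], by linarith [(abs_lt.1 hy').2, ht.2]⟩
  refine (convex_Icc y y').mul_sub_le_image_sub_of_le_deriv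
    (fun t ht ↦ (h.hasDerivAt_snd hx (hd t ht)).continuousAt.continuousWithinAt)
    (fun t ht ↦ (h.hasDerivAt_snd hx
      (hd t (interior_subset ht))).differentiableAt.differentiableWithinAt)
    (fun t ht ↦ ?_) y (left_mem_Icc.2 hyy) y' (right_mem_Icc.2 hyy) hyy
  rw [(h.hasDerivAt_snd hx (hd t (interior_subset ht))).deriv]
  linarith [(h.obar_mem hx (hd t (interior_subset ht))).1]

lemma sub_fst {x x' y : ℝ} (hx : |x| < b) (hx' : |x'| < b) (hy : |y| < b) (hxx : x ≤ x') :
    α / 2 * (x' - x) ≤ actionEnergy α om R x' y - actionEnergy α om R x y := by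
  have hd : ∀ t ∈ Icc x x', |t| < b := fun t ht ↦
    abs_lt.2 ⟨by linarith [(abs_lt.1 hx).1, ht.1], by linarith [(abs_lt.1 hx').2, ht.2]⟩
  refine (convex_Icc x x').mul_sub_le_image_sub_of_le_deriv
    (fun t ht ↦ (h.hasDerivAt_fst (hd t ht) hy).continuousAt.continuousWithinAt)
    (fun t ht ↦ (h.hasDerivAt_fst
      (hd t (interior_subset ht)) hy).differentiableAt.differentiableWithinAt)
    (fun t ht ↦ ?_) x (left_mem_Icc.2 hxx) x' (right_mem_Icc.2 hxx) hxx
  rw [(h.hasDerivAt_fst (hd t (interior_subset ht)) hy).deriv]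
  linarith [(h.abar_mem (hd t (interior_subset ht)) hy).1]

lemma sub_fst_le {x x' y : ℝ} (hx : |x| < b) (hx' : |x'| < b) (hy : |y| < b) (hxx : x ≤ x') :
    actionEnergy α om R x' y - actionEnergy α om R x y ≤ 3 * α / 2 * (x' - x) := by
  have hd : ∀ t ∈ Icc x x', |t| < b := fun t ht ↦
    abs_lt.2 ⟨by linarith [(abs_lt.1 hx).1, ht.1], by linarith [(abs_lt.1 hx').2, ht.2]⟩
  refine (convex_Icc x x').image_sub_le_mul_sub_of_deriv_le
    (fun t ht ↦ (h.hasDerivAt_fst (hd t ht) hy).continuousAt.continuousWithinAt)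
    (fun t ht ↦ (h.hasDerivAt_fst
      (hd t (interior_subset ht)) hy).differentiableAt.differentiableWithinAt)
    (fun t ht ↦ ?_) x (left_mem_Icc.2 hxx) x' (right_mem_Icc.2 hxx) hxx
  rw [(h.hasDerivAt_fst (hd t (interior_subset ht)) hy).deriv]
  linarith [(h.abar_mem (hd t (interior_subset ht)) hy).2]

lemma eq_of_snd {x y y' : ℝ} (hx : |x| < b) (hy : |y| < b) (hy' : |y'| < b)
    (he : actionEnergy α om R x y = actionEnergy α om R x y') : y = y' := by
  have := h.om_pos
  rcases le_total y y' with hl | hl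
  · have := h.sub_snd hx hy hy' hl; nlinarith
  · have := h.sub_snd hx hy' hy hl; nlinarith

/-- Coercivity of the energy on the quadrant. -/
lemma lower_bound {x y : ℝ} (hx : 0 ≤ x) (hxb : x < b) (hy : 0 ≤ y) (hyb : y < b) :
    α / 2 * x + om / 4 * y ≤ actionEnergy α om R x y := by
  have hb := h.b_pos
  have h1 := h.sub_fst (x := 0) (x' := x) (y := 0) (by simpa) (by rwa [abs_of_nonneg hx])
    (by simpa) hx
  have h2 := h.sub_snd (x := x) (y := 0) (y' := y) (by rwa [abs_of_nonneg hx]) (by simpa)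
    (by rwa [abs_of_nonneg hy]) hy
  rw [h.zero_apply] at h1
  linarith

end IsGoodBox

end Actions

/-- The bound R = O(I₁² + I₂²) forces R(0) = 0 and dR(0) = 0; continuity of dR then makes the
derivatives small on a box. -/
lemma IsSaddleCenterNormalForm.exists_goodBox {H : E4 → ℝ} {pc : E4}
    {φ : OpenPartialHomeomorph E4 E4} {α om : ℝ} {R : ℝ × ℝ → ℝ}
    (h : IsSaddleCenterNormalForm H pc φ α om R) : ∃ b, IsGoodBox α om R b := by
  obtain ⟨O, hO, hR⟩ := h.smooth_R
  have h0 : R 0 = 0 := by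
    have h1 := h.isBigO_R.isBigOWith.choose_spec
    have h2 := h1.bound.self_of_nhds
    simpa using h2
  have hd : fderiv ℝ R 0 = 0 := by
    have h1 : R =O[𝓝 0] fun I : ℝ × ℝ ↦ ‖I - 0‖ ^ 2 := by
      refine h.isBigO_R.trans (Asymptotics.IsBigO.of_bound 2 (Eventually.of_forall fun I ↦ ?_))
      simp only [sub_zero, norm_pow, norm_norm]
      have e1 : |I.1| ≤ ‖I‖ := norm_fst_le I
      have e2 : |I.2| ≤ ‖I‖ := norm_snd_le I
      rw [Real.norm_of_nonneg (by positivity), ← sq_abs I.1, ← sq_abs I.2]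
      nlinarith [abs_nonneg I.1, abs_nonneg I.2]
    have h2 := h1.hasFDerivAt (n := 2) (𝕜 := ℝ) (by norm_num)
    exact h2.fderiv
  obtain ⟨O', hO', hO'o, hO'0⟩ := mem_nhds_iff.1 hO
  have hsm : ∀ p ∈ O', ContDiffAt ℝ ∞ R p := fun p hp ↦
    hR.contDiffAt (mem_of_superset (hO'o.mem_nhds hp) hO')
  have hc : ∀ v, ContinuousAt (fun p ↦ |fderiv ℝ R p v|) 0 := fun v ↦
    ((((hsm 0 hO'0).fderiv_right (m := 0) (by simp)).continuousAt).clm_apply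
      continuousAt_const).abs
  have e1 : ∀ᶠ p in 𝓝 (0 : ℝ × ℝ), |fderiv ℝ R p (1, 0)| < α / 2 :=
    (hc (1, 0)).eventually_lt continuousAt_const (by simp [hd, h.alpha_pos])
  have e2 : ∀ᶠ p in 𝓝 (0 : ℝ × ℝ), |fderiv ℝ R p (0, 1)| < om / 2 :=
    (hc (0, 1)).eventually_lt continuousAt_const (by simp [hd, h.omega_pos])
  obtain ⟨b, hb, hball⟩ := Metric.eventually_nhds_iff.1
    ((e1.and e2).and (hO'o.mem_nhds hO'0))
  have hmem : ∀ p : ℝ × ℝ, |p.1| < b → |p.2| < b → dist p 0 < b := fun p h1 h2 ↦ by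
    rw [dist_zero_right, Prod.norm_def]; exact max_lt h1 h2
  exact ⟨b, h.alpha_pos, h.omega_pos, hb, h0, fun p h1 h2 ↦ hsm p (hball (hmem p h1 h2)).2,
    fun p h1 h2 ↦ (hball (hmem p h1 h2)).1.1.le, fun p h1 h2 ↦ (hball (hmem p h1 h2)).1.2.le⟩

/-! ### The profile of the two planes -/

section Profile

variable {α om : ℝ} {R : ℝ × ℝ → ℝ} {b : ℝ}

/-- The level `actionEnergy x y = E` is the graph of the smooth function `y = Y x`. -/
structure IsLevelGraph (α om : ℝ) (R : ℝ × ℝ → ℝ) (b b₁ E : ℝ) (Y : ℝ → ℝ) (x₀ : ℝ) : Prop where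
  b₁_le : b₁ ≤ b
  lt : ∀ x, |x| < b₁ → |Y x| < b
  level : ∀ x, |x| < b₁ → actionEnergy α om R x (Y x) = E
  x₀_pos : 0 < x₀
  x₀_lt : x₀ < b₁
  Y_x₀ : Y x₀ = 0

/-- Intermediate values and monotonicity. The graph is kept on both sides of x₀, also where y < 0,
although only y ≥ 0 is geometric: smoothness of the planes at z = 0 uses a full neighbourhood of x₀.
-/
lemma IsGoodBox.exists_levelGraph (h : IsGoodBox α om R b) :
    ∃ b₁ > 0, ∃ E₁ > 0, ∀ E, 0 < E → E < E₁ → ∃ Y x₀, IsLevelGraph α om R b b₁ E Y x₀ := by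
  have hα := h.alpha_pos
  have hom := h.om_pos
  have hb := h.b_pos
  -- The second bound gives |K(x, 0)| ≤ om b / 16 for |x| < b₁, which is half of the change om b / 8
  -- guaranteed when y moves from 0 to ±b/2.
  set b₁ := min (b / 2) (om * b / (24 * α)) with hb₁
  have hb₁0 : 0 < b₁ := by positivity
  have hle : b₁ ≤ b / 2 := min_le_left _ _
  have hle2 : 3 * α / 2 * b₁ ≤ om * b / 16 := by
    have : b₁ ≤ om * b / (24 * α) := min_le_right _ _
    rw [le_div_iff₀ (by positivity)] at this
    linarith
  -- The first bound places E between the values of K at y = -b/2 and y = b/2; the second places it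
  -- below K(b₁/2, 0), so that x₀ ≤ b₁/2.
  refine ⟨b₁, hb₁0, min (om * b / 16) (α * b₁ / 4), by positivity, fun E hE hE₁ ↦ ?_⟩
  have hE1 : E < om * b / 16 := hE₁.trans_le (min_le_left _ _)
  have hE2 : E < α * b₁ / 4 := hE₁.trans_le (min_le_right _ _)
  have habs0 : |(0 : ℝ)| < b := by simpa
  have hk0 := h.zero_apply
  have hex : ∀ x, |x| < b₁ → ∃ y, |y| < b ∧ actionEnergy α om R x y = E := by
    intro x hx
    have hxb : |x| < b := by linarith
    have hx0 : |actionEnergy α om R x 0| ≤ 3 * α / 2 * b₁ := by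
      have hx1 := abs_lt.1 hx
      rcases le_total 0 x with hs | hs
      · have e1 := h.sub_fst habs0 hxb habs0 hs
        have e2 := h.sub_fst_le habs0 hxb habs0 hs
        rw [abs_le]; constructor <;> nlinarith
      · have e1 := h.sub_fst hxb habs0 habs0 hs
        have e2 := h.sub_fst_le hxb habs0 habs0 hs
        rw [abs_le]; constructor <;> nlinarith
    have hx0 := abs_le.1 hx0
    have hb2 : |b / 2| < b := by rw [abs_of_pos (by positivity)]; linarith
    have hb2' : |-(b / 2)| < b := by rwa [abs_neg]
    have e1 := h.sub_snd hxb habs0 hb2 (by positivity)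
    have e2 := h.sub_snd hxb hb2' habs0 (by linarith)
    have hd : ∀ t ∈ Icc (-(b / 2)) (b / 2), |t| < b := fun t ht ↦
      abs_lt.2 ⟨by linarith [ht.1], by linarith [ht.2]⟩
    have hcont : ContinuousOn (fun y ↦ actionEnergy α om R x y) (Icc (-(b / 2)) (b / 2)) :=
      fun t ht ↦ (h.hasDerivAt_snd hxb (hd t ht)).continuousAt.continuousWithinAt
    obtain ⟨y, hy, hyE⟩ := intermediate_value_Icc (by linarith) hcont
      (show E ∈ Icc _ _ from ⟨by linarith, by linarith⟩)
    exact ⟨y, hd y hy, hyE⟩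
  choose! Y hY using hex
  obtain ⟨x₀, hx₀, hx₀E⟩ : ∃ x₀ ∈ Icc 0 (b₁ / 2), actionEnergy α om R x₀ 0 = E := by
    have hd : ∀ t ∈ Icc 0 (b₁ / 2), |t| < b := fun t ht ↦ by
      rw [abs_of_nonneg ht.1]; linarith [ht.2]
    have hcont : ContinuousOn (fun x ↦ actionEnergy α om R x 0) (Icc 0 (b₁ / 2)) :=
      fun t ht ↦ (h.hasDerivAt_fst (hd t ht) habs0).continuousAt.continuousWithinAt
    have e1 := h.sub_fst habs0 (hd (b₁ / 2) (right_mem_Icc.2 (by positivity))) habs0 (by positivity)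
    exact intermediate_value_Icc (by positivity) hcont
      (show E ∈ Icc _ _ from ⟨by linarith, by linarith⟩)
  have hx₀b : |x₀| < b₁ := by rw [abs_of_nonneg hx₀.1]; linarith [hx₀.2]
  refine ⟨Y, x₀, by linarith, fun x hx ↦ (hY x hx).1, fun x hx ↦ (hY x hx).2, ?_,
    (le_abs_self _).trans_lt hx₀b, ?_⟩
  · refine lt_of_le_of_ne hx₀.1 ?_
    rintro rfl
    linarith
  · exact h.eq_of_snd (by linarith) (hY x₀ hx₀b).1 habs0 ((hY x₀ hx₀b).2.trans hx₀E.symm)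

variable {b₁ E x₀ : ℝ} {Y : ℝ → ℝ}

namespace IsLevelGraph

variable (hY : IsLevelGraph α om R b b₁ E Y x₀) (h : IsGoodBox α om R b)
include hY h

lemma eq_of_level {x y : ℝ} (hx : |x| < b₁) (hy : |y| < b) (he : actionEnergy α om R x y = E) :
    y = Y x :=
  h.eq_of_snd (hx.trans_le hY.b₁_le) hy (hY.lt x hx) (he.trans (hY.level x hx).symm)

lemma contDiffAt {x : ℝ} (hx : |x| < b₁) : ContDiffAt ℝ ∞ Y x := by
  have hxb := hx.trans_le hY.b₁_le
  refine contDiffAt_of_implicit (h.contDiffAt_actionEnergy hxb (hY.lt x hx))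
    (h.hasDerivAt_snd hxb (hY.lt x hx)) (half_pos (h.obar_pos hxb (hY.lt x hx))).ne'
    (S := {y | |y| < b}) ((isOpen_lt continuous_abs continuous_const).mem_nhds (hY.lt x hx)) ?_
  filter_upwards [(isOpen_lt continuous_abs continuous_const).mem_nhds hx] with x' hx' y hy he
  exact hY.eq_of_level h hx' hy (he.trans (hY.level x hx))

lemma hasDerivAt {x : ℝ} (hx : |x| < b₁) :
    HasDerivAt Y (-(2 * abar α R x (Y x)) / obar om R x (Y x)) x := by
  have hxb := hx.trans_le hY.b₁_le
  have h1 := ((hY.contDiffAt h hx).differentiableAt (by simp)).hasDerivAt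
  have h2 := (h.hasFDerivAt_actionEnergy hxb (hY.lt x hx)).comp_hasDerivAt x
    ((hasDerivAt_id x).prodMk h1)
  have h3 : HasDerivAt (fun _ ↦ E) _ x := h2.congr_of_eventuallyEq (by
    filter_upwards [(isOpen_lt continuous_abs continuous_const).mem_nhds hx] with x' hx'
    exact (hY.level x' hx').symm)
  have h4 := h3.unique (hasDerivAt_const x E)
  have ho := (h.obar_pos hxb (hY.lt x hx)).ne'
  refine h1.congr_deriv ?_
  simp at h4
  rw [eq_div_iff ho]
  linarith

lemma strictAnti {x x' : ℝ} (hx : |x| < b₁) (hx' : |x'| < b₁) (hlt : x < x') : Y x' < Y x := by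
  have hanti : StrictAntiOn Y (Ioo (-b₁) b₁) := by
    refine strictAntiOn_of_deriv_neg (convex_Ioo _ _)
      (fun t ht ↦ (hY.hasDerivAt h (abs_lt.2 ht)).continuousAt.continuousWithinAt) fun t ht ↦ ?_
    have ht : |t| < b₁ := by rw [interior_Ioo] at ht; exact abs_lt.2 ht
    have htb := ht.trans_le hY.b₁_le
    rw [(hY.hasDerivAt h ht).deriv]
    exact div_neg_of_neg_of_pos (by linarith [h.abar_pos htb (hY.lt t ht)])
      (h.obar_pos htb (hY.lt t ht))
  exact hanti (abs_lt.1 hx) (abs_lt.1 hx') hlt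

end IsLevelGraph

/-- The profile `η(τ) = |h|`, `m(τ) = f / |z|`, as functions of `τ = |z|²`. -/
structure IsProfile (α om : ℝ) (R : ℝ × ℝ → ℝ) (b E : ℝ) (Y η m : ℝ → ℝ) : Prop where
  smooth_η : ∀ τ, 0 ≤ τ → ContDiffAt ℝ ∞ η τ
  smooth_m : ∀ τ, 0 ≤ τ → ContDiffAt ℝ ∞ m τ
  η_pos : ∀ τ, 0 ≤ τ → 0 < η τ
  m_pos : ∀ τ, 0 ≤ τ → 0 < m τ
  η_lt : ∀ τ, 0 ≤ τ → η τ ^ 2 < b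
  y_lt : ∀ τ, 0 ≤ τ → τ * m τ ^ 2 < b
  eq_Y : ∀ τ, 0 ≤ τ → τ * m τ ^ 2 = Y (η τ ^ 2)
  level : ∀ τ, 0 ≤ τ → actionEnergy α om R (η τ ^ 2) (τ * m τ ^ 2) = E
  hasDerivAt : ∀ τ, 0 ≤ τ → HasDerivAt η
    (-(abar α R (η τ ^ 2) (τ * m τ ^ 2) * obar om R (η τ ^ 2) (τ * m τ ^ 2) * η τ * m τ ^ 2) /
      (2 * (obar om R (η τ ^ 2) (τ * m τ ^ 2) ^ 2 * (τ * m τ ^ 2) +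
        2 * abar α R (η τ ^ 2) (τ * m τ ^ 2) ^ 2 * η τ ^ 2))) τ
  tendsto : Tendsto η atTop (𝓝 0)
  surj : ∀ h y, 0 < h → 0 ≤ y → h ^ 2 < b → y < b → actionEnergy α om R (h ^ 2) y = E →
    ∃ τ, 0 ≤ τ ∧ η τ = h

lemma exists_antideriv {g : ℝ → ℝ} {c d : ℝ} (hg : ContDiffOn ℝ ∞ g (Ioo c d)) {x₀ : ℝ}
    (hx₀ : x₀ ∈ Ioo c d) : ∃ Φ : ℝ → ℝ, Φ x₀ = 0 ∧ ContDiffOn ℝ ∞ Φ (Ioo c d) ∧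
      ∀ x ∈ Ioo c d, HasDerivAt Φ (g x) x := by
  have hd : ∀ x ∈ Ioo c d, HasDerivAt (fun x ↦ ∫ t in x₀..x, g t) (g x) x := by
    intro x hx
    refine intervalIntegral.integral_hasDerivAt_right ?_ ?_ ?_
    · refine (hg.continuousOn.mono ?_).intervalIntegrable
      exact (convex_Ioo c d).ordConnected.uIcc_subset hx₀ hx
    · exact hg.continuousOn.stronglyMeasurableAtFilter isOpen_Ioo x hx
    · exact hg.continuousOn.continuousAt (isOpen_Ioo.mem_nhds hx)
  refine ⟨_, intervalIntegral.integral_same, ?_, hd⟩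
  rw [contDiffOn_infty_iff_deriv_of_isOpen isOpen_Ioo]
  exact ⟨fun x hx ↦ (hd x hx).differentiableAt.differentiableWithinAt,
    hg.congr fun x hx ↦ (hd x hx).deriv⟩

/-- With τ = e^{4πs} as a function of t = h, the equation for h becomes d(log τ)/dt = -2(B²Y +
2A²t²)/(A B t Y), where Y = Y(t²). This is the logarithmic derivative of P = Y(t²) e^Φ with Φ' =
-2B/(A t). The factor Y carries the whole zero at h₀ = √x₀, so P is smooth and strictly decreasing
through h₀. Its inverse η is therefore smooth at τ = 0, and m = e^{-Φ(η)/2} satisfies τ m² = Y(η²).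
-/
lemma IsLevelGraph.exists_profile (hY : IsLevelGraph α om R b b₁ E Y x₀) (h : IsGoodBox α om R b)
    (hb₁ : ∀ x, 0 ≤ x → x < b → ∀ y, 0 ≤ y → y < b → actionEnergy α om R x y = E → x < b₁) :
    ∃ η m, IsProfile α om R b E Y η m := by
  have hα := h.alpha_pos
  have hom := h.om_pos
  have hx₀ := hY.x₀_pos
  have hb₁0 : 0 < b₁ := hx₀.trans hY.x₀_lt
  set d := Real.sqrt b₁ with hd
  set h₀ := Real.sqrt x₀ with hh₀
  have hsq : h₀ ^ 2 = x₀ := Real.sq_sqrt hx₀.le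
  have hh₀pos : 0 < h₀ := Real.sqrt_pos.2 hx₀
  have hh₀d : h₀ < d := Real.sqrt_lt_sqrt hx₀.le hY.x₀_lt
  have hlt : ∀ {t}, 0 ≤ t → t < d → |t ^ 2| < b₁ := fun {t} h0 ht ↦ by
    rw [abs_of_nonneg (sq_nonneg t)]; exact (Real.lt_sqrt h0).1 ht
  set A : ℝ → ℝ := fun t ↦ abar α R (t ^ 2) (Y (t ^ 2)) with hA
  set B : ℝ → ℝ := fun t ↦ obar om R (t ^ 2) (Y (t ^ 2)) with hB
  have hltb : ∀ {t}, 0 ≤ t → t < d → |t ^ 2| < b := fun h0 ht ↦ (hlt h0 ht).trans_le hY.b₁_le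
  have hAm : ∀ {t}, 0 ≤ t → t < d → α / 2 ≤ A t ∧ A t ≤ 3 * α / 2 := fun h0 ht ↦
    h.abar_mem (hltb h0 ht) (hY.lt _ (hlt h0 ht))
  have hBm : ∀ {t}, 0 ≤ t → t < d → om / 2 ≤ B t ∧ B t ≤ 3 * om / 2 := fun h0 ht ↦
    h.obar_mem (hltb h0 ht) (hY.lt _ (hlt h0 ht))
  have hAp : ∀ {t}, 0 ≤ t → t < d → 0 < A t := fun h0 ht ↦ by linarith [(hAm h0 ht).1]
  have hBp : ∀ {t}, 0 ≤ t → t < d → 0 < B t := fun h0 ht ↦ by linarith [(hBm h0 ht).1]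
  have hYs : ∀ {t}, 0 ≤ t → t < d → ContDiffAt ℝ ∞ (fun t ↦ Y (t ^ 2)) t := fun {t} h0 ht ↦
    (hY.contDiffAt h (hlt h0 ht)).comp (f := fun t : ℝ ↦ t ^ 2) t (contDiffAt_id.pow 2)
  have hAs : ∀ {t}, 0 ≤ t → t < d → ContDiffAt ℝ ∞ A t := fun {t} h0 ht ↦
    (h.contDiffAt_abar (hltb h0 ht) (hY.lt _ (hlt h0 ht))).comp
      (f := fun t : ℝ ↦ (t ^ 2, Y (t ^ 2))) t ((contDiffAt_id.pow 2).prodMk (hYs h0 ht))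
  have hBs : ∀ {t}, 0 ≤ t → t < d → ContDiffAt ℝ ∞ B t := fun {t} h0 ht ↦
    (h.contDiffAt_obar (hltb h0 ht) (hY.lt _ (hlt h0 ht))).comp
      (f := fun t : ℝ ↦ (t ^ 2, Y (t ^ 2))) t ((contDiffAt_id.pow 2).prodMk (hYs h0 ht))
  obtain ⟨Φ, hΦ0, hΦs, hΦd⟩ := exists_antideriv (g := fun t ↦ -(2 * B t / (A t * t))) (c := 0)
    (d := d) (x₀ := h₀) (fun t ht ↦ by
      have := (hAp ht.1.le ht.2).ne'
      have h3 := ht.1.ne'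
      exact ((contDiffAt_const.mul (hBs ht.1.le ht.2)).div ((hAs ht.1.le ht.2).mul contDiffAt_id)
        (mul_ne_zero this h3)).neg.contDiffWithinAt) ⟨hh₀pos, hh₀d⟩
  set P : ℝ → ℝ := fun t ↦ Y (t ^ 2) * Real.exp (Φ t) with hP
  set P' : ℝ → ℝ := fun t ↦ -(2 * (B t ^ 2 * Y (t ^ 2) + 2 * A t ^ 2 * t ^ 2)) /
    (A t * B t * t) * Real.exp (Φ t) with hP'
  have hPd : ∀ t ∈ Ioo 0 d, HasDerivAt P (P' t) t := by
    intro t ht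
    have e1 : HasDerivAt (fun t ↦ Y (t ^ 2)) (-(2 * A t) / B t * (2 * t)) t := by
      have := (hY.hasDerivAt h (hlt ht.1.le ht.2)).comp (h := fun t : ℝ ↦ t ^ 2) t
        (hasDerivAt_pow 2 t)
      exact HasDerivAt.congr_deriv this (by simp [hA, hB])
    have e2 := e1.mul (hΦd t ht).exp
    refine HasDerivAt.congr_deriv e2 ?_
    have := (hAp ht.1.le ht.2).ne'
    have := (hBp ht.1.le ht.2).ne'
    have := ht.1.ne'
    simp only [hP']
    field_simp
    ring
  have hPs : ∀ t ∈ Ioo 0 d, ContDiffAt ℝ ∞ P t := fun t ht ↦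
    (hYs ht.1.le ht.2).mul (hΦs.contDiffAt (isOpen_Ioo.mem_nhds ht)).exp
  have hYnn : ∀ t, 0 ≤ t → t ≤ h₀ → 0 ≤ Y (t ^ 2) := by
    intro t h0 ht
    rcases eq_or_lt_of_le ht with rfl | ht
    · rw [hsq, hY.Y_x₀]
    · have : t ^ 2 < x₀ := by rw [← hsq]; exact pow_lt_pow_left₀ ht h0 (by norm_num)
      have := hY.strictAnti h (hlt h0 (ht.trans hh₀d)) (by rw [abs_of_pos hx₀]; exact hY.x₀_lt) this
      rw [hY.Y_x₀] at this
      exact this.le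
  have hDpos : ∀ t, 0 < t → t ≤ h₀ → 0 < B t ^ 2 * Y (t ^ 2) + 2 * A t ^ 2 * t ^ 2 := by
    intro t h0 ht
    have := hYnn t h0.le ht
    have := hAp h0.le (ht.trans_lt hh₀d)
    positivity
  -- Positivity is evident only for t ≤ h₀, where Y ≥ 0. By continuity it persists a little beyond
  -- h₀, and so does the monotonicity of P.
  obtain ⟨d', hd'1, hd'2, hDpos'⟩ : ∃ d', h₀ < d' ∧ d' ≤ d ∧ ∀ t ∈ Ioo 0 d',
      0 < B t ^ 2 * Y (t ^ 2) + 2 * A t ^ 2 * t ^ 2 := by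
    have hc : ContinuousAt (fun t ↦ B t ^ 2 * Y (t ^ 2) + 2 * A t ^ 2 * t ^ 2) h₀ := by
      have e1 := (hAs hh₀pos.le hh₀d).continuousAt
      have e2 := (hBs hh₀pos.le hh₀d).continuousAt
      have e3 := (hYs hh₀pos.le hh₀d).continuousAt
      exact ((e2.pow 2).mul e3).add ((continuousAt_const.mul (e1.pow 2)).mul (continuousAt_id.pow 2))
    obtain ⟨ε, hε, hball⟩ := Metric.eventually_nhds_iff.1
      (hc.eventually (lt_mem_nhds (hDpos h₀ hh₀pos le_rfl)))
    refine ⟨min (h₀ + ε) d, lt_min (by linarith) hh₀d, min_le_right _ _, fun t ht ↦ ?_⟩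
    rcases le_or_gt t h₀ with hth | hth
    · exact hDpos t ht.1 hth
    · refine hball ?_
      rw [Real.dist_eq, abs_of_pos (by linarith)]
      linarith [ht.2.trans_le (min_le_left _ _)]
  have hsub : ∀ t ∈ Ioo 0 d', t ∈ Ioo 0 d := fun t ht ↦ ⟨ht.1, ht.2.trans_le hd'2⟩
  have hP'neg : ∀ t ∈ Ioo 0 d', P' t < 0 := by
    intro t ht
    have h1 := hDpos' t ht
    have h2 := hAp ht.1.le (hsub t ht).2
    have h3 := hBp ht.1.le (hsub t ht).2
    refine mul_neg_of_neg_of_pos (div_neg_of_neg_of_pos (by linarith) ?_) (Real.exp_pos _)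
    exact mul_pos (mul_pos h2 h3) ht.1
  have hPanti : StrictAntiOn P (Ioo 0 d') :=
    strictAntiOn_of_deriv_neg (convex_Ioo _ _)
      (fun t ht ↦ (hPd t (hsub t ht)).continuousAt.continuousWithinAt) fun t ht ↦ by
        rw [(hPd t (hsub t (interior_subset ht))).deriv]
        exact hP'neg t (interior_subset ht)
  have hPh₀ : P h₀ = 0 := by simp [hP, hsq, hY.Y_x₀]
  have hh₀d' : h₀ ∈ Ioo 0 d' := ⟨hh₀pos, hd'1⟩
  -- `P` tends to infinity at `0`
  have hPtop : Tendsto P (𝓝[>] 0) atTop := by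
    have h1 : Tendsto (fun t ↦ Y (t ^ 2)) (𝓝[>] 0) (𝓝 (Y 0)) := by
      have := (hYs le_rfl (hh₀pos.trans hh₀d)).continuousAt.tendsto
      simp only [ne_eq, OfNat.ofNat_ne_zero, not_false_eq_true, zero_pow] at this
      exact this.mono_left nhdsWithin_le_nhds
    have hY0 : 0 < Y 0 := by
      have := hY.strictAnti h (by simpa) (by rw [abs_of_pos hx₀]; exact hY.x₀_lt) hx₀
      rwa [hY.Y_x₀] at this
    refine h1.pos_mul_atTop hY0 (Real.tendsto_exp_atTop.comp ?_)
    -- A lower bound for 2B/A, from B ≥ om/2 and A ≤ 3α/2. Hence Φ' ≤ -c/t, and Φ grows at least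
    -- like -c log t as t → 0.
    set c := 2 * (om / 2) / (3 * α / 2) with hc
    have hcpos : 0 < c := by positivity
    have hlog : Tendsto (fun t ↦ c * (Real.log h₀ - Real.log t)) (𝓝[>] 0) atTop := by
      refine Tendsto.const_mul_atTop hcpos ?_
      simp only [sub_eq_add_neg]
      exact tendsto_atTop_add_const_left _ _ (tendsto_neg_atBot_atTop.comp
        Real.tendsto_log_nhdsGT_zero)
    refine tendsto_atTop_mono' _ ?_ hlog
    filter_upwards [Ioo_mem_nhdsGT hh₀pos] with t ht
    have hd1 : ∀ s ∈ Icc t h₀, HasDerivAt (fun s ↦ Φ s + c * Real.log s)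
        (-(2 * B s / (A s * s)) + c * s⁻¹) s := fun s hs ↦
      (hΦd s ⟨ht.1.trans_le hs.1, hs.2.trans_lt hh₀d⟩).add
        ((Real.hasDerivAt_log (ht.1.trans_le hs.1).ne').const_mul c)
    have hanti : AntitoneOn (fun s ↦ Φ s + c * Real.log s) (Icc t h₀) := by
      refine antitoneOn_of_deriv_nonpos (convex_Icc _ _)
        (fun s hs ↦ (hd1 s hs).continuousAt.continuousWithinAt)
        (fun s hs ↦ (hd1 s (interior_subset hs)).differentiableAt.differentiableWithinAt)
        fun s hs ↦ ?_
      have hs := interior_subset hs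
      rw [(hd1 s hs).deriv]
      have hs0 : 0 < s := ht.1.trans_le hs.1
      have hsd : s < d := hs.2.trans_lt hh₀d
      have e1 : c ≤ 2 * B s / A s := by
        rw [hc]
        have := (hBm hs0.le hsd).1
        have := (hAm hs0.le hsd).2
        have := hAp hs0.le hsd
        have := hBp hs0.le hsd
        gcongr
      have e2 : 2 * B s / (A s * s) = 2 * B s / A s * s⁻¹ := by
        rw [← div_div, div_eq_mul_inv (2 * B s / A s)]
      rw [e2]
      have : 0 < s⁻¹ := inv_pos.2 hs0
      nlinarith
    have := hanti (left_mem_Icc.2 ht.2.le) (right_mem_Icc.2 ht.2.le) ht.2.le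
    simp only [hΦ0] at this
    linarith
  have hPsurj : ∀ τ, 0 ≤ τ → ∃ t ∈ Ioc 0 h₀, P t = τ := by
    intro τ hτ
    obtain ⟨t, htτ, ht⟩ := ((hPtop.eventually_ge_atTop τ).and (Ioo_mem_nhdsGT hh₀pos)).exists
    have hcont : ContinuousOn P (Icc t h₀) := fun s hs ↦
      (hPd s ⟨ht.1.trans_le hs.1, hs.2.trans_lt hh₀d⟩).continuousAt.continuousWithinAt
    obtain ⟨s, hs, hsτ⟩ := intermediate_value_Icc' ht.2.le hcont
      (show τ ∈ Icc _ _ from ⟨by rw [hPh₀]; exact hτ, htτ⟩)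
    exact ⟨s, ⟨ht.1.trans_le hs.1, hs.2⟩, hsτ⟩
  set η : ℝ → ℝ := fun τ ↦ Function.invFunOn P (Ioo 0 d') τ with hη
  have hηP : ∀ t ∈ Ioo 0 d', η (P t) = t := fun t ht ↦
    hPanti.injOn.leftInvOn_invFunOn ht
  have hηm : ∀ τ, 0 ≤ τ → η τ ∈ Ioc 0 h₀ ∧ P (η τ) = τ := by
    intro τ hτ
    obtain ⟨t, ht, rfl⟩ := hPsurj τ hτ
    rw [hηP t ⟨ht.1, ht.2.trans_lt hd'1⟩]
    exact ⟨ht, rfl⟩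
  have hηm' : ∀ τ, 0 ≤ τ → η τ ∈ Ioo 0 d' := fun τ hτ ↦
    ⟨(hηm τ hτ).1.1, (hηm τ hτ).1.2.trans_lt hd'1⟩
  have hηs : ∀ τ, 0 ≤ τ → ContDiffAt ℝ ∞ η τ := by
    intro τ hτ
    have hm := hηm' τ hτ
    -- P is open near η τ because P' ≠ 0 there. At τ = 0 this reaches slightly negative τ', taken at
    -- points beyond h₀, so η is smooth on a full neighbourhood of 0.
    have hev : ∀ᶠ τ' in 𝓝 τ, τ' ∈ P '' Ioo 0 d' := by
      have h1 : map P (𝓝 (η τ)) = 𝓝 (P (η τ)) := by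
        have := ((hPs _ (hsub _ hm)).hasStrictDerivAt' (hPd _ (hsub _ hm)) (by simp))
        exact this.map_nhds_eq (hP'neg _ hm).ne
      rw [(hηm τ hτ).2] at h1
      rw [← h1]
      exact image_mem_map (isOpen_Ioo.mem_nhds hm)
    refine contDiffAt_of_implicit (f := fun p ↦ P p.2 - p.1) (f₂ := P' (η τ)) (S := Ioo 0 d')
      ?_ ?_ (hP'neg _ hm).ne (isOpen_Ioo.mem_nhds hm) ?_
    · exact ((hPs _ (hsub _ hm)).comp (τ, η τ) contDiffAt_snd).sub contDiffAt_fst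
    · exact (hPd _ (hsub _ hm)).sub_const _
    · filter_upwards [hev] with τ' hτ' y hy he
      have : P y = τ' := by
        simp only [(hηm τ hτ).2] at he
        linarith
      rw [← this, hηP y hy]
  have hηd : ∀ τ, 0 ≤ τ → HasDerivAt η (P' (η τ))⁻¹ τ := by
    intro τ hτ
    have hm := hηm' τ hτ
    have h1 : HasDerivAt P (P' (η τ)) (η τ) := hPd _ (hsub _ hm)
    refine h1.of_local_left_inverse (hηs τ hτ).continuousAt (hP'neg _ hm).ne ?_
    have h1 : map P (𝓝 (η τ)) = 𝓝 (P (η τ)) := by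
      have := ((hPs _ (hsub _ hm)).hasStrictDerivAt' (hPd _ (hsub _ hm)) (by simp))
      exact this.map_nhds_eq (hP'neg _ hm).ne
    rw [(hηm τ hτ).2] at h1
    rw [← h1]
    filter_upwards [image_mem_map (isOpen_Ioo.mem_nhds hm)]
    rintro _ ⟨t, ht, rfl⟩
    rw [hηP t ht]
  set m : ℝ → ℝ := fun τ ↦ Real.exp (-Φ (η τ) / 2) with hm
  have hmsq : ∀ τ, m τ ^ 2 * Real.exp (Φ (η τ)) = 1 := fun τ ↦ by
    rw [hm, ← Real.exp_nat_mul, ← Real.exp_add]; simp; ring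
  have hmY : ∀ τ, 0 ≤ τ → τ * m τ ^ 2 = Y (η τ ^ 2) := by
    intro τ hτ
    have := (hηm τ hτ).2
    rw [hP] at this
    simp only at this
    calc τ * m τ ^ 2 = Y (η τ ^ 2) * Real.exp (Φ (η τ)) * m τ ^ 2 := by rw [this]
      _ = Y (η τ ^ 2) * (m τ ^ 2 * Real.exp (Φ (η τ))) := by ring
      _ = _ := by rw [hmsq, mul_one]
  have hηlt : ∀ τ, 0 ≤ τ → |η τ ^ 2| < b₁ := fun τ hτ ↦
    hlt (hηm τ hτ).1.1.le ((hηm τ hτ).1.2.trans_lt hh₀d)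
  refine ⟨η, m, hηs, ?_, fun τ hτ ↦ (hηm τ hτ).1.1, fun τ _ ↦ Real.exp_pos _,
    fun τ hτ ↦ (le_abs_self _).trans_lt ((hηlt τ hτ).trans_le hY.b₁_le),
    fun τ hτ ↦ by rw [hmY τ hτ]; exact (le_abs_self _).trans_lt (hY.lt _ (hηlt τ hτ)), hmY,
    fun τ hτ ↦ by rw [hmY τ hτ]; exact hY.level _ (hηlt τ hτ), ?_, ?_, ?_⟩
  · intro τ hτ
    have e1 := hΦs.contDiffAt (isOpen_Ioo.mem_nhds (hsub _ (hηm' τ hτ)))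
    exact ((e1.comp τ (hηs τ hτ)).neg.div_const 2).exp
  · intro τ hτ
    rw [hmY τ hτ]
    refine (hηd τ hτ).congr_deriv ?_
    have hmm := hηm' τ hτ
    have e1 := hDpos' _ hmm
    have e2 := (hAp hmm.1.le (hsub _ hmm).2).ne'
    have e3 := (hBp hmm.1.le (hsub _ hmm).2).ne'
    have e4 := hmm.1.ne'
    have e5 : Real.exp (Φ (η τ)) = (m τ ^ 2)⁻¹ := by
      exact eq_inv_of_mul_eq_one_right (hmsq τ)
    have e6 : m τ ≠ 0 := (Real.exp_pos _).ne'
    simp only [hP', e5]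
    change _ = -(A (η τ) * B (η τ) * η τ * m τ ^ 2) /
      (2 * (B (η τ) ^ 2 * Y (η τ ^ 2) + 2 * A (η τ) ^ 2 * η τ ^ 2))
    have e7 := e1.ne'
    have e8 : (-(2 * (B (η τ) ^ 2 * Y (η τ ^ 2) + 2 * A (η τ) ^ 2 * η τ ^ 2))) ≠ 0 := by
      linarith
    rw [inv_eq_one_div, div_eq_div_iff]
    · field_simp
    · exact mul_ne_zero (div_ne_zero e8 (mul_ne_zero (mul_ne_zero e2 e3) e4)) (by positivity)
    · linarith
  · rw [Metric.tendsto_atTop]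
    intro ε hε
    set ε' := min (ε / 2) (h₀ / 2) with hε'
    have hε'0 : 0 < ε' := by positivity
    have hε'1 : ε' < h₀ := (min_le_right _ _).trans_lt (by linarith)
    have hmem : ε' ∈ Ioo 0 d' := ⟨hε'0, hε'1.trans hd'1⟩
    have hPpos : 0 < P ε' := by rw [← hPh₀]; exact hPanti hmem hh₀d' hε'1
    refine ⟨P ε', fun τ hτ ↦ ?_⟩
    have hτ0 : 0 ≤ τ := hPpos.le.trans hτ
    have : η τ ≤ ε' := by
      by_contra! hcon
      have := hPanti hmem (hηm' τ hτ0) hcon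
      rw [(hηm τ hτ0).2] at this
      linarith
    rw [Real.dist_eq, sub_zero, abs_of_pos (hηm τ hτ0).1.1]
    linarith [min_le_left (ε / 2) (h₀ / 2)]
  -- The condition y ≥ 0 forces t ≤ h₀, since Y is negative beyond x₀; then τ = P t is nonnegative
  -- and is mapped to t.
  · intro t y ht hy htb hyb hE
    have htb₁ := hb₁ _ (sq_nonneg t) htb y hy hyb hE
    have hyY : y = Y (t ^ 2) := hY.eq_of_level h (by rwa [abs_of_nonneg (sq_nonneg t)])
      (by rwa [abs_of_nonneg hy]) hE
    have hth : t ≤ h₀ := by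
      by_contra! hcon
      have : x₀ < t ^ 2 := by rw [← hsq]; exact pow_lt_pow_left₀ hcon hh₀pos.le (by norm_num)
      have := hY.strictAnti h (by rw [abs_of_pos hx₀]; exact hY.x₀_lt)
        (by rwa [abs_of_nonneg (sq_nonneg t)]) this
      rw [hY.Y_x₀, ← hyY] at this
      linarith
    have hmem : t ∈ Ioo 0 d' := ⟨ht, hth.trans_lt hd'1⟩
    refine ⟨P t, ?_, hηP t hmem⟩
    rw [← hPh₀]
    exact hPanti.antitoneOn hmem hh₀d' hth

end Profile

/-! ### 1-forms, endomorphisms and metrics in charts -/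

section Charts

variable {M : Type*} [TopologicalSpace M] [ChartedSpace E3 M]

/-- The derivative of the chart at `x₀`, at the point `x`. -/
def chartD (x₀ x : M) : E3 →L[ℝ] E3 := mfderiv (𝓡 3) 𝓘(ℝ, E3) (extChartAt (𝓡 3) x₀) x

/-- The derivative of the inverse of the chart at `x₀`. -/
def chartDsymm (x₀ : M) (y : E3) : E3 →L[ℝ] E3 :=
  mfderiv 𝓘(ℝ, E3) (𝓡 3) (extChartAt (𝓡 3) x₀).symm y

/-- The derivative of a map to a normed space, as a map on the model space. -/
def spaceD {V : Type*} [NormedAddCommGroup V] [NormedSpace ℝ V] (F : M → V) (x : M) : E3 →L[ℝ] V :=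
  mfderiv (𝓡 3) 𝓘(ℝ, V) F x

lemma chart_target_open (x₀ : M) : IsOpen (extChartAt (𝓡 3) x₀).target :=
  isOpen_extChartAt_target x₀

variable [IsManifold (𝓡 3) ∞ M]

lemma hasMFDerivAt_chart {x₀ x : M} (hx : x ∈ (extChartAt (𝓡 3) x₀).source) :
    HasMFDerivAt (𝓡 3) 𝓘(ℝ, E3) (extChartAt (𝓡 3) x₀) x (chartD x₀ x) := by
  have : IsManifold (𝓡 3) 1 M := .of_le (n := ∞) (by simp)
  exact (mdifferentiableAt_extChartAt (by simpa using hx)).hasMFDerivAt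

lemma hasMFDerivAt_chart_symm {x₀ : M} {y : E3} (hy : y ∈ (extChartAt (𝓡 3) x₀).target) :
    HasMFDerivAt 𝓘(ℝ, E3) (𝓡 3) (extChartAt (𝓡 3) x₀).symm y (chartDsymm x₀ y) := by
  have : IsManifold (𝓡 3) 1 M := .of_le (n := ∞) (by simp)
  have h := mdifferentiableWithinAt_extChartAt_symm (I := 𝓡 3) hy
  rw [ModelWithCorners.Boundaryless.range_eq_univ, mdifferentiableWithinAt_univ] at h
  exact h.hasMFDerivAt

lemma chartD_comp_symm {x₀ x : M} (hx : x ∈ (extChartAt (𝓡 3) x₀).source) (v : E3) :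
    chartD x₀ x (chartDsymm x₀ (extChartAt (𝓡 3) x₀ x) v) = v := by
  have : IsManifold (𝓡 3) 1 M := .of_le (n := ∞) (by simp)
  have h := mfderiv_extChartAt_comp_mfderivWithin_extChartAt_symm' (I := 𝓡 3) hx
  rw [ModelWithCorners.Boundaryless.range_eq_univ, mfderivWithin_univ] at h
  exact DFunLike.congr_fun h v

lemma chartDsymm_comp {x₀ x : M} (hx : x ∈ (extChartAt (𝓡 3) x₀).source) (v : E3) :
    chartDsymm x₀ (extChartAt (𝓡 3) x₀ x) (chartD x₀ x v) = v := by
  have : IsManifold (𝓡 3) 1 M := .of_le (n := ∞) (by simp)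
  have h := mfderivWithin_extChartAt_symm_comp_mfderiv_extChartAt' (I := 𝓡 3) hx
  rw [ModelWithCorners.Boundaryless.range_eq_univ, mfderivWithin_univ] at h
  exact DFunLike.congr_fun h v

/-- The derivative of the chart as an equivalence. -/
def chartDEquiv {x₀ x : M} (hx : x ∈ (extChartAt (𝓡 3) x₀).source) : E3 ≃L[ℝ] E3 :=
  ContinuousLinearEquiv.equivOfInverse (chartD x₀ x) (chartDsymm x₀ (extChartAt (𝓡 3) x₀ x))
    (chartDsymm_comp hx) (chartD_comp_symm hx)

lemma chartDEquiv_apply {x₀ x : M} (hx : x ∈ (extChartAt (𝓡 3) x₀).source) (v : E3) :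
    chartDEquiv hx v = chartD x₀ x v := rfl

@[simp] lemma chartD_chartDEquiv_symm {x₀ x : M} (hx : x ∈ (extChartAt (𝓡 3) x₀).source) (v : E3) :
    chartD x₀ x ((chartDEquiv hx).symm v) = v := (chartDEquiv hx).apply_symm_apply v

lemma chartD_self (x : M) : chartD x x = ContinuousLinearMap.id ℝ E3 := by
  have : IsManifold (𝓡 3) 1 M := .of_le (n := ∞) (by simp)
  exact mfderiv_extChartAt_self (I := 𝓡 3) (x := x)

section Maps

variable {V : Type*} [NormedAddCommGroup V] [NormedSpace ℝ V] {F : M → V}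

lemma contDiffAt_comp_chart_symm {x₀ x : M} (hx : x ∈ (extChartAt (𝓡 3) x₀).source)
    (hF : ContMDiffAt (𝓡 3) 𝓘(ℝ, V) ∞ F x) :
    ContDiffAt ℝ ∞ (F ∘ (extChartAt (𝓡 3) x₀).symm) (extChartAt (𝓡 3) x₀ x) := by
  rw [← contMDiffAt_iff_contDiffAt]
  have h1 : ContMDiffAt 𝓘(ℝ, E3) (𝓡 3) ∞ (extChartAt (𝓡 3) x₀).symm (extChartAt (𝓡 3) x₀ x) :=
    (contMDiffOn_extChartAt_symm x₀).contMDiffAt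
      ((chart_target_open x₀).mem_nhds ((extChartAt (𝓡 3) x₀).map_source hx))
  refine ContMDiffAt.comp _ ?_ h1
  rwa [(extChartAt (𝓡 3) x₀).left_inv hx]

lemma spaceD_eq_fderiv {x₀ x : M} (hx : x ∈ (extChartAt (𝓡 3) x₀).source)
    (hF : MDifferentiableAt (𝓡 3) 𝓘(ℝ, V) F x) :
    spaceD F x = (fderiv ℝ (F ∘ (extChartAt (𝓡 3) x₀).symm) (extChartAt (𝓡 3) x₀ x)).comp
      (chartD x₀ x) := by
  have hy := (extChartAt (𝓡 3) x₀).map_source hx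
  have hl := (extChartAt (𝓡 3) x₀).left_inv hx
  have h1 : HasMFDerivAt (𝓡 3) 𝓘(ℝ, V) F ((extChartAt (𝓡 3) x₀).symm (extChartAt (𝓡 3) x₀ x))
      (mfderiv (𝓡 3) 𝓘(ℝ, V) F ((extChartAt (𝓡 3) x₀).symm (extChartAt (𝓡 3) x₀ x))) := by
    rw [hl]; exact hF.hasMFDerivAt
  have h2 : HasFDerivAt (F ∘ (extChartAt (𝓡 3) x₀).symm)
      ((spaceD F ((extChartAt (𝓡 3) x₀).symm (extChartAt (𝓡 3) x₀ x))).comp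
        (chartDsymm x₀ (extChartAt (𝓡 3) x₀ x))) (extChartAt (𝓡 3) x₀ x) :=
    hasMFDerivAt_iff_hasFDerivAt.1 (h1.comp _ (hasMFDerivAt_chart_symm hy))
  ext1 v
  rw [h2.fderiv, hl, ContinuousLinearMap.comp_apply, ContinuousLinearMap.comp_apply,
    chartDsymm_comp hx]

lemma fderiv_comp_chart_symm {x₀ : M} {y : E3} (hy : y ∈ (extChartAt (𝓡 3) x₀).target)
    (hF : MDifferentiableAt (𝓡 3) 𝓘(ℝ, V) F ((extChartAt (𝓡 3) x₀).symm y)) :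
    fderiv ℝ (F ∘ (extChartAt (𝓡 3) x₀).symm) y =
      (spaceD F ((extChartAt (𝓡 3) x₀).symm y)).comp (chartDsymm x₀ y) := by
  have h2 : HasFDerivAt (F ∘ (extChartAt (𝓡 3) x₀).symm)
      ((spaceD F ((extChartAt (𝓡 3) x₀).symm y)).comp (chartDsymm x₀ y)) y :=
    hasMFDerivAt_iff_hasFDerivAt.1 (hF.hasMFDerivAt.comp _ (hasMFDerivAt_chart_symm hy))
  exact h2.fderiv

end Maps

/-- The exterior derivative as a bilinear form on the model space. -/
def extDL (lam : OneForm M) (x : M) : E3 →L[ℝ] E3 →L[ℝ] ℝ :=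
  fderiv ℝ (chartForm lam x) (extChartAt (𝓡 3) x x) -
    (fderiv ℝ (chartForm lam x) (extChartAt (𝓡 3) x x)).flip

/-- The value of a 1-form as a functional on the model space. -/
def formAt (lam : OneForm M) (x : M) : E3 →L[ℝ] ℝ := lam x

lemma extD_eq_dForm (lam : OneForm M) (x : M) (v w : E3) :
    extD lam x v w = dForm (chartForm lam x) (extChartAt (𝓡 3) x x) v w := by
  have h : ∀ v : E3, mfderiv (𝓡 3) 𝓘(ℝ, E3) (extChartAt (𝓡 3) x) x v = v := fun v ↦
    DFunLike.congr_fun (chartD_self x) v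
  change fderiv ℝ (chartForm lam x) (extChartAt (𝓡 3) x x) (mfderiv (𝓡 3) 𝓘(ℝ, E3) (extChartAt (𝓡 3) x) x v)
      (mfderiv (𝓡 3) 𝓘(ℝ, E3) (extChartAt (𝓡 3) x) x w) -
    fderiv ℝ (chartForm lam x) (extChartAt (𝓡 3) x x) (mfderiv (𝓡 3) 𝓘(ℝ, E3) (extChartAt (𝓡 3) x) x w)
      (mfderiv (𝓡 3) 𝓘(ℝ, E3) (extChartAt (𝓡 3) x) x v) = _
  rw [h, h]
  rfl

lemma extDL_apply (lam : OneForm M) (x : M) (v w : E3) : extDL lam x v w = extD lam x v w := by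
  rw [extD_eq_dForm]; rfl

omit [IsManifold (𝓡 3) ∞ M] in
lemma chartForm_eq (lam : OneForm M) (x₀ : M) (y : E3) : chartForm lam x₀ y =
    (formAt lam ((extChartAt (𝓡 3) x₀).symm y)).comp (chartDsymm x₀ y) := rfl

lemma formAt_eq_chartForm (lam : OneForm M) {x₀ x : M} (hx : x ∈ (extChartAt (𝓡 3) x₀).source) :
    formAt lam x = (chartForm lam x₀ (extChartAt (𝓡 3) x₀ x)).comp (chartD x₀ x) := by
  ext v
  rw [chartForm_eq, (extChartAt (𝓡 3) x₀).left_inv hx, ContinuousLinearMap.comp_apply,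
    ContinuousLinearMap.comp_apply, chartDsymm_comp hx]

/-- Translates the trivialisation of the cotangent bundle into the chart expression, so that
smoothness of a section becomes ordinary smoothness of `chartForm`. -/
lemma inCoordinates_oneForm (lam : OneForm M) {x₀ x : M}
    (hx : x ∈ (extChartAt (𝓡 3) x₀).source) :
    ContinuousLinearMap.inCoordinates E3 (TangentSpace (𝓡 3) : M → Type _) ℝ (Bundle.Trivial M ℝ)
      x₀ x x₀ x (lam x) = chartForm lam x₀ (extChartAt (𝓡 3) x₀ x) := by
  have : IsManifold (𝓡 3) 1 M := .of_le (n := ∞) (by simp)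
  have h := TangentBundle.symmL_trivializationAt (I := 𝓡 3) (x₀ := x₀) (x := x) (by simpa using hx)
  rw [ModelWithCorners.Boundaryless.range_eq_univ, mfderivWithin_univ] at h
  rw [ContinuousLinearMap.inCoordinates, h, chartForm_eq, (extChartAt (𝓡 3) x₀).left_inv hx]
  ext v
  simp
  rfl

lemma SmoothOneForm.contDiffAt_chartForm {lam : OneForm M} (h : SmoothOneForm lam) (x₀ : M) :
    ContDiffAt ℝ ∞ (chartForm lam x₀) (extChartAt (𝓡 3) x₀ x₀) := by
  have h1 := ((contMDiffAt_hom_bundle _).1 (h x₀)).2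
  have hx₀ : x₀ ∈ (extChartAt (𝓡 3) x₀).source := mem_extChartAt_source x₀
  have h2 := contDiffAt_comp_chart_symm hx₀ h1
  refine h2.congr_of_eventuallyEq ?_
  filter_upwards [(chart_target_open x₀).mem_nhds ((extChartAt (𝓡 3) x₀).map_source hx₀)] with y hy
  simp only [Function.comp_apply]
  rw [inCoordinates_oneForm lam ((extChartAt (𝓡 3) x₀).map_target hy),
    (extChartAt (𝓡 3) x₀).right_inv hy]

lemma smoothEndField_of_chart {J : EndField M} (h : ∀ x₀ : M, ∃ Jc : E3 → E3 →L[ℝ] E3,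
    ContDiffAt ℝ ∞ Jc (extChartAt (𝓡 3) x₀ x₀) ∧ ∀ᶠ x in 𝓝 x₀, ∀ v : E3,
      chartD x₀ x (J x v) = Jc (extChartAt (𝓡 3) x₀ x) (chartD x₀ x v)) :
    SmoothEndField J := by
  have : IsManifold (𝓡 3) 1 M := .of_le (n := ∞) (by simp)
  intro x₀
  obtain ⟨Jc, hJc, hJ⟩ := h x₀
  rw [contMDiffAt_hom_bundle]
  refine ⟨contMDiffAt_id, ?_⟩
  have h1 : ContMDiffAt (𝓡 3) 𝓘(ℝ, E3 →L[ℝ] E3) ∞ (fun x ↦ Jc (extChartAt (𝓡 3) x₀ x)) x₀ :=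
    ContMDiffAt.comp x₀ hJc.contMDiffAt contMDiffAt_extChartAt
  refine h1.congr_of_eventuallyEq ?_
  filter_upwards [hJ, extChartAt_source_mem_nhds (I := 𝓡 3) x₀] with x hx hxs
  have e1 := TangentBundle.symmL_trivializationAt (I := 𝓡 3) (x₀ := x₀) (x := x) (by simpa using hxs)
  have e2 := TangentBundle.continuousLinearMapAt_trivializationAt (I := 𝓡 3) (x₀ := x₀) (x := x)
    (by simpa using hxs)
  rw [ModelWithCorners.Boundaryless.range_eq_univ, mfderivWithin_univ] at e1
  rw [ContinuousLinearMap.inCoordinates, e1, e2]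
  ext1 v
  change chartD x₀ x (J x (chartDsymm x₀ (extChartAt (𝓡 3) x₀ x) v)) = _
  rw [hx, chartD_comp_symm hxs]

/-- The exterior derivative may be computed in any chart. -/
lemma extD_eq_dForm_chart {lam : OneForm M} {x₀ x : M} (hx : x ∈ (extChartAt (𝓡 3) x₀).source)
    (hl : DifferentiableAt ℝ (chartForm lam x₀) (extChartAt (𝓡 3) x₀ x)) (v w : E3) :
    extD lam x v w = dForm (chartForm lam x₀) (extChartAt (𝓡 3) x₀ x)
      (chartD x₀ x v) (chartD x₀ x w) := by
  -- `extD` at x uses the chart centred at x, which varies with x. The transition map to one fixed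
  -- chart, together with `dForm_pullback`, removes this dependence.
  set Θ : E3 → E3 := extChartAt (𝓡 3) x₀ ∘ (extChartAt (𝓡 3) x).symm with hΘ
  have hxx : x ∈ (extChartAt (𝓡 3) x).source := mem_extChartAt_source x
  set y := extChartAt (𝓡 3) x x with hy
  have hyt : y ∈ (extChartAt (𝓡 3) x).target := (extChartAt (𝓡 3) x).map_source hxx
  have hΘy : Θ y = extChartAt (𝓡 3) x₀ x := by simp [hΘ, hy]
  have hsm : ContMDiffAt (𝓡 3) 𝓘(ℝ, E3) ∞ (extChartAt (𝓡 3) x₀) x :=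
    contMDiffAt_extChartAt' (by simpa using hx)
  have hΘs : ContDiffAt ℝ ∞ Θ y := contDiffAt_comp_chart_symm hxx hsm
  have hΘd : fderiv ℝ Θ y = chartD x₀ x := by
    have := spaceD_eq_fderiv hxx (hsm.mdifferentiableAt (by simp))
    rw [chartD_self] at this
    exact this.symm
  have hΘ2 : ContDiffAt ℝ 2 Θ y := hΘs.of_le (by norm_cast)
  rw [extD_eq_dForm, dForm_pullback (Θ := Θ) (l := chartForm lam x₀) hΘ2
    (by rwa [hΘy]), hΘy, hΘd]
  have hev : ∀ᶠ y' in 𝓝 y, y' ∈ (extChartAt (𝓡 3) x).target ∧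
      (extChartAt (𝓡 3) x).symm y' ∈ (extChartAt (𝓡 3) x₀).source := by
    refine Eventually.and ((chart_target_open x).mem_nhds hyt) ?_
    have hc : ContinuousAt (extChartAt (𝓡 3) x).symm y := continuousAt_extChartAt_symm x
    refine hc.eventually_mem ?_
    rw [hy, (extChartAt (𝓡 3) x).left_inv hxx]
    exact (isOpen_extChartAt_source x₀).mem_nhds hx
  filter_upwards [hev] with y' hy'
  have e1 : Θ y' = extChartAt (𝓡 3) x₀ ((extChartAt (𝓡 3) x).symm y') := rfl
  have e2 : fderiv ℝ Θ y' = (chartD x₀ ((extChartAt (𝓡 3) x).symm y')).comp (chartDsymm x y') :=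
    fderiv_comp_chart_symm hy'.1 (hasMFDerivAt_chart hy'.2).mdifferentiableAt
  rw [chartForm_eq, e2, e1, formAt_eq_chartForm lam hy'.2]
  rfl

/-- A field of bilinear forms that is smooth at `x₀`. -/
def SmoothBilinAt (g : M → E3 →L[ℝ] E3 →L[ℝ] ℝ) (x₀ : M) : Prop :=
  ∃ Gc : E3 → E3 →L[ℝ] E3 →L[ℝ] ℝ, ContDiffAt ℝ ∞ Gc (extChartAt (𝓡 3) x₀ x₀) ∧
    ∀ᶠ x in 𝓝 x₀, ∀ v w, g x v w = Gc (extChartAt (𝓡 3) x₀ x) (chartD x₀ x v) (chartD x₀ x w)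

omit [IsManifold (𝓡 3) ∞ M] in
lemma SmoothBilinAt.add {g g' : M → E3 →L[ℝ] E3 →L[ℝ] ℝ} {x₀ : M} (h : SmoothBilinAt g x₀)
    (h' : SmoothBilinAt g' x₀) : SmoothBilinAt (fun x ↦ g x + g' x) x₀ := by
  obtain ⟨G, h1, h2⟩ := h
  obtain ⟨G', h1', h2'⟩ := h'
  refine ⟨fun y ↦ G y + G' y, h1.add h1', ?_⟩
  filter_upwards [h2, h2'] with x e1 e2 v w
  simp [e1, e2]

omit [IsManifold (𝓡 3) ∞ M] in
lemma SmoothBilinAt.congr {g g' : M → E3 →L[ℝ] E3 →L[ℝ] ℝ} {x₀ : M} (h : SmoothBilinAt g x₀)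
    (he : ∀ᶠ x in 𝓝 x₀, g' x = g x) : SmoothBilinAt g' x₀ := by
  obtain ⟨G, h1, h2⟩ := h
  refine ⟨G, h1, ?_⟩
  filter_upwards [h2, he] with x e1 e2 v w
  rw [e2, e1]

omit [IsManifold (𝓡 3) ∞ M] in
lemma smoothBilinAt_zero (x₀ : M) : SmoothBilinAt (fun _ : M ↦ 0) x₀ :=
  ⟨fun _ ↦ 0, contDiffAt_const, Eventually.of_forall fun _ _ _ ↦ by simp⟩

section Pull

variable {V : Type*} [NormedAddCommGroup V] [NormedSpace ℝ V]

/-- The pull-back of a bilinear form by the derivative of a map. -/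
def bilinComp (Q : V →L[ℝ] V →L[ℝ] ℝ) (D : E3 →L[ℝ] V) : E3 →L[ℝ] E3 →L[ℝ] ℝ :=
  ((ContinuousLinearMap.compL ℝ E3 V ℝ).flip D).comp (Q.comp D)

@[simp] lemma bilinComp_apply (Q : V →L[ℝ] V →L[ℝ] ℝ) (D : E3 →L[ℝ] V) (v w : E3) :
    bilinComp Q D v w = Q (D v) (D w) := by simp [bilinComp]

lemma smoothBilinAt_pull {F : M → V} {Q : M → V →L[ℝ] V →L[ℝ] ℝ} {x₀ : M}
    (hF : ContMDiffAt (𝓡 3) 𝓘(ℝ, V) ∞ F x₀)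
    (hQ : ContMDiffAt (𝓡 3) 𝓘(ℝ, V →L[ℝ] V →L[ℝ] ℝ) ∞ Q x₀) :
    SmoothBilinAt (fun x ↦ bilinComp (Q x) (spaceD F x)) x₀ := by
  have hx₀ : x₀ ∈ (extChartAt (𝓡 3) x₀).source := mem_extChartAt_source x₀
  have h1 := contDiffAt_comp_chart_symm hx₀ hF
  have h2 := contDiffAt_comp_chart_symm hx₀ hQ
  have h3 : ContDiffAt ℝ ∞ (fderiv ℝ (F ∘ (extChartAt (𝓡 3) x₀).symm)) (extChartAt (𝓡 3) x₀ x₀) :=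
    h1.fderiv_right (by simp)
  refine ⟨fun y ↦ bilinComp (Q ((extChartAt (𝓡 3) x₀).symm y))
    (fderiv ℝ (F ∘ (extChartAt (𝓡 3) x₀).symm) y), ?_, ?_⟩
  · have h4 : ContDiffAt ℝ ∞ (fun y ↦ (ContinuousLinearMap.compL ℝ E3 V ℝ).flip
      (fderiv ℝ (F ∘ (extChartAt (𝓡 3) x₀).symm) y)) (extChartAt (𝓡 3) x₀ x₀) :=
      contDiffAt_const.clm_apply h3
    exact h4.clm_comp (h2.clm_comp h3)
  · have hF1 : ContMDiffAt (𝓡 3) 𝓘(ℝ, V) 1 F x₀ := ContMDiffAt.of_le hF (by norm_cast)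
    have : IsManifold (𝓡 3) 1 M := .of_le (n := ∞) (by simp)
    have hd : ∀ᶠ x in 𝓝 x₀, ContMDiffAt (𝓡 3) 𝓘(ℝ, V) 1 F x :=
      (contMDiffAt_iff_contMDiffAt_nhds (by simp)).1 hF1
    filter_upwards [hd, extChartAt_source_mem_nhds (I := 𝓡 3) x₀] with x hx hxs v w
    rw [bilinComp_apply, bilinComp_apply, (extChartAt (𝓡 3) x₀).left_inv hxs,
      spaceD_eq_fderiv hxs (hx.mdifferentiableAt (by simp))]
    rfl

end Pull

/-! ### Compatible complex structures from metrics -/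

section ContactForms

variable {lam : OneForm M}

lemma IsContactForm.isContactPair (h : IsContactForm lam) (x : M) :
    IsContactPair (formAt lam x) (extDL lam x) := by
  refine ⟨fun v w ↦ ?_, ?_⟩
  · rw [extDL_apply, extDL_apply, extD_eq_dForm, extD_eq_dForm, dForm, dForm]; ring
  · obtain ⟨u, v, w, hw⟩ := h.nondeg x
    refine ⟨u, v, w, ?_⟩
    have e (u v w : E3) : wedge (formAt lam x) (extDL lam x) u v w = lam x u * extD lam x v w +
        lam x v * extD lam x w u + lam x w * extD lam x u v := by
      rw [wedge, extDL_apply, extDL_apply, extDL_apply]; rfl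
    exact (e u v w).trans_ne hw

/-- `reeb` is a choice among solutions of its two equations; for a contact pair the solution exists
and is unique. -/
lemma IsContactForm.reeb_eq (h : IsContactForm lam) (x : M) :
    reeb lam x = reebVec (formAt lam x) (extDL lam x) := by
  have hp := h.isContactPair x
  have hs := hp.reebVec_spec
  have h1 : ∃ X : TangentSpace (𝓡 3) x, lam x X = 1 ∧ ∀ v, extD lam x X v = 0 :=
    ⟨reebVec (formAt lam x) (extDL lam x), hs.1, fun v ↦ by
      exact (extDL_apply lam x _ v).symm.trans (hs.2 v)⟩
  have h2 := Classical.epsilon_spec h1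
  exact hp.eq_reebVec h2.1 fun v ↦ (extDL_apply lam x _ v).trans (h2.2 v)

lemma IsContactForm.reeb_unique (h : IsContactForm lam) {x : M} {X : E3}
    (h1 : formAt lam x X = 1) (h2 : ∀ v : E3, extDL lam x X v = 0) : reeb lam x = X := by
  rw [h.reeb_eq]
  exact ((h.isContactPair x).eq_reebVec h1 h2).symm

/-- The compatible complex structure in the conformal class of a metric. -/
def metricJ (lam : OneForm M) (g : M → E3 →L[ℝ] E3 →L[ℝ] ℝ) : EndField M :=
  fun x ↦ conformalJ (formAt lam x) (extDL lam x) (g x)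

omit [IsManifold (𝓡 3) ∞ M] in
lemma metricJ_apply (g : M → E3 →L[ℝ] E3 →L[ℝ] ℝ) (x : M) (v : E3) :
    metricJ lam g x v = conformalJ (formAt lam x) (extDL lam x) (g x) v := rfl

/-- Near x₀ the forms λ, dλ and g at a point are pulled back from smooth data on the chart at x₀ by
the derivative of that chart. By `conformalJ_pull` J is represented in the chart by `conformalJ` of
these data, which is smooth by `contDiffAt_conformalJ`. -/
lemma IsContactForm.smooth_metricJ (h : IsContactForm lam) {g : M → E3 →L[ℝ] E3 →L[ℝ] ℝ}
    (hg : ∀ x, SmoothBilinAt g x) (hpos : ∀ x, IsKerMetric (formAt lam x) (g x)) :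
    SmoothEndField (metricJ lam g) := by
  refine smoothEndField_of_chart fun x₀ ↦ ?_
  obtain ⟨Gc, hGc, hgG⟩ := hg x₀
  have hl := h.smooth.contDiffAt_chartForm x₀
  set Ωc : E3 → E3 →L[ℝ] E3 →L[ℝ] ℝ := fun y ↦ fderiv ℝ (chartForm lam x₀) y -
    (fderiv ℝ (chartForm lam x₀) y).flip with hΩc
  have hΩs : ContDiffAt ℝ ∞ Ωc (extChartAt (𝓡 3) x₀ x₀) := by
    have h1 : ContDiffAt ℝ ∞ (fderiv ℝ (chartForm lam x₀)) (extChartAt (𝓡 3) x₀ x₀) :=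
      hl.fderiv_right (by simp)
    have h2 : ContDiffAt ℝ ∞ (fun y ↦ (ContinuousLinearMap.flipₗᵢ ℝ E3 E3 ℝ :
        (E3 →L[ℝ] E3 →L[ℝ] ℝ) ≃ₗᵢ[ℝ] (E3 →L[ℝ] E3 →L[ℝ] ℝ)).toContinuousLinearEquiv
        (fderiv ℝ (chartForm lam x₀) y)) (extChartAt (𝓡 3) x₀ x₀) :=
      (ContinuousLinearEquiv.contDiff _).contDiffAt.comp _ h1
    exact h1.sub h2
  have key : ∀ᶠ x in 𝓝 x₀, ∃ hx : x ∈ (extChartAt (𝓡 3) x₀).source,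
      formAt lam x = (chartForm lam x₀ (extChartAt (𝓡 3) x₀ x)).comp (chartDEquiv hx : E3 →L[ℝ] E3) ∧
      extDL lam x = bilinPull (Ωc (extChartAt (𝓡 3) x₀ x)) (chartDEquiv hx : E3 →L[ℝ] E3) ∧
      g x = bilinPull (Gc (extChartAt (𝓡 3) x₀ x)) (chartDEquiv hx : E3 →L[ℝ] E3) := by
    have hd : ∀ᶠ y in 𝓝 (extChartAt (𝓡 3) x₀ x₀), ContDiffAt ℝ 1 (chartForm lam x₀) y :=
      (hl.of_le (by simp)).eventually (by simp)
    have hd' := (continuousAt_extChartAt (I := 𝓡 3) x₀).eventually hd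
    filter_upwards [hd', hgG, extChartAt_source_mem_nhds (I := 𝓡 3) x₀] with x h1 h2 hx
    refine ⟨hx, formAt_eq_chartForm lam hx, ?_, ?_⟩
    · ext v w
      rw [extDL_apply, extD_eq_dForm_chart hx (h1.differentiableAt (by simp)), bilinPull_apply]
      rfl
    · ext v w
      rw [h2, bilinPull_apply]
      rfl
  have key2 : ∀ x (hx : x ∈ (extChartAt (𝓡 3) x₀).source),
      formAt lam x = (chartForm lam x₀ (extChartAt (𝓡 3) x₀ x)).comp (chartDEquiv hx : E3 →L[ℝ] E3) →
      extDL lam x = bilinPull (Ωc (extChartAt (𝓡 3) x₀ x)) (chartDEquiv hx : E3 →L[ℝ] E3) →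
      IsContactPair (chartForm lam x₀ (extChartAt (𝓡 3) x₀ x)) (Ωc (extChartAt (𝓡 3) x₀ x)) := by
    intro x hx e1 e2
    have h1 := (h.isContactPair x).pull (chartDEquiv hx).symm
    rw [e1, e2] at h1
    convert h1 using 1
    · ext v; simp
    · ext v w; simp
  refine ⟨fun y ↦ conformalJ (chartForm lam x₀ y) (Ωc y) (Gc y), ?_, ?_⟩
  · obtain ⟨hx, e1, e2, e3⟩ := key.self_of_nhds
    refine contDiffAt_conformalJ hl hΩs hGc (key2 x₀ hx e1 e2) ?_
    have hp := hpos x₀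
    rw [e1, e3] at hp
    refine ⟨fun v w ↦ ?_, fun v hv hv0 ↦ ?_⟩
    · simpa using hp.symm ((chartDEquiv hx).symm v) ((chartDEquiv hx).symm w)
    · simpa using hp.pos ((chartDEquiv hx).symm v) (by simpa using hv) (by simpa using hv0)
  · filter_upwards [key] with x ⟨hx, e1, e2, e3⟩ v
    rw [metricJ_apply, e1, e2, e3, ← chartDEquiv_apply hx, ← chartDEquiv_apply hx]
    exact (key2 x hx e1 e2).conformalJ_pull (chartDEquiv hx) v

lemma IsContactForm.isCompatible_metricJ (h : IsContactForm lam) {g : M → E3 →L[ℝ] E3 →L[ℝ] ℝ}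
    (hg : ∀ x, SmoothBilinAt g x) (hpos : ∀ x, IsKerMetric (formAt lam x) (g x)) :
    IsCompatible lam (metricJ lam g) := by
  have hext : ∀ x (v w : E3), extD lam x v w = extDL lam x v w := fun x v w ↦
    (extDL_apply lam x v w).symm
  refine ⟨h.smooth_metricJ hg hpos, fun x ↦ ?_, fun x v _ ↦ ?_, fun x v hv ↦ ?_,
    fun x v w hv hw ↦ ?_, fun x v hv hv0 ↦ ?_⟩
  · rw [h.reeb_eq]
    exact (h.isContactPair x).conformalJ_reebVec
  · exact (h.isContactPair x).conformalJ_mem_ker v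
  · exact (h.isContactPair x).conformalJ_sq (hpos x) hv
  · exact (hext x v _).trans (((h.isContactPair x).conformalJ_symm (hpos x) hv hw).trans
      (hext x w _).symm)
  · exact ((h.isContactPair x).conformalJ_pos (hpos x) hv hv0).trans_eq (hext x v _).symm

end ContactForms

end Charts

/-! ### Maps into a collar -/

section Collar

variable {W : Type*} [TopologicalSpace W] [ChartedSpace E3 W] [IsManifold (𝓡 3) ∞ W]
  {C : Set E4} {f : E4 → W} {κ : W → E4}

namespace IsDiffeoOnto

variable (hd : IsDiffeoOnto C f κ)
include hd

omit [IsManifold (𝓡 3) ∞ W] in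
lemma contMDiffAt_inv {x : W} (hx : x ∈ f '' C) : ContMDiffAt (𝓡 3) 𝓘(ℝ, E4) ∞ κ x :=
  hd.smooth_inv.contMDiffAt (hd.isOpen_image.mem_nhds hx)

omit [IsManifold (𝓡 3) ∞ W] in
lemma spaceD_injective {x : W} (hx : x ∈ f '' C) : Function.Injective (spaceD κ x) :=
  hd.immersion x hx

section Comp

variable {EN HN N : Type*} [NormedAddCommGroup EN] [NormedSpace ℝ EN] [TopologicalSpace HN]
  {I : ModelWithCorners ℝ EN HN} [TopologicalSpace N] [ChartedSpace HN N] {F : N → E4} {p : N}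

/-- A smooth map to `ℝ⁴` with values in the collar is smooth as a map to the manifold. -/
lemma contMDiffAt_comp (hF : ContMDiffAt I 𝓘(ℝ, E4) ∞ F p) (hC : ∀ᶠ q in 𝓝 p, F q ∈ C) :
    ContMDiffAt I (𝓡 3) ∞ (f ∘ F) p := by
  have hpC := hC.self_of_nhds
  set x := f (F p) with hx
  have hxC : x ∈ f '' C := mem_image_of_mem f hpC
  have hxs : x ∈ (extChartAt (𝓡 3) x).source := mem_extChartAt_source x
  have hκ := hd.contMDiffAt_inv hxC
  have hk := contDiffAt_comp_chart_symm hxs hκ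
  set k : E3 → E4 := κ ∘ (extChartAt (𝓡 3) x).symm with hkdef
  have hkd : fderiv ℝ k (extChartAt (𝓡 3) x x) = spaceD κ x := by
    have := spaceD_eq_fderiv hxs (hκ.mdifferentiableAt (by simp))
    rw [chartD_self] at this
    exact this.symm
  -- With L a left inverse of dκ, the map L ∘ κ read in the chart has derivative the identity at the
  -- base point and is locally invertible. Since κ ∘ f ∘ F = F, the chart expression of f ∘ F is
  -- this local inverse applied to L ∘ F.
  obtain ⟨L, hL⟩ := LinearMap.exists_leftInverse_of_injective (spaceD κ x : E3 →ₗ[ℝ] E4)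
    (LinearMap.ker_eq_bot.2 (hd.spaceD_injective hxC))
  set L' : E4 →L[ℝ] E3 := LinearMap.toContinuousLinearMap L with hL'
  have hψ : ContDiffAt ℝ ∞ (L' ∘ k) (extChartAt (𝓡 3) x x) := L'.contDiff.contDiffAt.comp _ hk
  have hψd : HasFDerivAt (L' ∘ k) ((ContinuousLinearEquiv.refl ℝ E3 : E3 ≃L[ℝ] E3) : E3 →L[ℝ] E3)
      (extChartAt (𝓡 3) x x) := by
    have h1 := L'.hasFDerivAt.comp (extChartAt (𝓡 3) x x)
      (hk.differentiableAt (by simp)).hasFDerivAt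
    refine h1.congr_fderiv ?_
    rw [hkd]
    ext1 v
    exact DFunLike.congr_fun hL v
  have hn : (∞ : ℕ∞ω) ≠ 0 := by simp
  have hinv := hψ.to_localInverse hψd hn
  have hleft := (hψ.hasStrictFDerivAt' hψd hn).eventually_left_inverse
  have hcont : ContinuousAt (f ∘ F) p := by
    have h1 : Tendsto F (𝓝 p) (𝓝[C] (F p)) :=
      tendsto_nhdsWithin_iff.2 ⟨hF.continuousAt, hC⟩
    exact (hd.continuousOn (F p) hpC).tendsto.comp h1
  rw [contMDiffAt_iff_target]
  refine ⟨hcont, ?_⟩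
  have hval : (L' ∘ k) (extChartAt (𝓡 3) x x) = L' (F p) := by
    simp only [hkdef, Function.comp_apply, (extChartAt (𝓡 3) x).left_inv hxs]
    rw [hx, hd.leftInv _ hpC]
  have h2 : ContMDiffAt I 𝓘(ℝ, E3) ∞ (fun q ↦ hψ.localInverse hψd hn (L' (F q))) p := by
    have h3 : ContMDiffAt I 𝓘(ℝ, E3) ∞ (fun q ↦ L' (F q)) p :=
      (L'.contDiff.contDiffAt.contMDiffAt).comp p hF
    rw [hval] at hinv
    exact ContMDiffAt.comp p (g := hψ.localInverse hψd hn) hinv.contMDiffAt h3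
  refine h2.congr_of_eventuallyEq ?_
  have hch : ∀ᶠ q in 𝓝 p, f (F q) ∈ (extChartAt (𝓡 3) x).source :=
    hcont.eventually_mem (extChartAt_source_mem_nhds (I := 𝓡 3) x)
  have hl' : ∀ᶠ q in 𝓝 p, hψ.localInverse hψd hn ((L' ∘ k) (extChartAt (𝓡 3) x (f (F q)))) =
      extChartAt (𝓡 3) x (f (F q)) :=
    ((continuousAt_extChartAt (I := 𝓡 3) x).comp_of_eq hcont rfl).eventually hleft
  filter_upwards [hC, hch, hl'] with q h1 h4 h5
  change extChartAt (𝓡 3) x (f (F q)) = _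
  rw [← h5]
  simp only [hkdef, Function.comp_apply, (extChartAt (𝓡 3) x).left_inv h4, hd.leftInv _ h1]

/-- The derivative of κ ∘ f ∘ F = F. As dκ is injective, it determines tangent vectors of W from
computations in ℝ⁴. -/
lemma spaceD_mfderiv_comp (hF : ContMDiffAt I 𝓘(ℝ, E4) ∞ F p) (hC : ∀ᶠ q in 𝓝 p, F q ∈ C)
    (v : TangentSpace I p) :
    spaceD κ (f (F p)) (mfderiv I (𝓡 3) (f ∘ F) p v) = mfderiv I 𝓘(ℝ, E4) F p v := by
  have h1 := (hd.contMDiffAt_inv (mem_image_of_mem f hC.self_of_nhds)).mdifferentiableAt (by simp)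
  have h2 := (hd.contMDiffAt_comp hF hC).mdifferentiableAt (by simp)
  have h3 := HasMFDerivAt.comp p (g := κ) (f := f ∘ F) h1.hasMFDerivAt h2.hasMFDerivAt
  have h4 : HasMFDerivAt I 𝓘(ℝ, E4) F p _ := h3.congr_of_eventuallyEq (by
    filter_upwards [hC] with q hq
    exact (hd.leftInv _ hq).symm)
  rw [h4.mfderiv]
  rfl

end Comp

end IsDiffeoOnto

/-! ### The Liouville form -/

/-- The coordinate functionals on `ℝ⁴`. -/
def coordL (i : Fin 4) : E4 →L[ℝ] ℝ := EuclideanSpace.proj i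

@[simp] lemma coordL_apply (i : Fin 4) (z : E4) : coordL i z = z i := rfl

/-- The Liouville form as a linear map. -/
def liouvilleL : E4 →L[ℝ] E4 →L[ℝ] ℝ :=
  (2 : ℝ)⁻¹ • ((coordL 2).smulRight (coordL 0) - (coordL 0).smulRight (coordL 2) +
    ((coordL 3).smulRight (coordL 1) - (coordL 1).smulRight (coordL 3)))

lemma liouvilleL_apply (z v : E4) : liouvilleL z v = liouville z v := by
  have : liouvilleL z v = 2⁻¹ * (z 2 * v 0 - z 0 * v 2 + (z 3 * v 1 - z 1 * v 3)) := rfl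
  rw [this, liouville]; ring

lemma dForm_liouvilleL (z v w : E4) : dForm liouvilleL z v w = omega0 v w := by
  rw [dForm, ContinuousLinearMap.fderiv, liouvilleL_apply, liouvilleL_apply, liouville, liouville,
    omega0]
  ring

/-- `O` is an open subset of the collar on which `lam` is the Liouville form. -/
structure IsLiouvilleCollar (C : Set E4) (f : E4 → W) (κ : W → E4) (lam : OneForm W)
    (O : Set W) : Prop where
  collar : IsDiffeoOnto C f κ
  contact : IsContactForm lam
  isOpen : IsOpen O
  subset : O ⊆ f '' C
  form : ∀ x ∈ O, ∀ v : E3, formAt lam x v = liouville (κ x) (spaceD κ x v)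

namespace IsLiouvilleCollar

variable {lam : OneForm W} {O : Set W} (h : IsLiouvilleCollar C f κ lam O)
include h

/-- On O the form is κ^* of the Liouville form, whose exterior derivative is ω₀; `dForm_pullback`
carries this to W. -/
lemma extDL_eq {x : W} (hx : x ∈ O) (v w : E3) :
    extDL lam x v w = omega0 (spaceD κ x v) (spaceD κ x w) := by
  have hxs : x ∈ (extChartAt (𝓡 3) x).source := mem_extChartAt_source x
  have hκ : ∀ x' ∈ O, ContMDiffAt (𝓡 3) 𝓘(ℝ, E4) ∞ κ x' := fun x' hx' ↦
    h.collar.contMDiffAt_inv (h.subset hx')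
  have hk := contDiffAt_comp_chart_symm hxs (hκ x hx)
  set k : E3 → E4 := κ ∘ (extChartAt (𝓡 3) x).symm with hkdef
  have hkd : fderiv ℝ k (extChartAt (𝓡 3) x x) = spaceD κ x := by
    have := spaceD_eq_fderiv hxs ((hκ x hx).mdifferentiableAt (by simp))
    rw [chartD_self] at this
    exact this.symm
  have hk2 : ContDiffAt ℝ 2 k (extChartAt (𝓡 3) x x) := hk.of_le (by norm_cast)
  rw [extDL_apply, extD_eq_dForm, dForm_pullback (Θ := k) (l := liouvilleL) hk2
    liouvilleL.differentiableAt, hkd, dForm_liouvilleL]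
  have hev : ∀ᶠ y in 𝓝 (extChartAt (𝓡 3) x x), y ∈ (extChartAt (𝓡 3) x).target ∧
      (extChartAt (𝓡 3) x).symm y ∈ O := by
    refine Eventually.and ((chart_target_open x).mem_nhds
      ((extChartAt (𝓡 3) x).map_source hxs)) ?_
    have hc := continuousAt_extChartAt_symm (I := 𝓡 3) x
    refine hc.eventually_mem ?_
    rw [(extChartAt (𝓡 3) x).left_inv hxs]
    exact h.isOpen.mem_nhds hx
  filter_upwards [hev] with y hy
  rw [hkdef, fderiv_comp_chart_symm hy.1 ((hκ _ hy.2).mdifferentiableAt (by simp)), chartForm_eq]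
  ext1 v
  simp only [ContinuousLinearMap.comp_apply, h.form _ hy.2, Function.comp_apply, liouvilleL_apply]

lemma reeb_eq {x : W} (hx : x ∈ O) {X : E3} (h1 : liouville (κ x) (spaceD κ x X) = 1)
    (h2 : ∀ v, omega0 (spaceD κ x X) (spaceD κ x v) = 0) : reeb lam x = X :=
  h.contact.reeb_unique ((h.form x hx X).trans h1) fun v ↦ (h.extDL_eq hx X v).trans (h2 v)

end IsLiouvilleCollar

end Collar

/-! ### The level sets of the normal form -/

section Level

/-- `-I₁`. -/
def actX (z : E4) : ℝ := -(z 0 * z 2)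

/-- `2 I₂`. -/
def actY (z : E4) : ℝ := z 1 ^ 2 + z 3 ^ 2

variable (α om : ℝ) (R : ℝ × ℝ → ℝ)

/-- The normal form of the Hamiltonian. -/
def normalForm (z : E4) : ℝ := actionEnergy α om R (actX z) (actY z)

/-- `α - ∂R/∂I₁` as a function on `ℝ⁴`. -/
def coefA (z : E4) : ℝ := abar α R (actX z) (actY z)

/-- `om + ∂R/∂I₂` as a function on `ℝ⁴`. -/
def coefB (z : E4) : ℝ := obar om R (actX z) (actY z)

/-- The value of the Liouville form on the Hamiltonian vector field. -/
def coefN (z : E4) : ℝ := coefA α R z * actX z + coefB om R z * (actY z / 2)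

/-- The level sets of the normal form in the ball of radius `δ`. -/
def levelSet (E δ : ℝ) : Set E4 := {z | z ∈ Metric.ball (0 : E4) δ ∧ normalForm α om R z = E}

/-- The Reeb vector field of the Liouville form on the level sets of the normal form. -/
def reebModel (z : E4) : E4 :=
  !₂[-(coefA α R z / coefN α om R z * z 0), coefB om R z / coefN α om R z * z 3,
    coefA α R z / coefN α om R z * z 2, -(coefB om R z / coefN α om R z * z 1)]

/-- The flow of `reebModel`. -/
def flowModel (t : ℝ) (z : E4) : E4 :=
  !₂[z 0 * Real.exp (-(coefA α R z / coefN α om R z * t)),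
    z 1 * Real.cos (coefB om R z / coefN α om R z * t) +
      z 3 * Real.sin (coefB om R z / coefN α om R z * t),
    z 2 * Real.exp (coefA α R z / coefN α om R z * t),
    -(z 1 * Real.sin (coefB om R z / coefN α om R z * t)) +
      z 3 * Real.cos (coefB om R z / coefN α om R z * t)]

variable {α om R}

lemma norm_sq_E4 (z : E4) : ‖z‖ ^ 2 = z 0 ^ 2 + z 1 ^ 2 + z 2 ^ 2 + z 3 ^ 2 := by
  rw [EuclideanSpace.real_norm_sq_eq, Fin.sum_univ_four]

lemma mem_ball_E4 {δ : ℝ} (hδ : 0 < δ) (z : E4) :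
    z ∈ Metric.ball (0 : E4) δ ↔ z 0 ^ 2 + z 1 ^ 2 + z 2 ^ 2 + z 3 ^ 2 < δ ^ 2 := by
  rw [mem_ball_zero_iff, ← norm_sq_E4, sq_lt_sq₀ (norm_nonneg z) hδ.le]

lemma hasDerivAt_E4 {c : ℝ → E4} {c' : E4} {t : ℝ}
    (h : ∀ i, HasDerivAt (fun s ↦ c s i) (c' i) t) : HasDerivAt c c' t := by
  have h1 : HasDerivAt (fun s ↦ WithLp.ofLp (c s)) (WithLp.ofLp c') t := hasDerivAt_pi.2 h
  exact (PiLp.continuousLinearEquiv 2 ℝ (fun _ : Fin 4 ↦ ℝ)).symm.hasFDerivAt.comp_hasDerivAt t h1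

lemma contDiffAt_coord {n : ℕ∞ω} (i : Fin 4) (z : E4) : ContDiffAt ℝ n (fun z : E4 ↦ z i) z :=
  (coordL i).contDiff.contDiffAt

lemma contDiffAt_actX {n : ℕ∞ω} (z : E4) : ContDiffAt ℝ n actX z :=
  ((contDiffAt_coord 0 z).mul (contDiffAt_coord 2 z)).neg

lemma contDiffAt_actY {n : ℕ∞ω} (z : E4) : ContDiffAt ℝ n actY z :=
  ((contDiffAt_coord 1 z).pow 2).add ((contDiffAt_coord 3 z).pow 2)

lemma hasFDerivAt_actX (z : E4) :
    HasFDerivAt actX (-(z 0 • coordL 2 + z 2 • coordL 0)) z :=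
  ((coordL 0).hasFDerivAt.mul (coordL 2).hasFDerivAt).neg

lemma hasFDerivAt_actY (z : E4) :
    HasFDerivAt actY ((2 * z 1) • coordL 1 + (2 * z 3) • coordL 3) z := by
  have h := ((coordL 1).hasFDerivAt (x := z).pow 2).add ((coordL 3).hasFDerivAt (x := z).pow 2)
  refine h.congr_fderiv ?_
  simp

/-- The radius of the ball is small compared to the box. -/
structure IsGoodBall (α om : ℝ) (R : ℝ × ℝ → ℝ) (b δ : ℝ) : Prop where
  box : IsGoodBox α om R b
  δ_pos : 0 < δ
  δ_sq : δ ^ 2 ≤ b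

namespace IsGoodBall

variable {b δ E : ℝ} (h : IsGoodBall α om R b δ)
include h

lemma actX_lt {z : E4} (hz : z ∈ Metric.ball (0 : E4) δ) : |actX z| < b := by
  rw [mem_ball_E4 h.δ_pos] at hz
  refine lt_of_lt_of_le ?_ h.δ_sq
  rw [actX, abs_neg, abs_mul]
  nlinarith [sq_abs (z 0), sq_abs (z 2), sq_nonneg (|z 0| - |z 2|), sq_nonneg (z 1),
    sq_nonneg (z 3), sq_nonneg (z 0), sq_nonneg (z 2)]

lemma actY_lt {z : E4} (hz : z ∈ Metric.ball (0 : E4) δ) : |actY z| < b := by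
  rw [mem_ball_E4 h.δ_pos] at hz
  refine lt_of_lt_of_le ?_ h.δ_sq
  rw [actY, abs_of_nonneg (by positivity)]
  nlinarith [sq_nonneg (z 0), sq_nonneg (z 2)]

lemma coefA_pos {z : E4} (hz : z ∈ Metric.ball (0 : E4) δ) : 0 < coefA α R z :=
  h.box.abar_pos (h.actX_lt hz) (h.actY_lt hz)

lemma coefB_pos {z : E4} (hz : z ∈ Metric.ball (0 : E4) δ) : 0 < coefB om R z :=
  h.box.obar_pos (h.actX_lt hz) (h.actY_lt hz)

lemma contDiffAt_coefA {z : E4} (hz : z ∈ Metric.ball (0 : E4) δ) :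
    ContDiffAt ℝ ∞ (coefA α R) z :=
  (h.box.contDiffAt_abar (h.actX_lt hz) (h.actY_lt hz)).comp
    (f := fun z : E4 ↦ (actX z, actY z)) z ((contDiffAt_actX z).prodMk (contDiffAt_actY z))

lemma contDiffAt_coefB {z : E4} (hz : z ∈ Metric.ball (0 : E4) δ) :
    ContDiffAt ℝ ∞ (coefB om R) z :=
  (h.box.contDiffAt_obar (h.actX_lt hz) (h.actY_lt hz)).comp
    (f := fun z : E4 ↦ (actX z, actY z)) z ((contDiffAt_actX z).prodMk (contDiffAt_actY z))

lemma contDiffAt_coefN {z : E4} (hz : z ∈ Metric.ball (0 : E4) δ) :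
    ContDiffAt ℝ ∞ (coefN α om R) z :=
  ((h.contDiffAt_coefA hz).mul (contDiffAt_actX z)).add
    ((h.contDiffAt_coefB hz).mul ((contDiffAt_actY z).div_const 2))

/-- The derivative of the normal form, evaluated on a vector. -/
lemma fderiv_normalForm {z : E4} (hz : z ∈ Metric.ball (0 : E4) δ) :
    ∃ D : E4 →L[ℝ] ℝ, HasFDerivAt (normalForm α om R) D z ∧ ∀ v, D v =
      -(coefA α R z * (z 0 * v 2 + z 2 * v 0)) + coefB om R z * (z 1 * v 1 + z 3 * v 3) := by
  have h1 := (h.box.hasFDerivAt_actionEnergy (h.actX_lt hz) (h.actY_lt hz)).comp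
    (f := fun z : E4 ↦ (actX z, actY z)) z ((hasFDerivAt_actX z).prodMk (hasFDerivAt_actY z))
  refine ⟨_, h1, fun v ↦ ?_⟩
  simp [coefA, coefB]
  ring

omit h in
lemma reebModel_liouville {z : E4} (hN : coefN α om R z ≠ 0) :
    liouville z (reebModel α om R z) = 1 := by
  have h1 : liouville z (reebModel α om R z) = coefN α om R z / coefN α om R z := by
    set N := coefN α om R z with hN'
    have h2 : N = coefA α R z * -(z 0 * z 2) + coefB om R z * ((z 1 ^ 2 + z 3 ^ 2) / 2) := rfl
    rw [eq_div_iff hN]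
    conv_rhs => rw [h2]
    simp only [liouville, reebModel, ← hN']
    simp
    field_simp
    ring
  rw [h1, div_self hN]

-- The contraction of ω₀ with the Hamiltonian field is -dK, which vanishes on vectors tangent to the
-- level set; this is the second Reeb condition.
omit h in
lemma reebModel_omega0 (z v : E4) : omega0 (reebModel α om R z) v =
    -(1 / coefN α om R z) * (-(coefA α R z * (z 0 * v 2 + z 2 * v 0)) +
      coefB om R z * (z 1 * v 1 + z 3 * v 3)) := by
  simp only [omega0, reebModel]
  simp
  ring

omit h in
lemma actX_flowModel (t : ℝ) (z : E4) : actX (flowModel α om R t z) = actX z := by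
  simp only [actX, flowModel]
  simp
  rw [Real.exp_neg]
  field_simp

omit h in
lemma actY_flowModel (t : ℝ) (z : E4) : actY (flowModel α om R t z) = actY z := by
  simp only [actY, flowModel]
  simp
  set a := coefB om R z / coefN α om R z * t
  linear_combination (z 1 ^ 2 + z 3 ^ 2) * Real.sin_sq_add_cos_sq a

omit h in
lemma normalForm_flowModel (t : ℝ) (z : E4) :
    normalForm α om R (flowModel α om R t z) = normalForm α om R z := by
  simp only [normalForm, actX_flowModel, actY_flowModel]

omit h in
lemma flowModel_zero (z : E4) : flowModel α om R 0 z = z := by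
  ext i; fin_cases i <;> simp [flowModel]

-- The coefficients of `reebModel` are functions of the two actions and are constant along the flow,
-- so the equation is linear with constant coefficients on each orbit.
omit h in
lemma hasDerivAt_flowModel (t : ℝ) (z : E4) :
    HasDerivAt (fun t ↦ flowModel α om R t z) (reebModel α om R (flowModel α om R t z)) t := by
  have hA : coefA α R (flowModel α om R t z) = coefA α R z := by
    simp only [coefA, actX_flowModel, actY_flowModel]
  have hB : coefB om R (flowModel α om R t z) = coefB om R z := by
    simp only [coefB, actX_flowModel, actY_flowModel]
  have hN : coefN α om R (flowModel α om R t z) = coefN α om R z := by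
    simp only [coefN, hA, hB, actX_flowModel, actY_flowModel]
  have hlin : ∀ k : ℝ, HasDerivAt (fun t ↦ k * t) k t := fun k ↦ by
    simpa using (hasDerivAt_id t).const_mul k
  set a := coefA α R z / coefN α om R z with ha
  set β := coefB om R z / coefN α om R z with hβ
  refine hasDerivAt_E4 fun i ↦ ?_
  simp only [reebModel, hA, hB, hN, ← ha, ← hβ]
  fin_cases i
  · exact ((hlin a).neg.exp.const_mul (z 0)).congr_deriv (by simp [flowModel, ← ha]; ring)
  · exact (((hlin β).cos.const_mul (z 1)).add ((hlin β).sin.const_mul (z 3))).congr_deriv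
      (by simp [flowModel, ← hβ]; ring)
  · exact ((hlin a).exp.const_mul (z 2)).congr_deriv (by simp [flowModel, ← ha]; ring)
  · exact (((hlin β).sin.const_mul (z 1)).neg.add ((hlin β).cos.const_mul (z 3))).congr_deriv
      (by simp [flowModel, ← hβ]; ring)

lemma contDiffAt_flowModel {z : E4} (hz : z ∈ Metric.ball (0 : E4) δ)
    (hN : coefN α om R z ≠ 0) (t : ℝ) :
    ContDiffAt ℝ ∞ (fun p : E4 × ℝ ↦ flowModel α om R p.2 p.1) (z, t) := by
  have hc : ∀ i : Fin 4, ContDiffAt ℝ ∞ (fun p : E4 × ℝ ↦ p.1 i) (z, t) := fun i ↦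
    (contDiffAt_coord i z).comp (z, t) contDiffAt_fst
  have hA : ContDiffAt ℝ ∞ (fun p : E4 × ℝ ↦ coefA α R p.1 / coefN α om R p.1 * p.2) (z, t) :=
    (((h.contDiffAt_coefA hz).div (h.contDiffAt_coefN hz) hN).comp (z, t) contDiffAt_fst).mul
      contDiffAt_snd
  have hB : ContDiffAt ℝ ∞ (fun p : E4 × ℝ ↦ coefB om R p.1 / coefN α om R p.1 * p.2) (z, t) :=
    (((h.contDiffAt_coefB hz).div (h.contDiffAt_coefN hz) hN).comp (z, t) contDiffAt_fst).mul
      contDiffAt_snd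
  rw [contDiffAt_euclidean]
  intro i
  fin_cases i
  · exact (hc 0).mul hA.neg.exp
  · exact ((hc 1).mul hB.cos).add ((hc 3).mul hB.sin)
  · exact (hc 2).mul hA.exp
  · exact ((hc 1).mul hB.sin).neg.add ((hc 3).mul hB.cos)

end IsGoodBall

end Level

/-! ### The Reeb flow in the collar -/

section Reeb

variable {W : Type*} [TopologicalSpace W] [ChartedSpace E3 W] [IsManifold (𝓡 3) ∞ W]
  {α om : ℝ} {R : ℝ × ℝ → ℝ} {b δ E : ℝ} {f : E4 → W} {κ : W → E4} {lam : OneForm W} {O : Set W}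

/-- A Liouville collar modelled on a level set of the normal form, containing `{q₁ + p₁ = 0}`. -/
structure IsLevelCollar (α om : ℝ) (R : ℝ × ℝ → ℝ) (b δ E : ℝ) (f : E4 → W) (κ : W → E4)
    (lam : OneForm W) (O : Set W) : Prop where
  ball : IsGoodBall α om R b δ
  liou : IsLiouvilleCollar (levelSet α om R E δ) f κ lam O
  sphere_mem : ∀ z ∈ levelSet α om R E δ, z 0 + z 2 = 0 → f z ∈ O

namespace IsLevelCollar

variable (h : IsLevelCollar α om R b δ E f κ lam O)
include h

lemma kappa_mem {x : W} (hx : x ∈ O) : κ x ∈ levelSet α om R E δ ∧ f (κ x) = x := by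
  obtain ⟨z, hz, rfl⟩ := h.liou.subset hx
  rw [h.liou.collar.leftInv z hz]
  exact ⟨hz, rfl⟩

/-- Tangent vectors are annihilated by the derivative of the normal form. -/
lemma tangent {x : W} (hx : x ∈ O) (v : E3) :
    -(coefA α R (κ x) * (κ x 0 * spaceD κ x v 2 + κ x 2 * spaceD κ x v 0)) +
      coefB om R (κ x) * (κ x 1 * spaceD κ x v 1 + κ x 3 * spaceD κ x v 3) = 0 := by
  obtain ⟨D, hD, hDv⟩ := h.ball.fderiv_normalForm (h.kappa_mem hx).1.1
  have hκ := ((h.liou.collar.contMDiffAt_inv (h.liou.subset hx)).mdifferentiableAt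
    (by simp)).hasMFDerivAt
  have h1 := HasMFDerivAt.comp x hD.hasMFDerivAt hκ
  have h2 : HasMFDerivAt (𝓡 3) 𝓘(ℝ, ℝ) (fun _ : W ↦ E) x _ := h1.congr_of_eventuallyEq (by
    filter_upwards [h.liou.isOpen.mem_nhds hx] with x' hx'
    exact (h.kappa_mem hx').1.2.symm)
  have h3 := hasMFDerivAt_unique h2 (hasMFDerivAt_const E x)
  rw [← hDv]
  exact DFunLike.congr_fun h3 v

lemma reeb_eq {x : W} (hx : x ∈ O) (hN : coefN α om R (κ x) ≠ 0) {X : E3}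
    (hX : spaceD κ x X = reebModel α om R (κ x)) : reeb lam x = X := by
  refine h.liou.reeb_eq hx ?_ fun v ↦ ?_
  · rw [hX, IsGoodBall.reebModel_liouville hN]
  · rw [hX, IsGoodBall.reebModel_omega0, h.tangent hx, mul_zero]

lemma hasMFDerivAt_of_model {c : ℝ → E4} {t : ℝ} (hc : ContDiffAt ℝ ∞ c t)
    (hC : ∀ᶠ s in 𝓝 t, c s ∈ levelSet α om R E δ) (hO : f (c t) ∈ O)
    (hN : coefN α om R (c t) ≠ 0) (hd : HasDerivAt c (reebModel α om R (c t)) t) :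
    HasMFDerivAt 𝓘(ℝ, ℝ) (𝓡 3) (f ∘ c) t
      ((1 : ℝ →L[ℝ] ℝ).smulRight (reeb lam ((f ∘ c) t))) := by
  have hs := h.liou.collar.contMDiffAt_comp hc.contMDiffAt hC
  have h1 := (hs.mdifferentiableAt (by simp)).hasMFDerivAt
  have hκ : κ (f (c t)) = c t := h.liou.collar.leftInv _ hC.self_of_nhds
  have h2 := h.liou.collar.spaceD_mfderiv_comp hc.contMDiffAt hC (1 : ℝ)
  have h3 : spaceD κ (f (c t)) (mfderiv 𝓘(ℝ, ℝ) (𝓡 3) (f ∘ c) t (1 : ℝ)) =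
      reebModel α om R (c t) := by
    refine h2.trans ?_
    have h4 : mfderiv 𝓘(ℝ, ℝ) 𝓘(ℝ, E4) c t = fderiv ℝ c t := mfderiv_eq_fderiv
    have h5 : fderiv ℝ c t (1 : ℝ) = reebModel α om R (c t) := by
      rw [hd.hasFDerivAt.fderiv]; simp
    exact (DFunLike.congr_fun h4 (1 : ℝ)).trans h5
  have h6 : reeb lam (f (c t)) = mfderiv 𝓘(ℝ, ℝ) (𝓡 3) (f ∘ c) t (1 : ℝ) :=
    h.reeb_eq hO (by rwa [hκ]) (by rw [hκ]; exact h3)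
  have h7 : mfderiv 𝓘(ℝ, ℝ) (𝓡 3) (f ∘ c) t =
      (1 : ℝ →L[ℝ] ℝ).smulRight (reeb lam ((f ∘ c) t)) := by
    ext1
    exact h6.symm.trans (one_smul ℝ _).symm
  rw [← h7]
  exact h1

end IsLevelCollar

end Reeb

/-! ### The equatorial orbit -/

section Equator

variable {W : Type*} [TopologicalSpace W] [ChartedSpace E3 W] [IsManifold (𝓡 3) ∞ W]
  {α om : ℝ} {R : ℝ × ℝ → ℝ} {b δ E r : ℝ} {f : E4 → W} {κ : W → E4} {lam : OneForm W} {O : Set W}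

/-- The starting point of the equatorial orbit. -/
def equatorPoint (r : ℝ) : E4 := !₂[0, r, 0, 0]

lemma actX_equatorPoint_add (r s x y : ℝ) :
    actX (equatorPoint r + s • !₂[x, 0, y, 0]) = -(s ^ 2 * (x * y)) := by
  simp [actX, equatorPoint]; ring

lemma actY_equatorPoint_add (r s x y : ℝ) :
    actY (equatorPoint r + s • !₂[x, 0, y, 0]) = r ^ 2 := by
  simp [actY, equatorPoint]

lemma coefN_equatorPoint (r : ℝ) :
    coefN α om R (equatorPoint r) = coefB om R (equatorPoint r) * (r ^ 2 / 2) := by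
  simp [coefN, actX, actY, equatorPoint]

/-- An even function has vanishing derivative at `0`. -/
lemma hasDerivAt_zero_of_even {g : ℝ → ℝ} (hg : DifferentiableAt ℝ g 0)
    (he : ∀ s, g (-s) = g s) : HasDerivAt g 0 0 := by
  have h1 := hg.hasDerivAt
  have h2 : HasDerivAt (fun s ↦ g (-s)) (deriv g 0 * -1) 0 :=
    HasDerivAt.comp (h := fun s : ℝ ↦ -s) 0 (by simpa using h1) (hasDerivAt_neg 0)
  rw [show (fun s ↦ g (-s)) = g from funext he] at h2
  have h3 := h1.unique h2
  have h4 : deriv g 0 = 0 := by linarith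
  rwa [h4] at h1

lemma hasDerivAt_id_mul {g : ℝ → ℝ} (hg : DifferentiableAt ℝ g 0) (x : ℝ) :
    HasDerivAt (fun s ↦ s * x * g s) (x * g 0) 0 := by
  have h1 : HasDerivAt (fun s : ℝ ↦ s * x) x 0 := by simpa using (hasDerivAt_id (0 : ℝ)).mul_const x
  exact (h1.mul hg.hasDerivAt).congr_deriv (by simp)

omit [IsManifold (𝓡 3) ∞ W] in
lemma IsHyperbolicOrbit.of_eq {w : ℝ → W} {T : ℝ} {x : W} (hx : x = w 0)
    (h : ∃ F : W → W,
      (∀ᶠ y in 𝓝 x, ∃ γ : ℝ → W, γ 0 = y ∧ γ T = F y ∧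
        IsMIntegralCurveOn (I := 𝓡 3) γ (reeb lam) (Icc 0 T)) ∧
      MDifferentiableAt (𝓡 3) (𝓡 3) F x ∧
      ∃ A : contactPlane lam x →ₗ[ℝ] contactPlane lam x,
        (∀ v, (A v : E3) = mfderiv (𝓡 3) (𝓡 3) F x (v : E3)) ∧
        ∀ μ : ℂ, (A.charpoly.map (algebraMap ℝ ℂ)).IsRoot μ → ‖μ‖ ≠ 1) :
    IsHyperbolicOrbit lam w T := by
  subst hx
  exact h

namespace IsLevelCollar

variable (h : IsLevelCollar α om R b δ E f κ lam O) (hr : 0 < r)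
  (hC : ∀ z : E4, z 0 = 0 → z 2 = 0 → actY z = r ^ 2 → z ∈ levelSet α om R E δ)

include h hr hC

set_option linter.unusedSectionVars false in
lemma equatorPoint_mem : equatorPoint r ∈ levelSet α om R E δ :=
  hC _ (by simp [equatorPoint]) (by simp [equatorPoint]) (by simp [equatorPoint, actY])

lemma coefB_equatorPoint_pos : 0 < coefB om R (equatorPoint r) :=
  h.ball.coefB_pos (h.equatorPoint_mem hr hC).1

lemma coefN_equatorPoint_pos : 0 < coefN α om R (equatorPoint r) := by
  rw [coefN_equatorPoint]
  have := h.coefB_equatorPoint_pos hr hC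
  positivity

/-- On the equator I₁ = 0, so N = B r²/2 and the angular speed B/N equals 2/r², independently of R.
-/
lemma flowModel_equatorPoint (t : ℝ) : flowModel α om R t (equatorPoint r) =
    !₂[0, r * Real.cos (2 * Real.pi * (t / (Real.pi * r ^ 2))), 0,
      -(r * Real.sin (2 * Real.pi * (t / (Real.pi * r ^ 2))))] := by
  have hB := h.coefB_equatorPoint_pos hr hC
  have h1 : coefB om R (equatorPoint r) / coefN α om R (equatorPoint r) * t =
      2 * Real.pi * (t / (Real.pi * r ^ 2)) := by
    rw [coefN_equatorPoint]
    have := Real.pi_pos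
    field_simp
  simp only [flowModel, h1]
  ext i; fin_cases i <;> simp [equatorPoint]

lemma flowModel_equatorPoint_mem (t : ℝ) :
    flowModel α om R t (equatorPoint r) ∈ levelSet α om R E δ ∧
      f (flowModel α om R t (equatorPoint r)) ∈ O := by
  have h0 := h.flowModel_equatorPoint hr hC t
  have h1 : flowModel α om R t (equatorPoint r) ∈ levelSet α om R E δ := by
    refine hC _ (by simp [h0]) (by simp [h0]) ?_
    rw [IsGoodBall.actY_flowModel]
    simp [equatorPoint, actY]
  exact ⟨h1, h.sphere_mem _ h1 (by simp [h0])⟩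

lemma flowModel_period : flowModel α om R (Real.pi * r ^ 2) (equatorPoint r) = equatorPoint r := by
  have := Real.pi_pos
  rw [h.flowModel_equatorPoint hr hC, div_self (by positivity)]
  simp [equatorPoint]

lemma isPeriodicOrbit : IsPeriodicOrbit lam (fun t ↦ f !₂[0,
    r * Real.cos (2 * Real.pi * (t / (Real.pi * r ^ 2))), 0,
      -(r * Real.sin (2 * Real.pi * (t / (Real.pi * r ^ 2))))]) (Real.pi * r ^ 2) := by
  have hpi := Real.pi_pos
  refine ⟨?_, by positivity, fun t ↦ ?_⟩
  · have h0 : (fun t : ℝ ↦ f !₂[0,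
        r * Real.cos (2 * Real.pi * (t / (Real.pi * r ^ 2))), 0,
        -(r * Real.sin (2 * Real.pi * (t / (Real.pi * r ^ 2))))]) =
        f ∘ fun t ↦ flowModel α om R t (equatorPoint r) := by
      funext t
      rw [Function.comp_apply, h.flowModel_equatorPoint hr hC]
    rw [h0]
    intro t
    have hN : coefN α om R (flowModel α om R t (equatorPoint r)) ≠ 0 := by
      have : coefN α om R (flowModel α om R t (equatorPoint r)) =
          coefN α om R (equatorPoint r) := by
        simp only [coefN, coefA, coefB, IsGoodBall.actX_flowModel, IsGoodBall.actY_flowModel]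
      rw [this]
      exact (h.coefN_equatorPoint_pos hr hC).ne'
    refine h.hasMFDerivAt_of_model ?_ (Eventually.of_forall fun s ↦
      (h.flowModel_equatorPoint_mem hr hC s).1) (h.flowModel_equatorPoint_mem hr hC t).2 hN
      (IsGoodBall.hasDerivAt_flowModel t _)
    exact (h.ball.contDiffAt_flowModel (h.equatorPoint_mem hr hC).1
      (h.coefN_equatorPoint_pos hr hC).ne' t).comp (f := fun t : ℝ ↦ (equatorPoint r, t)) t
      (contDiffAt_const.prodMk contDiffAt_id)
  · have h1 : 2 * Real.pi * ((t + Real.pi * r ^ 2) / (Real.pi * r ^ 2)) =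
        2 * Real.pi * (t / (Real.pi * r ^ 2)) + 2 * Real.pi := by field_simp
    simp only [h1, Real.cos_add_two_pi, Real.sin_add_two_pi]

/-- Along `equatorPoint r + s • !₂[x, 0, y, 0]` the action I₂ is constant and I₁ is quadratic in s,
so all coefficients of the flow are even in s. Hence the (q₂, p₂)-components have zero derivative at
s = 0, while q₁ and p₁ are only rescaled, with c = (A/N)·πr². -/
lemma fderiv_flowModel_period :
    ∃ D : E4 →L[ℝ] E4, HasFDerivAt (flowModel α om R (Real.pi * r ^ 2)) D (equatorPoint r) ∧
      ∃ c > 0, ∀ x y : ℝ, D !₂[x, 0, y, 0] = !₂[x * Real.exp (-c), 0, y * Real.exp c, 0] := by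
  have hpi := Real.pi_pos
  set T := Real.pi * r ^ 2 with hT
  have hp := (h.equatorPoint_mem hr hC).1
  have hN := (h.coefN_equatorPoint_pos hr hC)
  have hd : DifferentiableAt ℝ (flowModel α om R T) (equatorPoint r) :=
    ((h.ball.contDiffAt_flowModel hp hN.ne' T).comp (f := fun z : E4 ↦ (z, T)) (equatorPoint r)
      (contDiffAt_id.prodMk contDiffAt_const)).differentiableAt (by simp)
  refine ⟨_, hd.hasFDerivAt, coefA α R (equatorPoint r) / coefN α om R (equatorPoint r) * T, ?_,
    fun x y ↦ ?_⟩
  · have := h.ball.coefA_pos hp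
    positivity
  set v : E4 := !₂[x, 0, y, 0] with hv
  have hline : HasDerivAt (fun s : ℝ ↦ equatorPoint r + s • v) v 0 := by
    simpa using ((hasDerivAt_id (0 : ℝ)).smul_const v).const_add (equatorPoint r)
  have hz : equatorPoint r + (0 : ℝ) • v = equatorPoint r := by simp
  have h1 : HasDerivAt (fun s : ℝ ↦ flowModel α om R T (equatorPoint r + s • v))
      (fderiv ℝ (flowModel α om R T) (equatorPoint r) v) 0 := by
    have h2 : HasFDerivAt (flowModel α om R T) (fderiv ℝ (flowModel α om R T) (equatorPoint r))
        (equatorPoint r + (0 : ℝ) • v) := by rw [hz]; exact hd.hasFDerivAt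
    exact h2.comp_hasDerivAt 0 hline
  have hq : DifferentiableAt ℝ (fun s : ℝ ↦ coefA α R (equatorPoint r + s • v) /
      coefN α om R (equatorPoint r + s • v) * T) 0 := by
    have h2 : DifferentiableAt ℝ (fun z ↦ coefA α R z / coefN α om R z * T)
        (equatorPoint r + (0 : ℝ) • v) := by
      rw [hz]
      exact ((((h.ball.contDiffAt_coefA hp).div (h.ball.contDiffAt_coefN hp) hN.ne').mul
        contDiffAt_const).differentiableAt (by simp))
    exact h2.comp (f := fun s : ℝ ↦ equatorPoint r + s • v) 0 hline.differentiableAt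
  have hcoord : ∀ i, DifferentiableAt ℝ
      (fun s : ℝ ↦ flowModel α om R T (equatorPoint r + s • v) i) 0 := fun i ↦
    ((coordL i).differentiableAt).comp (f := fun s : ℝ ↦
      flowModel α om R T (equatorPoint r + s • v)) 0 h1.differentiableAt
  have hneg : ∀ s : ℝ, coefB om R (equatorPoint r + -s • v) / coefN α om R (equatorPoint r + -s • v)
      = coefB om R (equatorPoint r + s • v) / coefN α om R (equatorPoint r + s • v) := fun s ↦ by
    simp only [coefN, coefA, coefB, hv, actX_equatorPoint_add, actY_equatorPoint_add, neg_sq]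
  refine h1.unique (hasDerivAt_E4 fun i ↦ ?_)
  fin_cases i
  · refine ((hasDerivAt_id_mul hq.neg.exp x).congr_deriv ?_).congr_of_eventuallyEq
      (Eventually.of_forall fun s ↦ ?_)
    · simp
    · simp [flowModel, equatorPoint, hv]
  · refine hasDerivAt_zero_of_even (hcoord 1) fun s ↦ ?_
    simp only [flowModel, hneg]
    simp [equatorPoint, hv]
  · refine ((hasDerivAt_id_mul hq.exp y).congr_deriv ?_).congr_of_eventuallyEq
      (Eventually.of_forall fun s ↦ ?_)
    · simp
    · simp [flowModel, equatorPoint, hv]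
  · refine hasDerivAt_zero_of_even (hcoord 3) fun s ↦ ?_
    simp only [flowModel, hneg]
    simp [equatorPoint, hv]

/-- `flowModel` is jointly continuous and keeps the equator inside the open set O; compactness of
[0, T] gives the same for nearby starting points, whose model trajectories are then Reeb
trajectories. -/
lemma eventually_integralCurve (T : ℝ) : ∀ᶠ y in 𝓝 (f (equatorPoint r)),
    ∃ γ : ℝ → W, γ 0 = y ∧ γ T = (f ∘ flowModel α om R T ∘ κ) y ∧
      IsMIntegralCurveOn (I := 𝓡 3) γ (reeb lam) (Icc 0 T) := by
  have hp := h.equatorPoint_mem hr hC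
  have hN := h.coefN_equatorPoint_pos hr hC
  have hpO : f (equatorPoint r) ∈ O := h.sphere_mem _ hp (by simp [equatorPoint])
  have hκp : κ (f (equatorPoint r)) = equatorPoint r := h.liou.collar.leftInv _ hp
  have hκc : ContinuousAt κ (f (equatorPoint r)) :=
    (h.liou.collar.contMDiffAt_inv (h.liou.subset hpO)).continuousAt
  have hO : ∀ᶠ y in 𝓝 (f (equatorPoint r)), y ∈ O := h.liou.isOpen.mem_nhds hpO
  have hNe : ∀ᶠ y in 𝓝 (f (equatorPoint r)), coefN α om R (κ y) ≠ 0 := by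
    have h1 : ContinuousAt (coefN α om R) (κ (f (equatorPoint r))) := by
      rw [hκp]; exact (h.ball.contDiffAt_coefN hp.1).continuousAt
    refine (h1.comp hκc).eventually_ne ?_
    simp only [Function.comp_apply, hκp]
    exact hN.ne'
  have hcont : ∀ t, ContinuousAt (fun q : W × ℝ ↦ flowModel α om R q.2 (κ q.1))
      (f (equatorPoint r), t) := fun t ↦ by
    have h1 : ContinuousAt (fun p : E4 × ℝ ↦ flowModel α om R p.2 p.1)
        (κ (f (equatorPoint r)), t) := by
      rw [hκp]; exact (h.ball.contDiffAt_flowModel hp.1 hN.ne' t).continuousAt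
    have h2 : ContinuousAt (fun q : W × ℝ ↦ κ q.1) (f (equatorPoint r), t) :=
      ContinuousAt.comp (f := fun q : W × ℝ ↦ q.1) hκc continuousAt_fst
    exact h1.comp (f := fun q : W × ℝ ↦ (κ q.1, q.2)) (h2.prodMk continuousAt_snd)
  have hlevel : ∀ t, ∀ᶠ q : W × ℝ in 𝓝 (f (equatorPoint r), t),
      flowModel α om R q.2 (κ q.1) ∈ levelSet α om R E δ := fun t ↦ by
    have h1 : ∀ᶠ q : W × ℝ in 𝓝 (f (equatorPoint r), t), q.1 ∈ O :=
      continuousAt_fst.eventually_mem (h.liou.isOpen.mem_nhds hpO)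
    have h2 : ∀ᶠ q : W × ℝ in 𝓝 (f (equatorPoint r), t),
        flowModel α om R q.2 (κ q.1) ∈ Metric.ball (0 : E4) δ := by
      refine (hcont t).eventually_mem (Metric.isOpen_ball.mem_nhds ?_)
      simp only [hκp]
      exact (h.flowModel_equatorPoint_mem hr hC t).1.1
    filter_upwards [h1, h2] with q h3 h4
    refine ⟨h4, ?_⟩
    rw [IsGoodBall.normalForm_flowModel]
    exact (h.kappa_mem h3).1.2
  have hfO : ∀ t, ∀ᶠ q : W × ℝ in 𝓝 (f (equatorPoint r), t),
      f (flowModel α om R q.2 (κ q.1)) ∈ O := fun t ↦ by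
    have hm := h.flowModel_equatorPoint_mem hr hC t
    have h1 : Tendsto (fun q : W × ℝ ↦ flowModel α om R q.2 (κ q.1))
        (𝓝 (f (equatorPoint r), t))
        (𝓝[levelSet α om R E δ] (flowModel α om R t (equatorPoint r))) := by
      refine tendsto_nhdsWithin_iff.2 ⟨?_, hlevel t⟩
      have := (hcont t).tendsto
      simpa only [hκp] using this
    exact ((h.liou.collar.continuousOn _ hm.1).tendsto.comp h1).eventually
      (h.liou.isOpen.mem_nhds hm.2)
  have hall : ∀ᶠ y in 𝓝 (f (equatorPoint r)), ∀ t ∈ Icc 0 T, ∀ᶠ s in 𝓝 t,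
      flowModel α om R s (κ y) ∈ levelSet α om R E δ ∧ f (flowModel α om R s (κ y)) ∈ O := by
    refine isCompact_Icc.eventually_forall_of_forall_eventually fun t _ ↦ ?_
    have h1 := ((hlevel t).and (hfO t)).eventually_nhds
    filter_upwards [h1] with q hq
    have h2 : Tendsto (fun s : ℝ ↦ (q.1, s)) (𝓝 q.2) (𝓝 q) :=
      (Continuous.prodMk_right q.1).continuousAt
    exact h2.eventually hq
  filter_upwards [hO, hNe, hall] with y hyO hyN hy
  refine ⟨f ∘ fun t ↦ flowModel α om R t (κ y), ?_, rfl, fun t ht ↦ ?_⟩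
  · simp only [Function.comp_apply, IsGoodBall.flowModel_zero]
    exact (h.kappa_mem hyO).2
  · have hN' : coefN α om R (flowModel α om R t (κ y)) ≠ 0 := by
      have : coefN α om R (flowModel α om R t (κ y)) = coefN α om R (κ y) := by
        simp only [coefN, coefA, coefB, IsGoodBall.actX_flowModel, IsGoodBall.actY_flowModel]
      rwa [this]
    refine (h.hasMFDerivAt_of_model ?_ ((hy t ht).mono fun s hs ↦ hs.1) (hy t ht).self_of_nhds.2
      hN' (IsGoodBall.hasDerivAt_flowModel t _)).hasMFDerivWithinAt
    exact (h.ball.contDiffAt_flowModel (h.kappa_mem hyO).1.1 hyN t).comp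
      (f := fun t : ℝ ↦ (κ y, t)) t (contDiffAt_const.prodMk contDiffAt_id)

/-- At (0, r, 0, 0) tangency to the level set gives v₁ = 0, and the Liouville form is -r v₃ / 2 on
such vectors. -/
lemma mem_contactPlane_equator {v : E3} :
    v ∈ contactPlane lam (f (equatorPoint r)) ↔
      spaceD κ (f (equatorPoint r)) v 1 = 0 ∧ spaceD κ (f (equatorPoint r)) v 3 = 0 := by
  have hp := h.equatorPoint_mem hr hC
  have hpO : f (equatorPoint r) ∈ O := h.sphere_mem _ hp (by simp [equatorPoint])
  have hκp : κ (f (equatorPoint r)) = equatorPoint r := h.liou.collar.leftInv _ hp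
  have h1 := h.tangent hpO v
  have h2 := h.liou.form _ hpO v
  rw [hκp] at h1 h2
  have hB := h.coefB_equatorPoint_pos hr hC
  have h3 : coefB om R (equatorPoint r) * (r * spaceD κ (f (equatorPoint r)) v 1) = 0 := by
    simpa [equatorPoint] using h1
  have h4 : spaceD κ (f (equatorPoint r)) v 1 = 0 := by
    simpa [hB.ne', hr.ne'] using h3
  have h5 : formAt lam (f (equatorPoint r)) v = -(r * spaceD κ (f (equatorPoint r)) v 3) / 2 := by
    rw [h2, liouville]; simp [equatorPoint]
  have h6 : v ∈ contactPlane lam (f (equatorPoint r)) ↔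
      formAt lam (f (equatorPoint r)) v = 0 := Iff.rfl
  rw [h6, h5]
  simp [h4, hr.ne']

lemma finrank_contactPlane_equator :
    Module.finrank ℝ (contactPlane lam (f (equatorPoint r))) = 2 := by
  set x := f (equatorPoint r)
  have h1 : formAt lam x (reeb lam x) = 1 := by
    have hp := h.equatorPoint_mem hr hC
    rw [h.liou.contact.reeb_eq]
    exact (h.liou.contact.isContactPair x).reebVec_spec.1
  have h2 : LinearMap.range (formAt lam x : E3 →ₗ[ℝ] ℝ) = ⊤ := by
    refine LinearMap.range_eq_top.2 fun c ↦ ⟨c • (reeb lam x : E3), ?_⟩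
    have : formAt lam x (c • (reeb lam x : E3)) = c • formAt lam x (reeb lam x) :=
      map_smul _ _ _
    exact this.trans (by rw [h1]; simp)
  have h3 := LinearMap.finrank_range_add_finrank_ker (formAt lam x : E3 →ₗ[ℝ] ℝ)
  rw [h2, finrank_top, Module.finrank_self, finrank_euclideanSpace_fin] at h3
  have h4 : contactPlane lam x = LinearMap.ker (formAt lam x : E3 →ₗ[ℝ] ℝ) := rfl
  rw [h4]
  omega

/-- The coordinates q₁, p₁ identify the contact plane with ℝ², and there the return map is
diag(e^{-c}, e^c) with c > 0. Its characteristic polynomial has exactly these two real roots. -/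
lemma isHyperbolicOrbit_model : IsHyperbolicOrbit lam (f ∘ fun t ↦ flowModel α om R t
    (equatorPoint r)) (Real.pi * r ^ 2) := by
  have hp := h.equatorPoint_mem hr hC
  have hpO : f (equatorPoint r) ∈ O := h.sphere_mem _ hp (by simp [equatorPoint])
  have hκp : κ (f (equatorPoint r)) = equatorPoint r := h.liou.collar.leftInv _ hp
  have hT : 0 < Real.pi * r ^ 2 := by have := Real.pi_pos; positivity
  obtain ⟨D, hD, c, hc, hDv⟩ := h.fderiv_flowModel_period hr hC
  have hper := h.flowModel_period hr hC
  set T := Real.pi * r ^ 2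
  have hw0 : (f ∘ fun t ↦ flowModel α om R t (equatorPoint r)) 0 = f (equatorPoint r) := by
    simp [IsGoodBall.flowModel_zero]
  refine IsHyperbolicOrbit.of_eq hw0.symm ?_
  set x := f (equatorPoint r) with hx
  have hκs := h.liou.collar.contMDiffAt_inv (h.liou.subset hpO)
  have hG : ContMDiffAt (𝓡 3) 𝓘(ℝ, E4) ∞ (flowModel α om R T ∘ κ) x := by
    have h1 : ContDiffAt ℝ ∞ (flowModel α om R T) (κ x) := by
      rw [hκp]
      exact (h.ball.contDiffAt_flowModel hp.1 (h.coefN_equatorPoint_pos hr hC).ne' T).comp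
        (f := fun z : E4 ↦ (z, T)) (equatorPoint r) (contDiffAt_id.prodMk contDiffAt_const)
    exact h1.contMDiffAt.comp x hκs
  have hGp : (flowModel α om R T ∘ κ) x = equatorPoint r := by
    rw [Function.comp_apply, hκp, hper]
  have hGC : ∀ᶠ y in 𝓝 x, (flowModel α om R T ∘ κ) y ∈ levelSet α om R E δ := by
    have h1 : ∀ᶠ y in 𝓝 x, (flowModel α om R T ∘ κ) y ∈ Metric.ball (0 : E4) δ := by
      refine hG.continuousAt.eventually_mem (Metric.isOpen_ball.mem_nhds ?_)
      rw [hGp]; exact hp.1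
    filter_upwards [h1, h.liou.isOpen.mem_nhds hpO] with y h2 h3
    refine ⟨h2, ?_⟩
    rw [Function.comp_apply, IsGoodBall.normalForm_flowModel]
    exact (h.kappa_mem h3).1.2
  have hGd : mfderiv (𝓡 3) 𝓘(ℝ, E4) (flowModel α om R T ∘ κ) x = D.comp (spaceD κ x) := by
    have h1 : HasMFDerivAt 𝓘(ℝ, E4) 𝓘(ℝ, E4) (flowModel α om R T) (κ x) D := by
      rw [hκp]; exact hD.hasMFDerivAt
    exact (h1.comp x (hκs.mdifferentiableAt (by simp)).hasMFDerivAt).mfderiv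
  have hFx : (f ∘ (flowModel α om R T ∘ κ)) x = x := by
    rw [Function.comp_apply, hGp]
  refine ⟨f ∘ (flowModel α om R T ∘ κ), h.eventually_integralCurve hr hC T,
    (h.liou.collar.contMDiffAt_comp hG hGC).mdifferentiableAt (by simp), ?_⟩
  set F' : E3 →L[ℝ] E3 := mfderiv (𝓡 3) (𝓡 3) (f ∘ (flowModel α om R T ∘ κ)) x with hF'
  have hF'v : ∀ v : E3, spaceD κ x (F' v) = D (spaceD κ x v) := fun v ↦ by
    have h1 := h.liou.collar.spaceD_mfderiv_comp hG hGC v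
    rw [hGp] at h1
    exact h1.trans (DFunLike.congr_fun hGd v)
  have hplane : ∀ v ∈ contactPlane lam x, spaceD κ x (F' v) =
      !₂[spaceD κ x v 0 * Real.exp (-c), 0, spaceD κ x v 2 * Real.exp c, 0] := fun v hv ↦ by
    have h1 := (h.mem_contactPlane_equator hr hC).1 hv
    rw [hF'v, ← hDv]
    congr 1
    ext i; fin_cases i
    · rfl
    · exact h1.1
    · rfl
    · exact h1.2
  set A : contactPlane lam x →ₗ[ℝ] contactPlane lam x := (F' : E3 →ₗ[ℝ] E3).restrict
    (p := contactPlane lam x) (q := contactPlane lam x) fun v hv ↦ by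
      refine (h.mem_contactPlane_equator hr hC).2 ?_
      have h1 := hplane v hv
      exact ⟨(congrArg (fun z : E4 ↦ z 1) h1).trans (by simp),
        (congrArg (fun z : E4 ↦ z 3) h1).trans (by simp)⟩ with hA
  refine ⟨A, fun v ↦ rfl, ?_⟩
  set L : contactPlane lam x →ₗ[ℝ] (Fin 2 → ℝ) := (LinearMap.pi
    ![((coordL 0).comp (spaceD κ x) : E3 →ₗ[ℝ] ℝ), ((coordL 2).comp (spaceD κ x) : E3 →ₗ[ℝ] ℝ)]).comp
      (contactPlane lam x).subtype with hL
  have hL0 : ∀ v, L v 0 = spaceD κ x v 0 := fun v ↦ rfl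
  have hL1 : ∀ v, L v 1 = spaceD κ x v 2 := fun v ↦ rfl
  have hinj : Function.Injective L := by
    rw [← LinearMap.ker_eq_bot, LinearMap.ker_eq_bot']
    intro v hv
    have h1 := (h.mem_contactPlane_equator hr hC).1 v.2
    have h2 : spaceD κ x (v : E3) = 0 := by
      ext i; fin_cases i
      · exact (hL0 v).symm.trans (congrFun hv 0)
      · exact h1.1
      · exact (hL1 v).symm.trans (congrFun hv 1)
      · exact h1.2
    exact Subtype.ext (h.liou.collar.spaceD_injective (h.liou.subset hpO)
      (h2.trans (map_zero _).symm))
  set e := LinearMap.linearEquivOfInjective L hinj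
    (by rw [h.finrank_contactPlane_equator hr hC]; simp) with he
  have hconj : e.conj A = Matrix.toLin' (Matrix.diagonal ![Real.exp (-c), Real.exp c]) := by
    refine LinearMap.ext fun y ↦ ?_
    obtain ⟨v, rfl⟩ := e.surjective y
    rw [LinearEquiv.conj_apply_apply, e.symm_apply_apply]
    have h1 := hplane v v.2
    change L (A v) = Matrix.toLin' _ (L v)
    funext i
    rw [Matrix.toLin'_apply, Matrix.mulVec_diagonal]
    fin_cases i
    · refine ((hL0 (A v)).trans ((congrArg (fun z : E4 ↦ z 0) h1).trans ?_))
      change spaceD κ x v 0 * Real.exp (-c) = Real.exp (-c) * L v 0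
      rw [hL0, mul_comm]
    · refine ((hL1 (A v)).trans ((congrArg (fun z : E4 ↦ z 2) h1).trans ?_))
      change spaceD κ x v 2 * Real.exp c = Real.exp c * L v 1
      rw [hL1, mul_comm]
  have hchar : A.charpoly = (Polynomial.X - Polynomial.C (Real.exp (-c))) *
      (Polynomial.X - Polynomial.C (Real.exp c)) := by
    rw [← LinearEquiv.charpoly_conj e A, hconj, Matrix.charpoly_toLin', Matrix.charpoly_diagonal,
      Fin.prod_univ_two]
    rfl
  intro μ hμ
  rw [hchar, Polynomial.IsRoot.def] at hμ
  simp only [Polynomial.map_mul, Polynomial.map_sub, Polynomial.map_X, Polynomial.map_C,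
    Polynomial.eval_mul, Polynomial.eval_sub, Polynomial.eval_X, Polynomial.eval_C, mul_eq_zero,
    sub_eq_zero, Complex.coe_algebraMap] at hμ
  rcases hμ with rfl | rfl
  · rw [Complex.norm_real, Real.norm_eq_abs, Real.abs_exp]
    rw [Ne, Real.exp_eq_one_iff]; linarith
  · rw [Complex.norm_real, Real.norm_eq_abs, Real.abs_exp]
    exact (Real.one_lt_exp_iff.2 hc).ne'

lemma isHyperbolicOrbit : IsHyperbolicOrbit lam (fun t ↦ f !₂[0,
    r * Real.cos (2 * Real.pi * (t / (Real.pi * r ^ 2))), 0,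
      -(r * Real.sin (2 * Real.pi * (t / (Real.pi * r ^ 2))))]) (Real.pi * r ^ 2) := by
  have h1 := h.isHyperbolicOrbit_model hr hC
  have h0 : (f ∘ fun t ↦ flowModel α om R t (equatorPoint r)) = (fun t : ℝ ↦ f !₂[0,
      r * Real.cos (2 * Real.pi * (t / (Real.pi * r ^ 2))), 0,
      -(r * Real.sin (2 * Real.pi * (t / (Real.pi * r ^ 2))))]) := by
    funext t
    rw [Function.comp_apply, h.flowModel_equatorPoint hr hC]
  rwa [h0] at h1

end IsLevelCollar

end Equator

/-! ### The metric near `{q₁ + p₁ = 0}` -/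

section Metric

variable (α om : ℝ) (R : ℝ × ℝ → ℝ)

/-- The coefficient of `dq₁² + dp₁²` in `neckMetric`. -/
def metP (z : E4) : ℝ :=
  (coefB om R z ^ 2 * actY z + 4 * (coefA α R z ^ 2 * coefB om R z /
    (coefA α R z + coefB om R z)) * ((z 0 ^ 2 + z 2 ^ 2) / 2)) / 2

/-- The coefficient of `dq₂² + dp₂²` in `neckMetric`. -/
def metC (z : E4) : ℝ :=
  coefA α R z ^ 2 * ((z 0 ^ 2 + z 2 ^ 2) / 2) + coefA α R z * coefB om R z ^ 2 /
    (coefA α R z + coefB om R z) * actY z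

/-- The square of a coordinate functional as a bilinear form. -/
def sqL (i : Fin 4) : E4 →L[ℝ] E4 →L[ℝ] ℝ := (coordL i).smulRight (coordL i)

/-- A metric on `ℝ⁴ \ {0}` for which the hemispheres of `{q₁ + p₁ = 0}` are projections of
pseudo-holomorphic planes. -/
def neckMetric (z : E4) : E4 →L[ℝ] E4 →L[ℝ] ℝ :=
  metP α om R z • (sqL 0 + sqL 2) + metC α om R z • (sqL 1 + sqL 3)

variable {α om R}

lemma neckMetric_apply (z v w : E4) : neckMetric α om R z v w =
    metP α om R z * (v 0 * w 0 + v 2 * w 2) + metC α om R z * (v 1 * w 1 + v 3 * w 3) := rfl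

namespace IsGoodBall

variable {b δ E : ℝ} (h : IsGoodBall α om R b δ)
include h

lemma metP_pos {z : E4} (hz : z ∈ Metric.ball (0 : E4) δ) (h0 : z ≠ 0) : 0 < metP α om R z := by
  have hA := h.coefA_pos hz
  have hB := h.coefB_pos hz
  have hs : 0 < actY z + (z 0 ^ 2 + z 2 ^ 2) := by
    have := norm_sq_E4 z
    have h2 : 0 < ‖z‖ ^ 2 := by have := norm_pos_iff.2 h0; positivity
    rw [actY]; linarith
  have hy : 0 ≤ actY z := by rw [actY]; positivity
  have hx : 0 ≤ z 0 ^ 2 + z 2 ^ 2 := by positivity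
  rw [metP]
  rcases hy.lt_or_eq with hy' | hy'
  · positivity
  · have : 0 < z 0 ^ 2 + z 2 ^ 2 := by linarith
    positivity

lemma metC_pos {z : E4} (hz : z ∈ Metric.ball (0 : E4) δ) (h0 : z ≠ 0) : 0 < metC α om R z := by
  have hA := h.coefA_pos hz
  have hB := h.coefB_pos hz
  have hs : 0 < actY z + (z 0 ^ 2 + z 2 ^ 2) := by
    have := norm_sq_E4 z
    have h2 : 0 < ‖z‖ ^ 2 := by have := norm_pos_iff.2 h0; positivity
    rw [actY]; linarith
  have hy : 0 ≤ actY z := by rw [actY]; positivity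
  have hx : 0 ≤ z 0 ^ 2 + z 2 ^ 2 := by positivity
  rw [metC]
  rcases hy.lt_or_eq with hy' | hy'
  · positivity
  · have : 0 < z 0 ^ 2 + z 2 ^ 2 := by linarith
    positivity

lemma neckMetric_pos {z v : E4} (hz : z ∈ Metric.ball (0 : E4) δ) (h0 : z ≠ 0) (hv : v ≠ 0) :
    0 < neckMetric α om R z v v := by
  have hP := h.metP_pos hz h0
  have hC := h.metC_pos hz h0
  have h1 := norm_sq_E4 v
  have h2 : 0 < ‖v‖ ^ 2 := by have := norm_pos_iff.2 hv; positivity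
  rw [neckMetric_apply]
  have hy : 0 ≤ v 0 ^ 2 + v 2 ^ 2 := by positivity
  have hx : 0 ≤ v 1 ^ 2 + v 3 ^ 2 := by positivity
  have h3 : metP α om R z * (v 0 * v 0 + v 2 * v 2) + metC α om R z * (v 1 * v 1 + v 3 * v 3) =
    metP α om R z * (v 0 ^ 2 + v 2 ^ 2) + metC α om R z * (v 1 ^ 2 + v 3 ^ 2) := by ring
  rw [h3]
  rcases hy.lt_or_eq with hy' | hy'
  · positivity
  · have : 0 < v 1 ^ 2 + v 3 ^ 2 := by linarith
    positivity

lemma contDiffAt_neckMetric {z : E4} (hz : z ∈ Metric.ball (0 : E4) δ) :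
    ContDiffAt ℝ ∞ (neckMetric α om R) z := by
  have hA := h.coefA_pos hz
  have hB := h.coefB_pos hz
  have hAs := h.contDiffAt_coefA hz
  have hBs := h.contDiffAt_coefB hz
  have hAB : coefA α R z + coefB om R z ≠ 0 := by positivity
  have hX : ContDiffAt ℝ ∞ (fun z : E4 ↦ (z 0 ^ 2 + z 2 ^ 2) / 2) z :=
    (((contDiffAt_coord 0 z).pow 2).add ((contDiffAt_coord 2 z).pow 2)).div_const 2
  have hP : ContDiffAt ℝ ∞ (metP α om R) z :=
    ((((hBs.pow 2).mul (contDiffAt_actY z)).add ((contDiffAt_const.mul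
      (((hAs.pow 2).mul hBs).div (hAs.add hBs) hAB)).mul hX))).div_const 2
  have hC : ContDiffAt ℝ ∞ (metC α om R) z :=
    ((hAs.pow 2).mul hX).add (((hAs.mul (hBs.pow 2)).div (hAs.add hBs) hAB).mul
      (contDiffAt_actY z))
  have h1 : ∀ {F : E4 → ℝ} (L : E4 →L[ℝ] E4 →L[ℝ] ℝ), ContDiffAt ℝ ∞ F z →
      ContDiffAt ℝ ∞ (fun z ↦ F z • L) z := fun L hF ↦
    contMDiffAt_iff_contDiffAt.1 (hF.contMDiffAt.smul contMDiffAt_const)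
  exact (h1 _ hP).add (h1 _ hC)

lemma ne_zero_of_mem {z : E4} (hE : E ≠ 0) (hz : z ∈ levelSet α om R E δ) : z ≠ 0 := by
  rintro rfl
  refine hE ?_
  rw [← hz.2, normalForm]
  simp [actX, actY, h.box.zero_apply]

end IsGoodBall

variable {W : Type*} [TopologicalSpace W] [ChartedSpace E3 W] [IsManifold (𝓡 3) ∞ W]
  {b δ E : ℝ} {f : E4 → W} {κ : W → E4} {lam : OneForm W} {O : Set W}

/-- The Euclidean metric as a bilinear form. -/
def euclL (n : ℕ) : EuclideanSpace ℝ (Fin n) →L[ℝ] EuclideanSpace ℝ (Fin n) →L[ℝ] ℝ :=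
  innerSL ℝ

/-- A cut-off function, equal to 1 near the sphere and 0 near the complement of O, interpolates
between the pull-back of `neckMetric` and the metric induced by an embedding of W into a Euclidean
space; convex combinations stay positive. -/
lemma IsLevelCollar.exists_metric [T2Space W] [CompactSpace W]
    (h : IsLevelCollar α om R b δ E f κ lam O) (hE : E ≠ 0)
    (hK : IsClosed (f '' {z | z ∈ levelSet α om R E δ ∧ z 0 + z 2 = 0})) :
    ∃ g : W → E3 →L[ℝ] E3 →L[ℝ] ℝ, (∀ x, SmoothBilinAt g x) ∧
      (∀ x, IsKerMetric (formAt lam x) (g x)) ∧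
      ∀ z ∈ levelSet α om R E δ, z 0 + z 2 = 0 → ∀ v w,
        g (f z) v w = neckMetric α om R z (spaceD κ (f z) v) (spaceD κ (f z) w) := by
  obtain ⟨n, e, he, -, hinj⟩ := exists_embedding_euclidean_of_compact (I := 𝓡 3) (M := W)
  have hd : Disjoint Oᶜ (f '' {z | z ∈ levelSet α om R E δ ∧ z 0 + z 2 = 0}) := by
    rw [disjoint_compl_left_iff_subset]
    rintro _ ⟨z, hz, rfl⟩
    exact h.sphere_mem z hz.1 hz.2
  obtain ⟨χ, hχ0, hχ1, hχ⟩ := exists_contMDiffMap_zero_one_nhds_of_isClosed (𝓡 3) (n := (⊤ : ℕ∞))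
    h.liou.isOpen.isClosed_compl hK hd
  set g₁ : W → E3 →L[ℝ] E3 →L[ℝ] ℝ := fun x ↦
    bilinComp (χ x • neckMetric α om R (κ x)) (spaceD κ x) with hg₁
  set g₂ : W → E3 →L[ℝ] E3 →L[ℝ] ℝ := fun x ↦
    bilinComp ((1 - χ x) • euclL n) (spaceD e x) with hg₂
  have hg₁a : ∀ x v w, g₁ x v w =
      χ x * neckMetric α om R (κ x) (spaceD κ x v) (spaceD κ x w) := fun x v w ↦ by
    rw [hg₁, bilinComp_apply]; rfl
  have hg₂a : ∀ x v w, g₂ x v w = (1 - χ x) * inner ℝ (spaceD e x v) (spaceD e x w) :=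
    fun x v w ↦ by rw [hg₂, bilinComp_apply]; rfl
  refine ⟨fun x ↦ g₁ x + g₂ x, fun x ↦ SmoothBilinAt.add ?_ ?_, fun x ↦ ⟨fun v w ↦ ?_,
    fun v _ hv ↦ ?_⟩, fun z hz hz0 v w ↦ ?_⟩
  · by_cases hx : x ∈ O
    · have hκ := h.liou.collar.contMDiffAt_inv (h.liou.subset hx)
      refine smoothBilinAt_pull hκ ?_
      have h1 : ContMDiffAt (𝓡 3) 𝓘(ℝ, E4 →L[ℝ] E4 →L[ℝ] ℝ) ∞
          (fun x ↦ neckMetric α om R (κ x)) x :=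
        ((h.ball.contDiffAt_neckMetric (h.kappa_mem hx).1.1).contMDiffAt).comp x hκ
      exact (χ.contMDiff.contMDiffAt).smul h1
    · refine (smoothBilinAt_zero x).congr ?_
      have h1 : ∀ᶠ x' in 𝓝 x, χ x' = 0 :=
        (eventually_nhdsSet_iff_forall.1 hχ0) x hx
      filter_upwards [h1] with x' hx'
      rw [hg₁]
      ext v w
      simp [hx']
  · refine smoothBilinAt_pull he.contMDiffAt ?_
    exact (contMDiffAt_const.sub χ.contMDiff.contMDiffAt).smul contMDiffAt_const
  · change g₁ x v w + g₂ x v w = g₁ x w v + g₂ x w v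
    rw [hg₁a, hg₁a, hg₂a, hg₂a, neckMetric_apply, neckMetric_apply, real_inner_comm]
    ring
  · change 0 < g₁ x v v + g₂ x v v
    rw [hg₁a, hg₂a]
    have hev : spaceD e x v ≠ 0 := fun h0 ↦ hv (hinj x (h0.trans (map_zero (spaceD e x)).symm))
    have h2 : 0 < inner ℝ (spaceD e x v) (spaceD e x v) := real_inner_self_pos.2 hev
    have hc := hχ x
    by_cases hx : x ∈ O
    · have hκv : spaceD κ x v ≠ 0 := fun h0 ↦ hv
        (h.liou.collar.spaceD_injective (h.liou.subset hx) (h0.trans (map_zero _).symm))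
      have h1 := h.ball.neckMetric_pos (h.kappa_mem hx).1.1
        (h.ball.ne_zero_of_mem hE (h.kappa_mem hx).1) hκv
      rcases hc.1.lt_or_eq with h3 | h3
      · have h4 : 0 ≤ 1 - χ x := by linarith [hc.2]
        positivity
      · rw [← h3]; simpa using h2
    · have h1 : χ x = 0 := hχ0.self_of_nhdsSet x hx
      rw [h1]; simpa using h2
  · change g₁ (f z) v w + g₂ (f z) v w = _
    have h1 : χ (f z) = 1 := hχ1.self_of_nhdsSet _ ⟨z, ⟨hz, hz0⟩, rfl⟩
    rw [hg₁a, hg₂a, h1, h.liou.collar.leftInv z hz]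
    simp

end Metric

/-! ### The profile of the planes -/

section Profile

/-- Antiderivatives of functions that are smooth on `[0, ∞)`. -/
lemma antideriv_of_nonneg {g : ℝ → ℝ} (hg : ∀ τ, 0 ≤ τ → ContDiffAt ℝ ∞ g τ) {τ : ℝ} (hτ : 0 ≤ τ) :
    HasDerivAt (fun x ↦ ∫ t in (1 : ℝ)..x, g t) (g τ) τ ∧
      ContDiffAt ℝ ∞ (fun x ↦ ∫ t in (1 : ℝ)..x, g t) τ := by
  have hc : ∀ σ, 0 ≤ σ → ∀ᶠ x in 𝓝 σ, ContinuousAt g x := fun σ hσ ↦ by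
    have h1 : ContDiffAt ℝ 1 g σ := (hg σ hσ).of_le (by norm_cast)
    filter_upwards [h1.eventually (by simp)] with x hx using hx.continuousAt
  have hd : ∀ᶠ x in 𝓝 τ, HasDerivAt (fun x ↦ ∫ t in (1 : ℝ)..x, g t) (g x) x := by
    obtain ⟨ε, hε, hball⟩ := Metric.eventually_nhds_iff_ball.1 (hc τ hτ)
    filter_upwards [Metric.ball_mem_nhds τ hε] with x hx
    have hcx : ContinuousOn g (uIcc 1 x) := by
      intro y hy
      rcases le_or_gt 0 y with h0 | h0
      · exact (hg y h0).continuousAt.continuousWithinAt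
      · refine (hball y ?_).continuousWithinAt
        rw [mem_uIcc] at hy
        rw [Metric.mem_ball, Real.dist_eq, abs_lt] at hx ⊢
        rcases hy with hy | hy <;> constructor <;> linarith
    refine intervalIntegral.integral_hasDerivAt_right hcx.intervalIntegrable ?_ (hball x hx)
    exact ContinuousAt.stronglyMeasurableAtFilter Metric.isOpen_ball
      (fun y hy ↦ hball y hy) x hx
  refine ⟨hd.self_of_nhds, ?_⟩
  rw [contDiffAt_infty]
  intro n
  refine ContDiffAt.of_le (n := (n : ℕ∞ω) + 1) ?_ (by norm_cast; simp)
  rw [contDiffAt_succ_iff_hasFDerivAt]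
  refine ⟨fun x ↦ (1 : ℝ →L[ℝ] ℝ).smulRight (g x), ⟨_, hd, fun x hx ↦ ?_⟩, ?_⟩
  · exact (show HasDerivAt _ _ _ from hx).hasFDerivAt
  · exact contDiffAt_const.smulRight ((hg τ hτ).of_le (by norm_cast; exact le_top))

namespace IsProfile

variable {α om : ℝ} {R : ℝ × ℝ → ℝ} {b E : ℝ} {Y η m : ℝ → ℝ}
  (hp : IsProfile α om R b E Y η m)
include hp

lemma abs_η_lt {τ : ℝ} (hτ : 0 ≤ τ) : |η τ ^ 2| < b := by
  rw [abs_of_nonneg (sq_nonneg _)]; exact hp.η_lt τ hτ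

lemma abs_y_lt {τ : ℝ} (hτ : 0 ≤ τ) : |τ * m τ ^ 2| < b := by
  rw [abs_of_nonneg (by positivity)]; exact hp.y_lt τ hτ

lemma hasDerivAt_m {τ : ℝ} (hτ : 0 ≤ τ) : HasDerivAt m (deriv m τ) τ :=
  ((hp.smooth_m τ hτ).differentiableAt (by simp)).hasDerivAt

/-- The derivative of the identity K(η², τ m²) = E, solved for τ m'. The factor τ is kept because
the identity yields no value of m' at τ = 0. -/
lemma mul_deriv_m (h : IsGoodBox α om R b) {τ A B : ℝ} (hτ : 0 ≤ τ)
    (hA : A = abar α R (η τ ^ 2) (τ * m τ ^ 2)) (hB : B = obar om R (η τ ^ 2) (τ * m τ ^ 2)) :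
    τ * deriv m τ = τ * (-(B ^ 2 * m τ ^ 3) / (2 * (B ^ 2 * (τ * m τ ^ 2) +
      2 * A ^ 2 * η τ ^ 2))) := by
  rcases hτ.eq_or_lt with rfl | hτ'
  · simp
  have hA0 : 0 < A := hA ▸ h.abar_pos (hp.abs_η_lt hτ) (hp.abs_y_lt hτ)
  have hB0 : 0 < B := hB ▸ h.obar_pos (hp.abs_η_lt hτ) (hp.abs_y_lt hτ)
  have hm := hp.m_pos τ hτ
  have hη := hp.η_pos τ hτ
  have hd1 := hp.hasDerivAt τ hτ
  rw [← hA, ← hB] at hd1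
  have hd2 := hp.hasDerivAt_m hτ
  have h1 := (h.hasFDerivAt_actionEnergy (hp.abs_η_lt hτ) (hp.abs_y_lt hτ)).comp_hasDerivAt τ
    ((hd1.pow 2).prodMk ((hasDerivAt_id τ).mul (hd2.pow 2)))
  have h2 : HasDerivAt (fun _ : ℝ ↦ E) _ τ := h1.congr_of_eventuallyEq (by
    filter_upwards [lt_mem_nhds hτ'] with x hx
    exact (hp.level x hx.le).symm)
  have h3 := h2.unique (hasDerivAt_const τ E)
  rw [← hA, ← hB] at h3
  simp at h3
  set D := B ^ 2 * (τ * m τ ^ 2) + 2 * A ^ 2 * η τ ^ 2 with hD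
  have hD0 : 0 < D := by positivity
  have h4 : A * (2 * η τ * (-(A * B * η τ * m τ ^ 2) / (2 * D))) +
      B / 2 * (m τ ^ 2 + τ * (2 * m τ * deriv m τ)) = 0 := by
    linear_combination h3
  have h5 : B * m τ * (τ * deriv m τ) = B * m τ * (τ * (-(B ^ 2 * m τ ^ 3) / (2 * D))) := by
    have h6 : A * (2 * η τ * (-(A * B * η τ * m τ ^ 2) / (2 * D))) =
      -(B / 2 * m τ ^ 2 * (2 * A ^ 2 * η τ ^ 2 / D)) := by field_simp
    have h7 : 2 * A ^ 2 * η τ ^ 2 / D = 1 - B ^ 2 * (τ * m τ ^ 2) / D := by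
      rw [eq_sub_iff_add_eq, ← add_div, div_eq_one_iff_eq hD0.ne']; ring
    rw [h6, h7] at h4
    have h8 : B * m τ * (τ * (-(B ^ 2 * m τ ^ 3) / (2 * D))) =
      -(B / 2 * m τ ^ 2 * (B ^ 2 * (τ * m τ ^ 2) / D)) := by field_simp
    rw [h8]
    linear_combination h4
  exact mul_left_cancel₀ (by positivity) h5

end IsProfile

end Profile

/-! ### The model planes -/

section PlaneAlgebra

variable {A B e m a b c d σ e' m' τ y p q D N S k : ℝ}

/-- Source of the metric coefficients P = (B²y + 4Se²)/2 and C = A²e² + ky. With x = e², equality of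
the lengths of u_s and π u_t reads 4N²(P B²y + 2C A²x) = D²(P y + 2C x). Cancelling the common
factor x y (B - A) leaves P : C = B(4A²x + B(A+B)y) : 2A(A(A+B)x + B²y), and division by 2(A+B)
gives P and C. They stay smooth and positive where A = B as well. -/
lemma plane_coeff (hA : 0 < A) (hB : 0 < B) (hD : D = B ^ 2 * y + 2 * A ^ 2 * e ^ 2)
    (hN : N = A * e ^ 2 + B * (y / 2)) (hS : S = A ^ 2 * B / (A + B))
    (hk : k = A * B ^ 2 / (A + B)) :
    (B ^ 2 * y + 4 * S * e ^ 2) * (A ^ 2 * B ^ 2 * e ^ 2) +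
      (A ^ 2 * e ^ 2 + k * y) * (B ^ 4 * y - 2 * B ^ 2 * D) + k * D ^ 2 = 0 ∧
    (B ^ 2 * y + 4 * S * e ^ 2) * (A ^ 2 * e ^ 2) +
      (A ^ 2 * e ^ 2 + k * y) * (y * B ^ 2 - 4 * B * N) + 4 * k * N ^ 2 = 0 := by
  have h1 : S = A * B - k := by rw [hS, hk]; field_simp; ring
  have h2 : k * A + k * B = A * B ^ 2 := by rw [hk]; field_simp
  rw [h1, hD, hN]
  constructor
  · linear_combination (4 * A ^ 3 * e ^ 4 - 4 * A ^ 2 * B * e ^ 4) * h2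
  · ring

/-- Here z = a + ib, ζ = c + id, and p, q are the real and imaginary parts of z̄ζ. The mixed terms
cancel, and what exceeds the claimed multiple of |ζ|² is a combination of p² and q² whose two
coefficients vanish by `plane_coeff`. -/
lemma plane_metric (hA : 0 < A) (hB : 0 < B) (he : 0 < e) (hσ : σ ^ 2 = 1)
    (hτ : τ = a ^ 2 + b ^ 2) (hy : y = τ * m ^ 2) (hp : p = a * c + b * d)
    (hq : q = a * d - b * c) (hD : D = B ^ 2 * y + 2 * A ^ 2 * e ^ 2)
    (hN : N = A * e ^ 2 + B * (y / 2)) (hS : S = A ^ 2 * B / (A + B))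
    (hk : k = A * B ^ 2 / (A + B)) (he' : e' = -(A * B * e * m ^ 2) / (2 * D))
    (hm' : τ * m' = τ * (-(B ^ 2 * m ^ 3) / (2 * D))) :
    (B ^ 2 * y + 4 * S * e ^ 2) / 2 *
      ((-(σ * (e' * (2 * p))) - m ^ 2 * q / 2 * (-(A / N * (-(σ * e))))) ^ 2 +
        (σ * (e' * (2 * p)) - m ^ 2 * q / 2 * (A / N * (σ * e))) ^ 2) +
    (A ^ 2 * e ^ 2 + k * y) *
      ((m * c + m' * (2 * p) * a - m ^ 2 * q / 2 * (B / N * (-(m * b)))) ^ 2 +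
        (-(m * d + m' * (2 * p) * b) - m ^ 2 * q / 2 * (-(B / N * (m * a)))) ^ 2) =
      A ^ 2 * e ^ 2 * m ^ 2 * (c ^ 2 + d ^ 2) := by
  have hτ0 : 0 ≤ τ := by rw [hτ]; positivity
  have hy0 : 0 ≤ y := by rw [hy]; positivity
  have hD0 : 0 < D := by rw [hD]; positivity
  have hN0 : 0 < N := by rw [hN]; positivity
  obtain ⟨h1, h2⟩ := plane_coeff hA hB hD hN hS hk
  -- For τ = 0 the hypothesis does not determine m', but then a = b = 0 and p = 0.
  have hpm : m' * p = -(B ^ 2 * m ^ 3) / (2 * D) * p := by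
    rcases hτ0.eq_or_lt with h0 | h0
    · obtain ⟨ha, hb⟩ := (add_eq_zero_iff_of_nonneg (sq_nonneg a) (sq_nonneg b)).1
        (hτ.symm.trans h0.symm)
      rw [hp, pow_eq_zero_iff two_ne_zero |>.1 ha, pow_eq_zero_iff two_ne_zero |>.1 hb]
      ring
    · rw [mul_left_cancel₀ h0.ne' hm']
  have hpq : p ^ 2 + q ^ 2 = τ * (c ^ 2 + d ^ 2) := by rw [hp, hq, hτ]; ring
  have h3 : (-(σ * (e' * (2 * p))) - m ^ 2 * q / 2 * (-(A / N * (-(σ * e))))) ^ 2 +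
      (σ * (e' * (2 * p)) - m ^ 2 * q / 2 * (A / N * (σ * e))) ^ 2 =
      2 * (4 * p ^ 2 * e' ^ 2 + m ^ 4 * q ^ 2 * A ^ 2 * e ^ 2 / (4 * N ^ 2)) := by
    have : (-(σ * (e' * (2 * p))) - m ^ 2 * q / 2 * (-(A / N * (-(σ * e))))) ^ 2 +
      (σ * (e' * (2 * p)) - m ^ 2 * q / 2 * (A / N * (σ * e))) ^ 2 = σ ^ 2 *
      (2 * (4 * p ^ 2 * e' ^ 2 + m ^ 4 * q ^ 2 * A ^ 2 * e ^ 2 / (4 * N ^ 2))) := by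
      field_simp; ring
    rw [this, hσ, one_mul]
  have h4 : (m * c + m' * (2 * p) * a - m ^ 2 * q / 2 * (B / N * (-(m * b)))) ^ 2 +
      (-(m * d + m' * (2 * p) * b) - m ^ 2 * q / 2 * (-(B / N * (m * a)))) ^ 2 =
      m ^ 2 * (c ^ 2 + d ^ 2) + 4 * (m' * p) ^ 2 * τ + (B / N * m ^ 3 / 2) ^ 2 * q ^ 2 * τ +
        4 * m * (m' * p) * p - m * (B / N * m ^ 3) * q ^ 2 := by
    have hp' : p = a * c + b * d := hp
    set w := m' * p with hw
    have e1 : m' * (2 * p) * a = 2 * w * a := by rw [hw]; ring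
    have e2 : m' * (2 * p) * b = 2 * w * b := by rw [hw]; ring
    rw [e1, e2, hτ]
    generalize w = w
    rw [hp', hq]
    generalize B / N = r
    ring
  rw [h3, h4, hpm, he']
  have h5 : (A ^ 2 * e ^ 2 + k * y) * (m ^ 2 * (c ^ 2 + d ^ 2)) =
      A ^ 2 * e ^ 2 * m ^ 2 * (c ^ 2 + d ^ 2) + k * m ^ 4 * (p ^ 2 + q ^ 2) := by
    rw [hpq, hy]; ring
  have h6 : ∀ X Y Z V : ℝ, (A ^ 2 * e ^ 2 + k * y) * (m ^ 2 * (c ^ 2 + d ^ 2) + X + Y + Z - V) =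
      A ^ 2 * e ^ 2 * m ^ 2 * (c ^ 2 + d ^ 2) + k * m ^ 4 * (p ^ 2 + q ^ 2) +
      (A ^ 2 * e ^ 2 + k * y) * (X + Z) + (A ^ 2 * e ^ 2 + k * y) * (Y - V) := fun X Y Z V ↦ by
    rw [← h5]; ring
  rw [h6]
  set P := B ^ 2 * y + 4 * S * e ^ 2
  set C := A ^ 2 * e ^ 2 + k * y
  have h7 : P / 2 * (2 * (4 * p ^ 2 * (-(A * B * e * m ^ 2) / (2 * D)) ^ 2)) + k * m ^ 4 * p ^ 2 +
      C * (4 * (-(B ^ 2 * m ^ 3) / (2 * D) * p) ^ 2 * τ +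
        4 * m * (-(B ^ 2 * m ^ 3) / (2 * D) * p) * p) = 0 := by
    have : P / 2 * (2 * (4 * p ^ 2 * (-(A * B * e * m ^ 2) / (2 * D)) ^ 2)) + k * m ^ 4 * p ^ 2 +
      C * (4 * (-(B ^ 2 * m ^ 3) / (2 * D) * p) ^ 2 * τ +
        4 * m * (-(B ^ 2 * m ^ 3) / (2 * D) * p) * p) = p ^ 2 * m ^ 4 / D ^ 2 *
        (P * (A ^ 2 * B ^ 2 * e ^ 2) + C * (B ^ 4 * (τ * m ^ 2) - 2 * B ^ 2 * D) + k * D ^ 2) := by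
      generalize P = P, C = C
      clear hD h1 h6
      field_simp
      ring
    rw [this, ← hy, h1, mul_zero]
  have h8 : P / 2 * (2 * (m ^ 4 * q ^ 2 * A ^ 2 * e ^ 2 / (4 * N ^ 2))) + k * m ^ 4 * q ^ 2 +
      C * ((B / N * m ^ 3 / 2) ^ 2 * q ^ 2 * τ - m * (B / N * m ^ 3) * q ^ 2) = 0 := by
    have : P / 2 * (2 * (m ^ 4 * q ^ 2 * A ^ 2 * e ^ 2 / (4 * N ^ 2))) + k * m ^ 4 * q ^ 2 +
      C * ((B / N * m ^ 3 / 2) ^ 2 * q ^ 2 * τ - m * (B / N * m ^ 3) * q ^ 2) =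
        q ^ 2 * m ^ 4 / (4 * N ^ 2) *
        (P * (A ^ 2 * e ^ 2) + C * (τ * m ^ 2 * B ^ 2 - 4 * B * N) + 4 * k * N ^ 2) := by
      generalize P = P, C = C
      clear hN h1 h2 h6
      field_simp
      ring
    rw [this, ← hy, h2, mul_zero]
  linear_combination h7 + h8

end PlaneAlgebra

/-! ### The planes as maps to ℝ⁴ and their derivatives -/

section Plane

/-- `|z|²`. -/
def sqAbs (z : ℂ) : ℝ := z.re ^ 2 + z.im ^ 2

lemma sqAbs_nonneg (z : ℂ) : 0 ≤ sqAbs z := by rw [sqAbs]; positivity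

lemma contDiff_sqAbs : ContDiff ℝ ∞ sqAbs :=
  (Complex.reCLM.contDiff.pow 2).add (Complex.imCLM.contDiff.pow 2)

/-- The planes: `h = σ η`, `f = ‖z‖ m`. -/
def planeMap (σ : ℝ) (η m : ℝ → ℝ) (z : ℂ) : E4 :=
  !₂[-(σ * η (sqAbs z)), m (sqAbs z) * z.re, σ * η (sqAbs z), -(m (sqAbs z) * z.im)]

/-- The `ℝ`-component of the planes. -/
def planeHeight (m : ℝ → ℝ) (z : ℂ) : ℝ := (∫ t in (1 : ℝ)..sqAbs z, m t ^ 2) / 4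

/-- The derivative of `planeMap`. -/
def planeDir (σ : ℝ) (η m : ℝ → ℝ) (z ζ : ℂ) : E4 :=
  !₂[-(σ * (deriv η (sqAbs z) * (2 * (z.re * ζ.re + z.im * ζ.im)))),
    m (sqAbs z) * ζ.re + deriv m (sqAbs z) * (2 * (z.re * ζ.re + z.im * ζ.im)) * z.re,
    σ * (deriv η (sqAbs z) * (2 * (z.re * ζ.re + z.im * ζ.im))),
    -(m (sqAbs z) * ζ.im + deriv m (sqAbs z) * (2 * (z.re * ζ.re + z.im * ζ.im)) * z.im)]

lemma hasDerivAt_line_re (z ζ : ℂ) : HasDerivAt (fun s : ℝ ↦ (z + s • ζ).re) ζ.re 0 := by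
  simpa using ((hasDerivAt_id (0 : ℝ)).mul_const ζ.re).const_add z.re

lemma hasDerivAt_line_im (z ζ : ℂ) : HasDerivAt (fun s : ℝ ↦ (z + s • ζ).im) ζ.im 0 := by
  simpa using ((hasDerivAt_id (0 : ℝ)).mul_const ζ.im).const_add z.im

lemma hasDerivAt_line_sqAbs (z ζ : ℂ) : HasDerivAt (fun s : ℝ ↦ sqAbs (z + s • ζ))
    (2 * (z.re * ζ.re + z.im * ζ.im)) 0 := by
  refine (((hasDerivAt_line_re z ζ).pow 2).add ((hasDerivAt_line_im z ζ).pow 2)).congr_deriv ?_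
  simp; ring

lemma fderiv_eq_of_line {V : Type*} [NormedAddCommGroup V] [NormedSpace ℝ V] {F : ℂ → V}
    {z ζ : ℂ} {v : V} (hF : DifferentiableAt ℝ F z)
    (h : HasDerivAt (fun s : ℝ ↦ F (z + s • ζ)) v 0) : fderiv ℝ F z ζ = v := by
  have h1 : HasDerivAt (fun s : ℝ ↦ z + s • ζ) ζ 0 := by
    simpa using ((hasDerivAt_id (0 : ℝ)).smul_const ζ).const_add z
  have h2 : HasFDerivAt F (fderiv ℝ F z) (z + (0 : ℝ) • ζ) := by simpa using hF.hasFDerivAt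
  exact (h2.comp_hasDerivAt 0 h1).unique h

/-- A profile whose planes stay in the ball of radius `δ`. -/
structure IsPlaneModel (α om : ℝ) (R : ℝ × ℝ → ℝ) (b δ E : ℝ) (Y η m : ℝ → ℝ) : Prop where
  ball : IsGoodBall α om R b δ
  prof : IsProfile α om R b E Y η m
  lt : ∀ τ, 0 ≤ τ → 2 * η τ ^ 2 + τ * m τ ^ 2 < δ ^ 2

namespace IsPlaneModel

variable {α om : ℝ} {R : ℝ × ℝ → ℝ} {b δ E : ℝ} {Y η m : ℝ → ℝ} {σ : ℝ}
  (hM : IsPlaneModel α om R b δ E Y η m)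

lemma contDiff_comp_sqAbs {g : ℝ → ℝ} (hg : ∀ τ, 0 ≤ τ → ContDiffAt ℝ ∞ g τ) :
    ContDiff ℝ ∞ fun z ↦ g (sqAbs z) :=
  contDiff_iff_contDiffAt.2 fun z ↦
    (hg _ (sqAbs_nonneg z)).comp z contDiff_sqAbs.contDiffAt

include hM

lemma contDiff_planeMap (σ : ℝ) : ContDiff ℝ ∞ (planeMap σ η m) := by
  have h1 := contDiff_comp_sqAbs hM.prof.smooth_η
  have h2 := contDiff_comp_sqAbs hM.prof.smooth_m
  have h3 : ContDiff ℝ ∞ fun z : ℂ ↦ z.re := Complex.reCLM.contDiff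
  have h4 : ContDiff ℝ ∞ fun z : ℂ ↦ z.im := Complex.imCLM.contDiff
  rw [contDiff_euclidean]
  intro i
  fin_cases i
  · exact (contDiff_const.mul h1).neg
  · exact h2.mul h3
  · exact contDiff_const.mul h1
  · exact (h2.mul h4).neg

lemma contDiff_planeHeight : ContDiff ℝ ∞ (planeHeight m) :=
  (contDiff_comp_sqAbs fun _ hτ ↦ (antideriv_of_nonneg (fun τ hτ ↦
    (hM.prof.smooth_m τ hτ).pow 2) hτ).2).div_const 4

lemma fderiv_planeMap (σ : ℝ) (z ζ : ℂ) :
    fderiv ℝ (planeMap σ η m) z ζ = planeDir σ η m z ζ := by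
  refine fderiv_eq_of_line ((hM.contDiff_planeMap σ).differentiable (by simp) z)
    (hasDerivAt_E4 fun i ↦ ?_)
  have h0 : sqAbs (z + (0 : ℝ) • ζ) = sqAbs z := by simp
  have hc : ∀ {g : ℝ → ℝ}, DifferentiableAt ℝ g (sqAbs z) →
      HasDerivAt (fun s : ℝ ↦ g (sqAbs (z + s • ζ)))
        (deriv g (sqAbs z) * (2 * (z.re * ζ.re + z.im * ζ.im))) 0 := fun {g} hg ↦ by
    have h1 : HasDerivAt g (deriv g (sqAbs z)) (sqAbs (z + (0 : ℝ) • ζ)) := by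
      rw [h0]; exact hg.hasDerivAt
    exact h1.comp (h := fun s : ℝ ↦ sqAbs (z + s • ζ)) 0 (hasDerivAt_line_sqAbs z ζ)
  have h1 := hc ((hM.prof.smooth_η _ (sqAbs_nonneg z)).differentiableAt (by simp))
  have h2 := hc ((hM.prof.smooth_m _ (sqAbs_nonneg z)).differentiableAt (by simp))
  fin_cases i
  · exact (h1.const_mul σ).neg
  · exact (h2.mul (hasDerivAt_line_re z ζ)).congr_deriv (by simp [planeDir]; ring)
  · exact h1.const_mul σ
  · exact (h2.mul (hasDerivAt_line_im z ζ)).neg.congr_deriv (by simp [planeDir]; ring)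

lemma fderiv_planeHeight (z ζ : ℂ) : fderiv ℝ (planeHeight m) z ζ =
    m (sqAbs z) ^ 2 * (z.re * ζ.re + z.im * ζ.im) / 2 := by
  refine fderiv_eq_of_line (hM.contDiff_planeHeight.differentiable (by simp) z) ?_
  have h1 : HasDerivAt (fun x ↦ ∫ t in (1 : ℝ)..x, m t ^ 2) (m (sqAbs z) ^ 2)
      (sqAbs (z + (0 : ℝ) • ζ)) := by
    rw [show sqAbs (z + (0 : ℝ) • ζ) = sqAbs z by simp]
    exact (antideriv_of_nonneg (fun τ hτ ↦ (hM.prof.smooth_m τ hτ).pow 2) (sqAbs_nonneg z)).1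
  refine ((h1.comp (h := fun s : ℝ ↦ sqAbs (z + s • ζ)) 0
    (hasDerivAt_line_sqAbs z ζ)).div_const 4).congr_deriv ?_
  ring

omit hM in
lemma actX_planeMap (hσ : σ ^ 2 = 1) (z : ℂ) : actX (planeMap σ η m z) = η (sqAbs z) ^ 2 := by
  simp [actX, planeMap]; linear_combination η (sqAbs z) ^ 2 * hσ

omit hM in
lemma actY_planeMap (z : ℂ) : actY (planeMap σ η m z) = sqAbs z * m (sqAbs z) ^ 2 := by
  simp [actY, planeMap]; rw [sqAbs]; ring

omit hM in
lemma coefA_planeMap (hσ : σ ^ 2 = 1) (z : ℂ) : coefA α R (planeMap σ η m z) =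
    abar α R (η (sqAbs z) ^ 2) (sqAbs z * m (sqAbs z) ^ 2) := by
  rw [coefA, actX_planeMap hσ, actY_planeMap]

omit hM in
lemma coefB_planeMap (hσ : σ ^ 2 = 1) (z : ℂ) : coefB om R (planeMap σ η m z) =
    obar om R (η (sqAbs z) ^ 2) (sqAbs z * m (sqAbs z) ^ 2) := by
  rw [coefB, actX_planeMap hσ, actY_planeMap]

lemma planeMap_mem (hσ : σ ^ 2 = 1) (z : ℂ) : planeMap σ η m z ∈ levelSet α om R E δ := by
  have h0 := sqAbs_nonneg z
  refine ⟨?_, ?_⟩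
  · rw [mem_ball_E4 hM.ball.δ_pos]
    refine lt_of_eq_of_lt ?_ (hM.lt _ h0)
    simp [planeMap]
    rw [← sub_eq_zero, sqAbs]
    linear_combination 2 * η (z.re ^ 2 + z.im ^ 2) ^ 2 * hσ
  · rw [normalForm, actX_planeMap hσ, actY_planeMap]
    exact hM.prof.level _ h0

omit hM in
lemma planeMap_sum (σ : ℝ) (z : ℂ) : planeMap σ η m z 0 + planeMap σ η m z 2 = 0 := by
  simp [planeMap]

end IsPlaneModel

end Plane

/-! ### The planes are pseudo-holomorphic -/

section Holo

variable {W : Type*} [TopologicalSpace W] [ChartedSpace E3 W] [IsManifold (𝓡 3) ∞ W]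
  {α om : ℝ} {R : ℝ × ℝ → ℝ} {b δ E : ℝ} {f : E4 → W} {κ : W → E4} {lam : OneForm W} {O : Set W}
  {Y η m : ℝ → ℝ} {σ : ℝ}

/-- `reebModel` first has to be exhibited as the image under dκ of a tangent vector of W; the lifted
trajectory of `flowModel` through κ x provides one. -/
lemma IsLevelCollar.spaceD_reeb (h : IsLevelCollar α om R b δ E f κ lam O) {x : W} (hx : x ∈ O)
    (hN : coefN α om R (κ x) ≠ 0) :
    spaceD κ x (reebVec (formAt lam x) (extDL lam x)) = reebModel α om R (κ x) := by
  rw [← h.liou.contact.reeb_eq]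
  have hx' := h.kappa_mem hx
  set c : ℝ → E4 := fun t ↦ flowModel α om R t (κ x) with hc
  have hc0 : c 0 = κ x := IsGoodBall.flowModel_zero _
  have hsm : ContDiffAt ℝ ∞ c 0 := (h.ball.contDiffAt_flowModel hx'.1.1 hN 0).comp
    (f := fun t : ℝ ↦ (κ x, t)) 0 (contDiffAt_const.prodMk contDiffAt_id)
  have hC : ∀ᶠ s in 𝓝 (0 : ℝ), c s ∈ levelSet α om R E δ := by
    have h1 : ∀ᶠ s in 𝓝 (0 : ℝ), c s ∈ Metric.ball (0 : E4) δ :=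
      hsm.continuousAt.eventually_mem (Metric.isOpen_ball.mem_nhds (by rw [hc0]; exact hx'.1.1))
    filter_upwards [h1] with s hs
    exact ⟨hs, (IsGoodBall.normalForm_flowModel s _).trans hx'.1.2⟩
  have hfx : f (c 0) = x := by rw [hc0]; exact hx'.2
  have hd := IsGoodBall.hasDerivAt_flowModel (α := α) (om := om) (R := R) 0 (κ x)
  have h1 := h.hasMFDerivAt_of_model hsm hC (by rwa [hfx]) (by rwa [hc0]) hd
  have h2 := h.liou.collar.spaceD_mfderiv_comp hsm.contMDiffAt hC (1 : ℝ)
  have h3 : mfderiv 𝓘(ℝ, ℝ) (𝓡 3) (f ∘ c) 0 (1 : ℝ) = reeb lam ((f ∘ c) 0) := by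
    rw [h1.mfderiv]
    exact one_smul ℝ _
  have h4 : mfderiv 𝓘(ℝ, ℝ) 𝓘(ℝ, E4) c 0 = fderiv ℝ c 0 := mfderiv_eq_fderiv
  have h5 : fderiv ℝ c 0 (1 : ℝ) = reebModel α om R (c 0) := by
    rw [hd.hasFDerivAt.fderiv]; simp [hc]
  have h6 : spaceD κ (f (c 0)) (reeb lam (f (c 0))) = reebModel α om R (c 0) :=
    (congrArg (spaceD κ (f (c 0))) h3.symm).trans
      (h2.trans ((DFunLike.congr_fun h4 (1 : ℝ)).trans h5))
  rw [hfx, hc0] at h6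
  exact h6

/-- The derivative of the projected plane. -/
def planeD (f : E4 → W) (σ : ℝ) (η m : ℝ → ℝ) (z : ℂ) : ℂ →L[ℝ] E3 :=
  mfderiv 𝓘(ℝ, ℂ) (𝓡 3) (f ∘ planeMap σ η m) z

/-- The component of the derivative of the projected plane in the contact structure. -/
def planeKer (f : E4 → W) (lam : OneForm W) (σ : ℝ) (η m : ℝ → ℝ) (z ζ : ℂ) : E3 :=
  contactProj (formAt lam (f (planeMap σ η m z))) (extDL lam (f (planeMap σ η m z)))
    (planeD f σ η m z ζ)

namespace IsPlaneModel

variable (hM : IsPlaneModel α om R b δ E Y η m) (h : IsLevelCollar α om R b δ E f κ lam O)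
  (hσ : σ ^ 2 = 1)
include hM h hσ

lemma contMDiff_plane : ContMDiff 𝓘(ℝ, ℂ) (𝓡 3) ∞ (f ∘ planeMap σ η m) := fun _ ↦
  h.liou.collar.contMDiffAt_comp (hM.contDiff_planeMap σ).contDiffAt.contMDiffAt
    (Eventually.of_forall (hM.planeMap_mem hσ))

lemma plane_mem (z : ℂ) : f (planeMap σ η m z) ∈ O :=
  h.sphere_mem _ (hM.planeMap_mem hσ z) (planeMap_sum σ z)

lemma kappa_plane (z : ℂ) : κ (f (planeMap σ η m z)) = planeMap σ η m z :=
  h.liou.collar.leftInv _ (hM.planeMap_mem hσ z)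

lemma spaceD_planeD (z ζ : ℂ) :
    spaceD κ (f (planeMap σ η m z)) (planeD f σ η m z ζ) = planeDir σ η m z ζ := by
  have h1 := h.liou.collar.spaceD_mfderiv_comp (hM.contDiff_planeMap σ).contDiffAt.contMDiffAt
    (Eventually.of_forall (hM.planeMap_mem hσ)) (p := z) ζ
  have h2 : mfderiv 𝓘(ℝ, ℂ) 𝓘(ℝ, E4) (planeMap σ η m) z = fderiv ℝ (planeMap σ η m) z :=
    mfderiv_eq_fderiv
  exact h1.trans ((DFunLike.congr_fun h2 ζ).trans (hM.fderiv_planeMap σ z ζ))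

/-- This is m² Im(z̄ζ)/2, while da(ζ) = m² Re(z̄ζ)/2; together they give the part of the
Cauchy-Riemann equation along ∂_a and the Reeb field. -/
lemma formAt_planeD (z ζ : ℂ) : formAt lam (f (planeMap σ η m z)) (planeD f σ η m z ζ) =
    m (sqAbs z) ^ 2 * (z.re * ζ.im - z.im * ζ.re) / 2 := by
  rw [h.liou.form _ (hM.plane_mem h hσ z), hM.kappa_plane h hσ, hM.spaceD_planeD h hσ]
  simp [liouville, planeMap, planeDir]
  ring

omit h in
lemma coefN_planeMap_pos (z : ℂ) : 0 < coefN α om R (planeMap σ η m z) := by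
  have hz := (hM.planeMap_mem hσ z).1
  have hA := hM.ball.coefA_pos hz
  have hB := hM.ball.coefB_pos hz
  have hη := hM.prof.η_pos _ (sqAbs_nonneg z)
  have hs := sqAbs_nonneg z
  rw [coefN, actX_planeMap hσ, actY_planeMap]
  positivity

lemma spaceD_planeKer (z ζ : ℂ) :
    spaceD κ (f (planeMap σ η m z)) (planeKer f lam σ η m z ζ) = planeDir σ η m z ζ -
      (m (sqAbs z) ^ 2 * (z.re * ζ.im - z.im * ζ.re) / 2) •
        reebModel α om R (planeMap σ η m z) := by
  have h1 := h.spaceD_reeb (hM.plane_mem h hσ z) (by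
    rw [hM.kappa_plane h hσ]; exact (hM.coefN_planeMap_pos hσ z).ne')
  rw [hM.kappa_plane h hσ] at h1
  rw [planeKer, contactProj_apply, hM.formAt_planeD h hσ, map_sub, map_smul,
    hM.spaceD_planeD h hσ, h1]

/-- The projected differential ℂ → ξ is conformal for `neckMetric`, with factor A²η²m²; the algebra
is `plane_metric`. -/
lemma neckMetric_planeKer (z : ℂ) : ∃ k, 0 < k ∧ ∀ ζ,
    neckMetric α om R (planeMap σ η m z)
      (spaceD κ (f (planeMap σ η m z)) (planeKer f lam σ η m z ζ))
      (spaceD κ (f (planeMap σ η m z)) (planeKer f lam σ η m z ζ)) =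
        k * (ζ.re ^ 2 + ζ.im ^ 2) := by
  have hz := (hM.planeMap_mem hσ z).1
  have hA := hM.ball.coefA_pos hz
  have hB := hM.ball.coefB_pos hz
  have hη := hM.prof.η_pos _ (sqAbs_nonneg z)
  have hm := hM.prof.m_pos _ (sqAbs_nonneg z)
  have hη' := (hM.prof.hasDerivAt _ (sqAbs_nonneg z)).deriv
  have hm' := hM.prof.mul_deriv_m hM.ball.box (sqAbs_nonneg z) rfl rfl
  rw [← coefA_planeMap hσ, ← coefB_planeMap hσ] at hη' hm'
  have hNe : coefN α om R (planeMap σ η m z) = coefA α R (planeMap σ η m z) * η (sqAbs z) ^ 2 +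
      coefB om R (planeMap σ η m z) * (sqAbs z * m (sqAbs z) ^ 2 / 2) := by
    rw [coefN, actX_planeMap hσ, actY_planeMap]
  have hPe : metP α om R (planeMap σ η m z) =
      (coefB om R (planeMap σ η m z) ^ 2 * (sqAbs z * m (sqAbs z) ^ 2) +
        4 * (coefA α R (planeMap σ η m z) ^ 2 * coefB om R (planeMap σ η m z) /
          (coefA α R (planeMap σ η m z) + coefB om R (planeMap σ η m z))) * η (sqAbs z) ^ 2) / 2 := by
    rw [metP, actY_planeMap]
    congr 4
    simp [planeMap]
    linear_combination η (sqAbs z) ^ 2 * hσ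
  have hCe : metC α om R (planeMap σ η m z) =
      coefA α R (planeMap σ η m z) ^ 2 * η (sqAbs z) ^ 2 +
        coefA α R (planeMap σ η m z) * coefB om R (planeMap σ η m z) ^ 2 /
          (coefA α R (planeMap σ η m z) + coefB om R (planeMap σ η m z)) *
          (sqAbs z * m (sqAbs z) ^ 2) := by
    rw [metC, actY_planeMap]
    congr 2
    simp [planeMap]
    linear_combination η (sqAbs z) ^ 2 * hσ
  refine ⟨coefA α R (planeMap σ η m z) ^ 2 * η (sqAbs z) ^ 2 * m (sqAbs z) ^ 2, by positivity,
    fun ζ ↦ ?_⟩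
  have key := plane_metric (τ := sqAbs z) (y := sqAbs z * m (sqAbs z) ^ 2) (a := z.re) (b := z.im) (c := ζ.re) (d := ζ.im) hA hB hη hσ rfl rfl
    rfl rfl rfl hNe rfl rfl hη' hm'
  rw [hM.spaceD_planeKer h hσ, neckMetric_apply, hPe, hCe, ← key]
  simp only [planeDir, reebModel]
  generalize coefA α R (planeMap σ η m z) = A
  generalize coefB om R (planeMap σ η m z) = B
  generalize coefN α om R (planeMap σ η m z) = N
  simp [planeMap]
  ring

omit [TopologicalSpace W] [ChartedSpace E3 W] [IsManifold (𝓡 3) ∞ W] hM h hσ in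
lemma omega0_planeDir (z ζ : ℂ) : omega0 (planeDir σ η m z ζ) (planeDir σ η m z (Complex.I * ζ)) =
    (m (sqAbs z) ^ 2 + 2 * m (sqAbs z) * (sqAbs z * deriv m (sqAbs z))) *
      (ζ.re ^ 2 + ζ.im ^ 2) := by
  simp [omega0, planeDir]
  generalize deriv m (sqAbs z) = m'
  generalize m (sqAbs z) = m
  rw [sqAbs]
  ring

omit hM hσ in
lemma extDL_planeKer (z ζ : ℂ) : extDL lam (f (planeMap σ η m z)) (planeKer f lam σ η m z ζ)
    (planeKer f lam σ η m z (Complex.I * ζ)) = extDL lam (f (planeMap σ η m z))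
      (planeD f σ η m z ζ) (planeD f σ η m z (Complex.I * ζ)) := by
  set x := f (planeMap σ η m z)
  have hr := (h.liou.contact.isContactPair x).reebVec_spec.2
  have hr' : ∀ v, extDL lam x v (reebVec (formAt lam x) (extDL lam x)) = 0 := fun v ↦ by
    rw [(h.liou.contact.isContactPair x).alt, hr, neg_zero]
  simp only [planeKer, contactProj_apply, map_sub, map_smul, sub_apply, smul_apply]
  rw [hr, hr, hr']
  simp

lemma extDL_planeD (z ζ : ℂ) : extDL lam (f (planeMap σ η m z)) (planeD f σ η m z ζ)
    (planeD f σ η m z (Complex.I * ζ)) =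
    (m (sqAbs z) ^ 2 + 2 * m (sqAbs z) * (sqAbs z * deriv m (sqAbs z))) *
      (ζ.re ^ 2 + ζ.im ^ 2) := by
  rw [h.liou.extDL_eq (hM.plane_mem h hσ z), hM.spaceD_planeD h hσ, hM.spaceD_planeD h hσ,
    omega0_planeDir]

-- The quantity is the τ-derivative of f² = τ m² and equals 2A²η²m²/D. It provides the orientation
-- of the planes, the sign of the energy density and the monotonicity of f.
omit h hσ in
lemma area_pos {τ : ℝ} (hτ : 0 ≤ τ) : 0 < m τ ^ 2 + 2 * m τ * (τ * deriv m τ) := by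
  rw [hM.prof.mul_deriv_m hM.ball.box hτ rfl rfl]
  have hA := hM.ball.box.abar_pos (hM.prof.abs_η_lt hτ) (hM.prof.abs_y_lt hτ)
  have hB := hM.ball.box.obar_pos (hM.prof.abs_η_lt hτ) (hM.prof.abs_y_lt hτ)
  have hη := hM.prof.η_pos τ hτ
  have hm := hM.prof.m_pos τ hτ
  generalize abar α R (η τ ^ 2) (τ * m τ ^ 2) = A at *
  generalize obar om R (η τ ^ 2) (τ * m τ ^ 2) = B at *
  have hD : 0 < B ^ 2 * (τ * m τ ^ 2) + 2 * A ^ 2 * η τ ^ 2 := by positivity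
  have : m τ ^ 2 + 2 * m τ * (τ * (-(B ^ 2 * m τ ^ 3) / (2 * (B ^ 2 * (τ * m τ ^ 2) +
      2 * A ^ 2 * η τ ^ 2)))) = 2 * A ^ 2 * η τ ^ 2 * m τ ^ 2 /
      (B ^ 2 * (τ * m τ ^ 2) + 2 * A ^ 2 * η τ ^ 2) := by
    rw [eq_div_iff hD.ne']
    field_simp
    ring
  rw [this]
  positivity

/-- Conformality at ζ, iζ and ζ + iζ polarises to orthogonality and equal length of the images of ζ
and iζ, and the area is positive; `conformalJ_eq` then says that J maps the first image to the
second. -/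
lemma isHolomorphicPlane {g : W → E3 →L[ℝ] E3 →L[ℝ] ℝ}
    (hg : ∀ x, IsKerMetric (formAt lam x) (g x))
    (hgn : ∀ z ∈ levelSet α om R E δ, z 0 + z 2 = 0 → ∀ v w,
        g (f z) v w = neckMetric α om R z (spaceD κ (f z) v) (spaceD κ (f z) w)) :
    IsHolomorphicPlane lam (metricJ lam g) (planeHeight m) (f ∘ planeMap σ η m) := by
  refine ⟨hM.contDiff_planeHeight, hM.contMDiff_plane h hσ, fun z ζ ↦ ?_⟩
  set x := f (planeMap σ η m z) with hx
  have hpair := h.liou.contact.isContactPair x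
  obtain ⟨k, hk, hkζ⟩ := hM.neckMetric_planeKer h hσ z
  have hG : ∀ v w, g x v w = neckMetric α om R (planeMap σ η m z) (spaceD κ x v) (spaceD κ x w) :=
    hgn _ (hM.planeMap_mem hσ z) (planeMap_sum σ z)
  have hker : ∀ ζ, formAt lam x (planeKer f lam σ η m z ζ) = 0 := fun ζ ↦
    hpair.contactProj_mem _
  have hGk : ∀ ζ, g x (planeKer f lam σ η m z ζ) (planeKer f lam σ η m z ζ) =
      k * (ζ.re ^ 2 + ζ.im ^ 2) := fun ζ ↦ (hG _ _).trans (hkζ ζ)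
  have hJ : conformalJ (formAt lam x) (extDL lam x) (g x) (planeKer f lam σ η m z ζ) =
      planeKer f lam σ η m z (Complex.I * ζ) := by
    by_cases h0 : ζ = 0
    · subst h0; simp [planeKer]
    have hζ : 0 < ζ.re ^ 2 + ζ.im ^ 2 := by
      have := Complex.normSq_pos.2 h0
      rw [Complex.normSq_apply] at this
      linarith
    have hadd : planeKer f lam σ η m z (ζ + Complex.I * ζ) =
        planeKer f lam σ η m z ζ + planeKer f lam σ η m z (Complex.I * ζ) := by
      simp only [planeKer, map_add]
    have e1 := hGk ζ
    have e2 := hGk (Complex.I * ζ)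
    have e3 := hGk (ζ + Complex.I * ζ)
    rw [hadd] at e3
    simp only [map_add, add_apply] at e3
    have e4 := (hg x).symm (planeKer f lam σ η m z ζ) (planeKer f lam σ η m z (Complex.I * ζ))
    simp at e2 e3
    refine hpair.conformalJ_eq (hg x) (hker _) (hker _) ?_ ?_ ?_
    · linarith
    · linarith
    · rw [extDL_planeKer h, hM.extDL_planeD h hσ]
      exact mul_pos (hM.area_pos (sqAbs_nonneg z)) hζ
  have e1 : -formAt lam x (planeD f σ η m z ζ) = fderiv ℝ (planeHeight m) z (Complex.I * ζ) := by
    rw [hM.fderiv_planeHeight, hM.formAt_planeD h hσ]; simp; ring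
  have e2 : formAt lam x (planeD f σ η m z (Complex.I * ζ)) = fderiv ℝ (planeHeight m) z ζ := by
    rw [hM.fderiv_planeHeight, hM.formAt_planeD h hσ]; simp
  refine Prod.ext e1 ?_
  have e3 : ∀ X : E3, X = reebVec (formAt lam x) (extDL lam x) →
      conformalJ (formAt lam x) (extDL lam x) (g x)
        (planeD f σ η m z ζ - formAt lam x (planeD f σ η m z ζ) • X) +
          fderiv ℝ (planeHeight m) z ζ • X = planeD f σ η m z (Complex.I * ζ) := by
    rintro X rfl
    rw [← contactProj_apply, ← e2]
    exact (congrArg (· + _) hJ).trans (by rw [planeKer, contactProj_apply]; exact sub_add_cancel _ _)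
  exact e3 _ (h.liou.contact.reeb_eq x)

lemma energyDensity_eq (ψ : ℝ → ℝ) (z : ℂ) :
    energyDensity lam ψ (planeHeight m) (f ∘ planeMap σ η m) z =
      deriv ψ (planeHeight m z) * (m (sqAbs z) ^ 4 * sqAbs z / 4) + ψ (planeHeight m z) *
        (m (sqAbs z) ^ 2 + 2 * m (sqAbs z) * (sqAbs z * deriv m (sqAbs z))) := by
  have e1 := hM.formAt_planeD h hσ z 1
  have e2 := hM.formAt_planeD h hσ z Complex.I
  have e3 := hM.extDL_planeD h hσ z 1
  have e4 := hM.fderiv_planeHeight z 1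
  have e5 := hM.fderiv_planeHeight z Complex.I
  rw [mul_one] at e3
  have e6 : energyDensity lam ψ (planeHeight m) (f ∘ planeMap σ η m) z =
      deriv ψ (planeHeight m z) *
      (fderiv ℝ (planeHeight m) z 1 *
          formAt lam (f (planeMap σ η m z)) (planeD f σ η m z Complex.I)
        - fderiv ℝ (planeHeight m) z Complex.I *
          formAt lam (f (planeMap σ η m z)) (planeD f σ η m z 1))
      + ψ (planeHeight m z) * extDL lam (f (planeMap σ η m z)) (planeD f σ η m z 1)
        (planeD f σ η m z Complex.I) := by
    rw [extDL_apply]; rfl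
  rw [e6, e1, e2, e3, e4, e5]
  simp
  left
  rw [sqAbs]
  ring

end IsPlaneModel

end Holo

/-! ### The energy of the planes -/

section Energy

open MeasureTheory

lemma setLIntegral_Ioi_le {g G : ℝ → ℝ} {C : ℝ} (hd : ∀ x, 0 ≤ x → HasDerivAt G (g x) x)
    (hg : ContinuousOn g (Ici 0)) (h0 : ∀ x, 0 ≤ x → 0 ≤ g x) (hG0 : G 0 = 0)
    (hC : ∀ x, 0 ≤ x → G x ≤ C) : ∫⁻ x in Ioi 0, ENNReal.ofReal (g x) ≤ ENNReal.ofReal C := by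
  have hU : Ioi (0 : ℝ) = ⋃ n : ℕ, Ioc (0 : ℝ) n := by
    ext x
    simp only [mem_Ioi, mem_iUnion, mem_Ioc, exists_and_left]
    exact ⟨fun hx ↦ ⟨hx, exists_nat_ge x⟩, fun hx ↦ hx.1⟩
  rw [hU, setLIntegral_iUnion_of_directed]
  · refine iSup_le fun n ↦ ?_
    have hn : (0 : ℝ) ≤ n := n.cast_nonneg
    have hint : IntervalIntegrable g volume 0 n := by
      refine (hg.mono ?_).intervalIntegrable
      rw [uIcc_of_le hn]
      exact fun x hx ↦ hx.1
    have h1 : ∫ x in (0 : ℝ)..n, g x = G n := by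
      rw [intervalIntegral.integral_eq_sub_of_hasDerivAt (fun x hx ↦ hd x ?_) hint, hG0, sub_zero]
      rw [uIcc_of_le hn] at hx
      exact hx.1
    rw [← ofReal_integral_eq_lintegral_ofReal
      ((intervalIntegrable_iff_integrableOn_Ioc_of_le hn).1 hint), ← intervalIntegral.integral_of_le
      hn, h1]
    · exact ENNReal.ofReal_le_ofReal (hC n hn)
    · filter_upwards [ae_restrict_mem measurableSet_Ioc] with x hx using h0 x hx.1.le
  · refine Monotone.directed_le fun i j hij ↦ Ioc_subset_Ioc_right ?_
    exact_mod_cast hij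

/-- The integral of a radial function which is the derivative of a bounded function. -/
lemma lintegral_radial_le {g G : ℝ → ℝ} {C : ℝ} (hd : ∀ x, 0 ≤ x → HasDerivAt G (g x) x)
    (hg : ContinuousOn g (Ici 0)) (h0 : ∀ x, 0 ≤ x → 0 ≤ g x) (hG0 : G 0 = 0)
    (hC : ∀ x, 0 ≤ x → G x ≤ C) :
    ∫⁻ z : ℂ, ENNReal.ofReal (g (sqAbs z)) ≤
      ENNReal.ofReal (C / 2) * ENNReal.ofReal (2 * Real.pi) := by
  rw [← Complex.lintegral_comp_polarCoord_symm]
  have ht : polarCoord.target = Ioi (0 : ℝ) ×ˢ Ioo (-Real.pi) Real.pi := rfl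
  have hgc : ContinuousOn (fun x : ℝ ↦ x * g (x ^ 2)) (Ici 0) :=
    continuousOn_id.mul (hg.comp (continuousOn_id.pow 2) fun x _ ↦ sq_nonneg x)
  calc ∫⁻ p in polarCoord.target,
      ENNReal.ofReal p.1 • ENNReal.ofReal (g (sqAbs (Complex.polarCoord.symm p)))
      = ∫⁻ p in Ioi (0 : ℝ) ×ˢ Ioo (-Real.pi) Real.pi,
        ENNReal.ofReal (p.1 * g (p.1 ^ 2)) * (1 : ENNReal) := by
        rw [ht]
        refine setLIntegral_congr_fun (measurableSet_Ioi.prod measurableSet_Ioo) fun p hp ↦ ?_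
        have h1 : sqAbs (Complex.polarCoord.symm p) = p.1 ^ 2 := by
          simp [sqAbs, Complex.cos_ofReal_re, Complex.sin_ofReal_re]
          linear_combination p.1 ^ 2 * Real.sin_sq_add_cos_sq p.2
        simp only [h1, mul_one, smul_eq_mul]
        rw [ENNReal.ofReal_mul (le_of_lt hp.1)]
    _ = (∫⁻ x in Ioi (0 : ℝ), ENNReal.ofReal (x * g (x ^ 2))) *
        ∫⁻ _ in Ioo (-Real.pi) Real.pi, (1 : ENNReal) := by
        rw [Measure.volume_eq_prod, ← Measure.prod_restrict]
        refine lintegral_prod_mul (μ := volume.restrict (Ioi (0 : ℝ)))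
          (f := fun x : ℝ ↦ ENNReal.ofReal (x * g (x ^ 2))) (g := fun _ : ℝ ↦ (1 : ENNReal))
          ?_ aemeasurable_const
        exact ((hgc.mono Ioi_subset_Ici_self).aemeasurable measurableSet_Ioi).ennreal_ofReal
    _ ≤ ENNReal.ofReal (C / 2) * ENNReal.ofReal (2 * Real.pi) := by
        refine mul_le_mul' (setLIntegral_Ioi_le (G := fun x ↦ G (x ^ 2) / 2) (fun x hx ↦ ?_) hgc
          (fun x hx ↦ mul_nonneg hx (h0 _ (sq_nonneg x))) (by simp [hG0])
          fun x _ ↦ ?_) (le_of_eq ?_)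
        · have h1 : HasDerivAt (fun x : ℝ ↦ x ^ 2) (2 * x) x := by
            simpa using hasDerivAt_pow 2 x
          exact (((hd _ (sq_nonneg x)).comp (h := fun x : ℝ ↦ x ^ 2) x h1).div_const
            2).congr_deriv (by ring)
        · have := hC _ (sq_nonneg x)
          linarith
        · rw [setLIntegral_one, Real.volume_Ioo]
          congr 1; ring

namespace IsPlaneModel

variable {W : Type*} [TopologicalSpace W] [ChartedSpace E3 W] [IsManifold (𝓡 3) ∞ W]
  {α om : ℝ} {R : ℝ × ℝ → ℝ} {b δ E : ℝ} {f : E4 → W} {κ : W → E4} {lam : OneForm W} {O : Set W}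
  {Y η m : ℝ → ℝ} {σ : ℝ}
  (hM : IsPlaneModel α om R b δ E Y η m)
include hM

lemma contDiffAt_deriv_m {τ : ℝ} (hτ : 0 ≤ τ) : ContDiffAt ℝ ∞ (deriv m) τ :=
  ((hM.prof.smooth_m τ hτ).fderiv_right (m := ∞) (by simp)).clm_apply contDiffAt_const

lemma hasDerivAt_y {τ : ℝ} (hτ : 0 ≤ τ) : HasDerivAt (fun τ ↦ τ * m τ ^ 2)
    (m τ ^ 2 + 2 * m τ * (τ * deriv m τ)) τ :=
  ((hasDerivAt_id τ).mul ((hM.prof.hasDerivAt_m hτ).pow 2)).congr_deriv (by simp; ring)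

lemma hasDerivAt_height {τ : ℝ} (hτ : 0 ≤ τ) :
    HasDerivAt (fun τ ↦ (∫ t in (1 : ℝ)..τ, m t ^ 2) / 4) (m τ ^ 2 / 4) τ :=
  (antideriv_of_nonneg (fun τ hτ ↦ (hM.prof.smooth_m τ hτ).pow 2) hτ).1.div_const 4

variable (h : IsLevelCollar α om R b δ E f κ lam O) (hσ : σ ^ 2 = 1)
include h hσ

/-- The density is the τ-derivative of ψ(a) τ m², which vanishes at τ = 0 and stays below b. In
polar coordinates the integral is π times the increment, so πb bounds it for every ψ. -/
lemma energy_lt_top : energy lam (planeHeight m) (f ∘ planeMap σ η m) < ⊤ := by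
  refine lt_of_le_of_lt (b := ENNReal.ofReal (b / 2) * ENNReal.ofReal (2 * Real.pi)) ?_
    (ENNReal.mul_lt_top ENNReal.ofReal_lt_top ENNReal.ofReal_lt_top)
  refine iSup₂_le fun ψ ⟨hψ, hψ01, hψ'⟩ ↦ ?_
  simp only [hM.energyDensity_eq h hσ]
  set a : ℝ → ℝ := fun τ ↦ (∫ t in (1 : ℝ)..τ, m t ^ 2) / 4 with ha
  have hac : ContinuousOn a (Ici 0) := fun τ hτ ↦
    (hM.hasDerivAt_height hτ).continuousAt.continuousWithinAt
  have hmc : ContinuousOn m (Ici 0) := fun τ hτ ↦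
    (hM.prof.smooth_m τ hτ).continuousAt.continuousWithinAt
  have hmc' : ContinuousOn (deriv m) (Ici 0) := fun τ hτ ↦
    (hM.contDiffAt_deriv_m hτ).continuousAt.continuousWithinAt
  refine lintegral_radial_le (g := fun τ ↦ deriv ψ (a τ) * (m τ ^ 4 * τ / 4) + ψ (a τ) *
    (m τ ^ 2 + 2 * m τ * (τ * deriv m τ))) (G := fun τ ↦ ψ (a τ) * (τ * m τ ^ 2))
    (fun τ hτ ↦ ?_) ?_ (fun τ hτ ↦ ?_) (by simp) fun τ hτ ↦ ?_
  · have h1 := ((hψ.differentiable (by simp)) (a τ)).hasDerivAt.comp τ (hM.hasDerivAt_height hτ)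
    exact (h1.mul (hM.hasDerivAt_y hτ)).congr_deriv (by simp only [Function.comp_apply]; ring)
  · have h1 : ContinuousOn (fun τ ↦ ψ (a τ)) (Ici 0) := hψ.continuous.comp_continuousOn hac
    have h2 : ContinuousOn (fun τ ↦ deriv ψ (a τ)) (Ici 0) :=
      (hψ.continuous_deriv (by simp)).comp_continuousOn hac
    exact (h2.mul (((hmc.pow 4).mul continuousOn_id).div_const 4)).add
      (h1.mul ((hmc.pow 2).add ((continuousOn_const.mul hmc).mul (continuousOn_id.mul hmc'))))
  · have h1 := hM.area_pos hτ
    have h2 := (hψ01 (a τ)).1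
    have h3 := hψ' (a τ)
    positivity
  · have h1 := hM.prof.y_lt τ hτ
    have h2 : 0 ≤ τ * m τ ^ 2 := by positivity
    have h3 := hψ01 (a τ)
    calc ψ (a τ) * (τ * m τ ^ 2) ≤ 1 * (τ * m τ ^ 2) := by gcongr; exact h3.2
      _ ≤ b := by linarith

/-- The constant ψ = 1 is admissible, and its density is positive everywhere. -/
lemma energy_pos : 0 < energy lam (planeHeight m) (f ∘ planeMap σ η m) := by
  refine lt_of_lt_of_le ?_ (le_iSup₂ (f := fun (ψ : ℝ → ℝ) (_ : ContDiff ℝ ∞ ψ ∧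
    (∀ x, ψ x ∈ Icc (0 : ℝ) 1) ∧ ∀ x, 0 ≤ deriv ψ x) ↦ ∫⁻ z : ℂ, ENNReal.ofReal
      (energyDensity lam ψ (planeHeight m) (f ∘ planeMap σ η m) z)) (fun _ ↦ (1 : ℝ))
    ⟨contDiff_const, fun _ ↦ by simp, fun _ ↦ by simp⟩)
  simp only [hM.energyDensity_eq h hσ]
  have h1 : ∀ z : ℂ, 0 < m (sqAbs z) ^ 2 + 2 * m (sqAbs z) * (sqAbs z * deriv m (sqAbs z)) :=
    fun z ↦ hM.area_pos (sqAbs_nonneg z)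
  have h2 : Continuous fun z : ℂ ↦
      m (sqAbs z) ^ 2 + 2 * m (sqAbs z) * (sqAbs z * deriv m (sqAbs z)) := by
    have h3 := (contDiff_comp_sqAbs hM.prof.smooth_m).continuous
    have h4 := (contDiff_comp_sqAbs fun τ hτ ↦ hM.contDiffAt_deriv_m hτ).continuous
    exact (h3.pow 2).add ((continuous_const.mul h3).mul (contDiff_sqAbs.continuous.mul h4))
  simp only [deriv_const, zero_mul, zero_add, one_mul]
  rw [lintegral_pos_iff_support h2.measurable.ennreal_ofReal]
  have h3 : (Function.support fun z : ℂ ↦ ENNReal.ofReal (m (sqAbs z) ^ 2 + 2 * m (sqAbs z) *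
      (sqAbs z * deriv m (sqAbs z)))) = univ := by
    ext z
    simp [h1 z]
  rw [h3]
  simp

lemma isFiniteEnergyPlane {g : W → E3 →L[ℝ] E3 →L[ℝ] ℝ}
    (hg : ∀ x, IsKerMetric (formAt lam x) (g x))
    (hgn : ∀ z ∈ levelSet α om R E δ, z 0 + z 2 = 0 → ∀ v w,
        g (f z) v w = neckMetric α om R z (spaceD κ (f z) v) (spaceD κ (f z) w)) :
    IsFiniteEnergyPlane lam (metricJ lam g) (planeHeight m) (f ∘ planeMap σ η m) :=
  ⟨hM.isHolomorphicPlane h hσ hg hgn, hM.energy_pos h hσ, hM.energy_lt_top h hσ⟩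

end IsPlaneModel

end Energy

/-! ### Uniform convergence of derivatives of loops -/

section Loops

/-- Induction on k with Ψ generalised: the t-derivative of Ψ is again jointly smooth on the strip
|x| < ε. -/
lemma continuousAt_iteratedDeriv_snd {ε : ℝ} (k : ℕ) {Ψ : ℝ → ℝ → ℝ}
    (hΨ : ∀ x, |x| < ε → ∀ t, ContDiffAt ℝ ∞ (Function.uncurry Ψ) (x, t)) {x t : ℝ} (hx : |x| < ε) :
    ContinuousAt (fun p : ℝ × ℝ ↦ iteratedDeriv k (Ψ p.1) p.2) (x, t) := by
  induction k generalizing Ψ with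
  | zero =>
    simp only [iteratedDeriv_zero]
    exact (hΨ x hx t).continuousAt
  | succ k ih =>
    have hd : ∀ x, |x| < ε → ∀ t, deriv (Ψ x) t =
        fderiv ℝ (Function.uncurry Ψ) (x, t) (0, 1) := fun x hx t ↦ by
      have h1 : HasDerivAt (fun t ↦ Ψ x t) _ t :=
        (((hΨ x hx t).differentiableAt (by simp)).hasFDerivAt).comp_hasDerivAt t
          ((hasDerivAt_const t x).prodMk (hasDerivAt_id t))
      exact h1.deriv
    have h1 : ∀ x, |x| < ε → ∀ t, ContDiffAt ℝ ∞
        (Function.uncurry fun x t ↦ deriv (Ψ x) t) (x, t) := fun x hx t ↦ by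
      have h2 : ContDiffAt ℝ ∞ (fun p : ℝ × ℝ ↦ fderiv ℝ (Function.uncurry Ψ) p (0, 1)) (x, t) :=
        ((hΨ x hx t).fderiv_right (by simp)).clm_apply contDiffAt_const
      refine h2.congr_of_eventuallyEq ?_
      have h3 : ∀ᶠ p : ℝ × ℝ in 𝓝 (x, t), |p.1| < ε :=
        (continuous_fst.abs.isOpen_preimage _ isOpen_Iio).mem_nhds hx
      filter_upwards [h3] with p hp
      exact hd p.1 hp p.2
    simp only [iteratedDeriv_succ']
    exact ih h1

lemma periodic_iteratedDeriv {F : ℝ → ℝ} {c : ℝ} (hF : Function.Periodic F c) (k : ℕ) :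
    Function.Periodic (iteratedDeriv k F) c := fun t ↦ by
  have h1 := congrFun (iteratedDeriv_comp_add_const k F c) t
  rw [show (fun z ↦ F (z + c)) = F from funext hF] at h1
  exact h1.symm

/-- Smooth families of loops converge in `C^∞`. -/
lemma tendstoUniformly_iteratedDeriv {ε : ℝ} (hε : 0 < ε) (k : ℕ) {Ψ : ℝ → ℝ → ℝ}
    (hΨ : ∀ x, |x| < ε → ∀ t, ContDiffAt ℝ ∞ (Function.uncurry Ψ) (x, t))
    (hper : ∀ x, Function.Periodic (Ψ x) 1) {ι : Type*} {l : Filter ι} {x : ι → ℝ}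
    (hx : Tendsto x l (𝓝 0)) :
    TendstoUniformly (fun i t ↦ iteratedDeriv k (Ψ (x i)) t) (fun t ↦ iteratedDeriv k (Ψ 0) t)
      l := by
  rw [Metric.tendstoUniformly_iff]
  intro e he
  have h0 : |(0 : ℝ)| < ε := by simpa
  -- Uniformity over one period comes from compactness; periodicity extends it to all t.
  have h1 : ∀ᶠ y in 𝓝 (0 : ℝ), ∀ t ∈ Icc (0 : ℝ) 1,
      dist (iteratedDeriv k (Ψ 0) t) (iteratedDeriv k (Ψ y) t) < e := by
    refine isCompact_Icc.eventually_forall_of_forall_eventually fun t _ ↦ ?_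
    have h2 : ContinuousAt (fun p : ℝ × ℝ ↦ iteratedDeriv k (Ψ p.1) p.2) (0, t) :=
      continuousAt_iteratedDeriv_snd k hΨ h0
    have h3 : ContinuousAt (fun p : ℝ × ℝ ↦ iteratedDeriv k (Ψ 0) p.2) (0, t) :=
      ContinuousAt.comp (f := fun p : ℝ × ℝ ↦ ((0 : ℝ), p.2)) (x := ((0 : ℝ), t)) h2
        (by fun_prop)
    exact (h3.dist h2).eventually_lt continuousAt_const (by simpa using he)
  filter_upwards [hx.eventually h1] with i hi t
  have h2 := fun y ↦ (periodic_iteratedDeriv (hper y) k).sub_int_mul_eq (x := t) ⌊t⌋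
  have h3 := hi (Int.fract t) ⟨Int.fract_nonneg t, (Int.fract_lt_one t).le⟩
  rw [Int.fract] at h3
  simp only [mul_one] at h2
  rwa [h2, h2] at h3

end Loops

/-! ### Asymptotics of the planes -/

section Asymptotics

lemma cyl_re (s t : ℝ) : (cyl s t).re = Real.exp (2 * Real.pi * s) * Real.cos (2 * Real.pi * t) := by
  have : (2 * Real.pi * (s + t * Complex.I) : ℂ) =
    ((2 * Real.pi * s : ℝ) : ℂ) + ((2 * Real.pi * t : ℝ) : ℂ) * Complex.I := by push_cast; ring
  rw [cyl, this, Complex.exp_re]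
  simp

lemma cyl_im (s t : ℝ) : (cyl s t).im = Real.exp (2 * Real.pi * s) * Real.sin (2 * Real.pi * t) := by
  have : (2 * Real.pi * (s + t * Complex.I) : ℂ) =
    ((2 * Real.pi * s : ℝ) : ℂ) + ((2 * Real.pi * t : ℝ) : ℂ) * Complex.I := by push_cast; ring
  rw [cyl, this, Complex.exp_im]
  simp

lemma exp_sq (s : ℝ) : Real.exp (2 * Real.pi * s) ^ 2 = Real.exp (4 * Real.pi * s) := by
  rw [← Real.exp_nat_mul]; congr 1; push_cast; ring

lemma sqAbs_cyl (s t : ℝ) : sqAbs (cyl s t) = Real.exp (4 * Real.pi * s) := by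
  rw [sqAbs, cyl_re, cyl_im, ← exp_sq]
  linear_combination Real.exp (2 * Real.pi * s) ^ 2 * Real.sin_sq_add_cos_sq (2 * Real.pi * t)

lemma sqAbs_eq_norm (z : ℂ) : sqAbs z = ‖z‖ ^ 2 := by
  rw [← Complex.normSq_eq_norm_sq, Complex.normSq_apply, sqAbs]; ring

lemma tendsto_sqAbs : Tendsto sqAbs (cocompact ℂ) atTop := by
  rw [show sqAbs = fun z ↦ ‖z‖ ^ 2 from funext sqAbs_eq_norm]
  exact (tendsto_pow_atTop two_ne_zero).comp (tendsto_norm_cocompact_atTop (E := ℂ))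

/-- The loops of the planes, as functions of `h` and `t`. -/
def loopPoint (Y : ℝ → ℝ) (x t : ℝ) : E4 :=
  !₂[-x, Real.sqrt (Y (x ^ 2)) * Real.cos (2 * Real.pi * t), x,
    -(Real.sqrt (Y (x ^ 2)) * Real.sin (2 * Real.pi * t))]

namespace IsPlaneModel

variable {W : Type*} [TopologicalSpace W] [ChartedSpace E3 W] [IsManifold (𝓡 3) ∞ W]
  {α om : ℝ} {R : ℝ × ℝ → ℝ} {b δ E : ℝ} {f : E4 → W} {κ : W → E4} {lam : OneForm W} {O : Set W}
  {Y η m : ℝ → ℝ} {σ : ℝ}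
  (hM : IsPlaneModel α om R b δ E Y η m)
include hM

omit hM in
lemma planeMap_cyl (σ s t : ℝ) : planeMap σ η m (cyl s t) =
    !₂[-(σ * η (Real.exp (4 * Real.pi * s))),
      Real.exp (2 * Real.pi * s) * m (Real.exp (4 * Real.pi * s)) * Real.cos (2 * Real.pi * t),
      σ * η (Real.exp (4 * Real.pi * s)),
      -(Real.exp (2 * Real.pi * s) * m (Real.exp (4 * Real.pi * s)) *
        Real.sin (2 * Real.pi * t))] := by
  rw [planeMap, sqAbs_cyl, cyl_re, cyl_im]
  congr 2
  ring_nf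

/-- Parametrising the loops by h instead of s turns the limit s → ∞ into the interior point h = 0 of
a smooth family. -/
lemma planeMap_cyl_eq_loopPoint (hσ : σ ^ 2 = 1) (s t : ℝ) :
    planeMap σ η m (cyl s t) = loopPoint Y (σ * η (Real.exp (4 * Real.pi * s))) t := by
  have he := Real.exp_pos (4 * Real.pi * s)
  have h1 : Real.sqrt (Y ((σ * η (Real.exp (4 * Real.pi * s))) ^ 2)) =
      Real.exp (2 * Real.pi * s) * m (Real.exp (4 * Real.pi * s)) := by
    rw [mul_pow, hσ, one_mul, ← hM.prof.eq_Y _ he.le, ← exp_sq, ← mul_pow]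
    refine Real.sqrt_sq ?_
    have := hM.prof.m_pos _ he.le
    rw [exp_sq]
    positivity
  rw [planeMap_cyl, loopPoint, h1]

lemma monotoneOn_y : MonotoneOn (fun τ ↦ τ * m τ ^ 2) (Ici 0) := by
  refine monotoneOn_of_deriv_nonneg (convex_Ici 0)
    (fun τ hτ ↦ (hM.hasDerivAt_y hτ).continuousAt.continuousWithinAt) (fun τ hτ ↦ ?_)
    fun τ hτ ↦ ?_
  · rw [interior_Ici] at hτ
    exact (hM.hasDerivAt_y (le_of_lt hτ)).differentiableAt.differentiableWithinAt
  · rw [interior_Ici] at hτ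
    rw [(hM.hasDerivAt_y (le_of_lt hτ)).deriv]
    exact (hM.area_pos (le_of_lt hτ)).le

/-- Since τ m² increases, m² ≥ m(1)²/τ for τ ≥ 1, so a dominates (m(1)²/4) log τ. -/
lemma tendsto_planeHeight : Tendsto (planeHeight m) (cocompact ℂ) atTop := by
  have hm1 := hM.prof.m_pos 1 zero_le_one
  set c := m 1 ^ 2 / 4 with hc
  have hc0 : 0 < c := by positivity
  have hmono : MonotoneOn (fun τ ↦ (∫ t in (1 : ℝ)..τ, m t ^ 2) / 4 - c * Real.log τ) (Ici 1) := by
    have hd : ∀ τ : ℝ, 1 ≤ τ → HasDerivAt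
        (fun τ ↦ (∫ t in (1 : ℝ)..τ, m t ^ 2) / 4 - c * Real.log τ)
        (m τ ^ 2 / 4 - c * τ⁻¹) τ := fun τ hτ ↦
      (hM.hasDerivAt_height (by linarith)).sub
        ((Real.hasDerivAt_log (by linarith)).const_mul c)
    refine monotoneOn_of_deriv_nonneg (convex_Ici 1)
      (fun τ hτ ↦ (hd τ hτ).continuousAt.continuousWithinAt) (fun τ hτ ↦ ?_) fun τ hτ ↦ ?_
    · rw [interior_Ici] at hτ
      exact (hd τ (le_of_lt hτ)).differentiableAt.differentiableWithinAt
    · rw [interior_Ici] at hτ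
      have hτ1 : (1 : ℝ) < τ := hτ
      rw [(hd τ hτ1.le).deriv]
      have h1 : 1 * m 1 ^ 2 ≤ τ * m τ ^ 2 := hM.monotoneOn_y (mem_Ici.2 zero_le_one)
        (mem_Ici.2 (by linarith)) hτ1.le
      rw [sub_nonneg, hc, ← div_eq_mul_inv, div_le_iff₀ (by linarith)]
      linarith
  have h1 : Tendsto (fun z : ℂ ↦ c * Real.log (sqAbs z)) (cocompact ℂ) atTop := by
    exact (Real.tendsto_log_atTop.comp tendsto_sqAbs).const_mul_atTop hc0
  refine tendsto_atTop_mono' _ ?_ h1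
  have h2 : ∀ᶠ z : ℂ in cocompact ℂ, 1 ≤ sqAbs z := tendsto_sqAbs.eventually_ge_atTop 1
  filter_upwards [h2] with z hz
  have h3 := hmono (mem_Ici.2 le_rfl) (mem_Ici.2 hz) hz
  simp at h3
  exact h3

/-- Because Y(0) = r² > 0, the square root in `loopPoint` is smooth near h = 0, where the loop is
the orbit itself. As h → 0, `tendstoUniformly_iteratedDeriv` applies; no rate of convergence is
needed, and the shift is 0. -/
lemma isAsymptoticTo (h : IsLevelCollar α om R b δ E f κ lam O) (hσ : σ ^ 2 = 1) {b₁ x₀ r : ℝ}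
    (hY : IsLevelGraph α om R b b₁ E Y x₀) (hr : 0 < r) (hr2 : Y 0 = r ^ 2) (hrδ : r < δ) :
    IsAsymptoticTo (planeHeight m) (f ∘ planeMap σ η m) (fun t ↦ f !₂[0,
      r * Real.cos (2 * Real.pi * (t / (Real.pi * r ^ 2))), 0,
      -(r * Real.sin (2 * Real.pi * (t / (Real.pi * r ^ 2))))]) (Real.pi * r ^ 2) := by
  have hpi := Real.pi_pos
  refine ⟨hM.tendsto_planeHeight, 0, fun g hg k ↦ ?_⟩
  have hb₁ : 0 < b₁ := hY.x₀_pos.trans hY.x₀_lt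
  have hY0 : ContDiffAt ℝ ∞ Y 0 := hY.contDiffAt hM.ball.box (by simpa)
  have hYc : ContinuousAt (fun x : ℝ ↦ Y (x ^ 2)) 0 :=
    ContinuousAt.comp (f := fun x : ℝ ↦ x ^ 2) (by simpa using hY0.continuousAt) (by fun_prop)
  have hev : ∀ᶠ x in 𝓝 (0 : ℝ), |x ^ 2| < b₁ ∧ 0 < Y (x ^ 2) ∧
      2 * x ^ 2 + Y (x ^ 2) < δ ^ 2 := by
    refine Eventually.and ?_ (Eventually.and ?_ ?_)
    · have : ContinuousAt (fun x : ℝ ↦ |x ^ 2|) 0 := by fun_prop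
      exact this.eventually_lt continuousAt_const (by simpa)
    · exact continuousAt_const.eventually_lt hYc (by simp [hr2]; positivity)
    · have : ContinuousAt (fun x : ℝ ↦ 2 * x ^ 2 + Y (x ^ 2)) 0 :=
        ContinuousAt.add (by fun_prop) hYc
      refine this.eventually_lt continuousAt_const ?_
      simp [hr2]
      exact pow_lt_pow_left₀ hrδ hr.le two_ne_zero
  obtain ⟨ε, hε, hball⟩ := Metric.eventually_nhds_iff_ball.1 hev
  have hball' : ∀ x, |x| < ε → |x ^ 2| < b₁ ∧ 0 < Y (x ^ 2) ∧
      2 * x ^ 2 + Y (x ^ 2) < δ ^ 2 := fun x hx ↦ hball x (by simpa using hx)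
  have hmem : ∀ x, |x| < ε → ∀ t, loopPoint Y x t ∈ levelSet α om R E δ := fun x hx t ↦ by
    obtain ⟨h1, h2, h3⟩ := hball' x hx
    have h4 := Real.sq_sqrt h2.le
    have h5 := Real.sin_sq_add_cos_sq (2 * Real.pi * t)
    have hX : actX (loopPoint Y x t) = x ^ 2 := by simp [actX, loopPoint]; ring
    have hYY : actY (loopPoint Y x t) = Y (x ^ 2) := by
      simp only [actY, loopPoint]
      simp
      rw [mul_pow, mul_pow, h4]
      linear_combination Y (x ^ 2) * h5
    refine ⟨?_, ?_⟩
    · rw [mem_ball_E4 hM.ball.δ_pos]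
      refine lt_of_eq_of_lt ?_ h3
      rw [← hYY]
      simp only [actY]
      have e0 : loopPoint Y x t 0 = -x := rfl
      have e2 : loopPoint Y x t 2 = x := rfl
      rw [e0, e2]
      ring
    · rw [normalForm, hX, hYY]
      exact hY.level _ h1
  have hsm : ∀ x, |x| < ε → ∀ t,
      ContDiffAt ℝ ∞ (fun p : ℝ × ℝ ↦ loopPoint Y p.1 p.2) (x, t) := fun x hx t ↦ by
    obtain ⟨h1, h2, h3⟩ := hball' x hx
    have hs : ContDiffAt ℝ ∞ (fun p : ℝ × ℝ ↦ Real.sqrt (Y (p.1 ^ 2))) (x, t) := by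
      refine ContDiffAt.sqrt ?_ h2.ne'
      exact (hY.contDiffAt hM.ball.box h1).comp (f := fun p : ℝ × ℝ ↦ p.1 ^ 2) (x, t)
        (contDiffAt_fst.pow 2)
    have ht : ContDiffAt ℝ ∞ (fun p : ℝ × ℝ ↦ 2 * Real.pi * p.2) (x, t) :=
      contDiffAt_const.mul contDiffAt_snd
    rw [contDiffAt_euclidean]
    intro i
    fin_cases i
    · exact contDiffAt_fst.neg
    · exact hs.mul ht.cos
    · exact contDiffAt_fst
    · exact (hs.mul ht.sin).neg
  have hΨ : ∀ x, |x| < ε → ∀ t,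
      ContDiffAt ℝ ∞ (Function.uncurry fun x t ↦ g (f (loopPoint Y x t))) (x, t) :=
    fun x hx t ↦ by
      have hC : ∀ᶠ p : ℝ × ℝ in 𝓝 (x, t), loopPoint Y p.1 p.2 ∈ levelSet α om R E δ := by
        have h3 : ∀ᶠ p : ℝ × ℝ in 𝓝 (x, t), |p.1| < ε :=
          (continuous_fst.abs.isOpen_preimage _ isOpen_Iio).mem_nhds hx
        filter_upwards [h3] with p hp
        exact hmem p.1 hp p.2
      have h1 := h.liou.collar.contMDiffAt_comp (hsm x hx t).contMDiffAt hC
      exact contMDiffAt_iff_contDiffAt.1 (hg.contMDiffAt.comp (x, t) h1)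
  have hper : ∀ x, Function.Periodic (fun t ↦ g (f (loopPoint Y x t))) 1 := fun x t ↦ by
    simp only [loopPoint, mul_add, mul_one, Real.cos_add_two_pi, Real.sin_add_two_pi]
  have hx : Tendsto (fun s : ℝ ↦ σ * η (Real.exp (4 * Real.pi * s))) atTop (𝓝 0) := by
    have h1 : Tendsto (fun s : ℝ ↦ Real.exp (4 * Real.pi * s)) atTop atTop :=
      Real.tendsto_exp_atTop.comp (tendsto_id.const_mul_atTop (by positivity))
    simpa using (hM.prof.tendsto.comp h1).const_mul σ
  have key := tendstoUniformly_iteratedDeriv hε k hΨ hper hx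
  have e1 : ∀ s : ℝ, (fun t' ↦ g ((f ∘ planeMap σ η m) (cyl s t'))) =
      fun t ↦ g (f (loopPoint Y (σ * η (Real.exp (4 * Real.pi * s))) t)) := fun s ↦ by
    funext t
    rw [Function.comp_apply, hM.planeMap_cyl_eq_loopPoint hσ]
  have e2 : (fun t' : ℝ ↦ g (f !₂[0,
      r * Real.cos (2 * Real.pi * ((Real.pi * r ^ 2 * t' + 0) / (Real.pi * r ^ 2))), 0,
      -(r * Real.sin (2 * Real.pi * ((Real.pi * r ^ 2 * t' + 0) / (Real.pi * r ^ 2))))])) =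
      fun t ↦ g (f (loopPoint Y 0 t)) := by
    funext t
    have h1 : (Real.pi * r ^ 2 * t + 0) / (Real.pi * r ^ 2) = t := by field_simp; simp
    have h2 : Real.sqrt (Y (0 ^ 2)) = r := by
      rw [zero_pow two_ne_zero, hr2, Real.sqrt_sq hr.le]
    rw [h1, loopPoint, h2, neg_zero]
  simp only [e1]
  rw [e2]
  exact key

end IsPlaneModel

end Asymptotics

/-! ### The explicit form and the image of the planes -/

section Explicit

namespace IsPlaneModel

variable {W : Type*}
  {α om : ℝ} {R : ℝ × ℝ → ℝ} {b δ E : ℝ} {Y η m : ℝ → ℝ} {σ : ℝ}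
  (hM : IsPlaneModel α om R b δ E Y η m)
include hM

/-- With τ = e^{4πs} and f = e^{2πs} m, the factor dτ/ds = 4πτ turns the equation for η into the one
for h. The height is normalised at τ = 1, which is s = 0. -/
lemma isExplicitPlane (hσ : σ ^ 2 = 1) {H : E4 → ℝ} {φ : E4 → E4}
    (hlev : localLevel H φ E δ = levelSet α om R E δ) (ι₀ ι₁ : E4 → W) :
    IsExplicitPlane H φ α om R E δ ι₀ ι₁ (planeHeight m) (neck φ ι₀ ι₁ ∘ planeMap σ η m) := by
  have hpi := Real.pi_pos
  have hτ : ∀ s : ℝ, 0 < Real.exp (4 * Real.pi * s) := fun s ↦ Real.exp_pos _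
  have hexp : ∀ c : ℝ, ContDiff ℝ ∞ fun s : ℝ ↦ Real.exp (c * Real.pi * s) := fun c ↦
    (contDiff_const.mul contDiff_id).exp
  have hcomp : ∀ {g : ℝ → ℝ}, (∀ τ, 0 ≤ τ → ContDiffAt ℝ ∞ g τ) →
      ContDiff ℝ ∞ fun s ↦ g (Real.exp (4 * Real.pi * s)) := fun {g} hg ↦
    contDiff_iff_contDiffAt.2 fun s ↦ (hg _ (hτ s).le).comp s (hexp 4).contDiffAt
  have hexpd : ∀ s : ℝ, HasDerivAt (fun s : ℝ ↦ Real.exp (4 * Real.pi * s))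
      (4 * Real.pi * Real.exp (4 * Real.pi * s)) s := fun s ↦ by
    have h1 : HasDerivAt (fun s : ℝ ↦ 4 * Real.pi * s) (4 * Real.pi) s := by
      simpa using (hasDerivAt_id s).const_mul (4 * Real.pi)
    exact h1.exp.congr_deriv (mul_comm _ _)
  set h : ℝ → ℝ := fun s ↦ σ * η (Real.exp (4 * Real.pi * s)) with hh
  set F : ℝ → ℝ := fun s ↦ Real.exp (2 * Real.pi * s) * m (Real.exp (4 * Real.pi * s)) with hF
  have hF2 : ∀ s, F s ^ 2 = Real.exp (4 * Real.pi * s) * m (Real.exp (4 * Real.pi * s)) ^ 2 :=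
    fun s ↦ by simp only [hF]; rw [mul_pow, exp_sq]
  have hh2 : ∀ s, h s ^ 2 = η (Real.exp (4 * Real.pi * s)) ^ 2 := fun s ↦ by
    simp only [hh]; rw [mul_pow, hσ, one_mul]
  have hA : ∀ s, α - fderiv ℝ R (-(h s) ^ 2, (F s) ^ 2 / 2) (1, 0) =
      abar α R (η (Real.exp (4 * Real.pi * s)) ^ 2)
        (Real.exp (4 * Real.pi * s) * m (Real.exp (4 * Real.pi * s)) ^ 2) := fun s ↦ by
    rw [hF2, hh2]; rfl
  have hB : ∀ s, om + fderiv ℝ R (-(h s) ^ 2, (F s) ^ 2 / 2) (0, 1) =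
      obar om R (η (Real.exp (4 * Real.pi * s)) ^ 2)
        (Real.exp (4 * Real.pi * s) * m (Real.exp (4 * Real.pi * s)) ^ 2) := fun s ↦ by
    rw [hF2, hh2]; rfl
  have hsmF : ContDiff ℝ ∞ F := (hexp 2).mul (hcomp hM.prof.smooth_m)
  refine ⟨h, F, _, _, contDiff_const.mul (hcomp hM.prof.smooth_η), hsmF, fun s ↦ ?_,
    fun s ↦ rfl, fun s ↦ rfl, fun s ↦ ?_, fun s ↦ ?_, fun s t ↦ ⟨?_, ?_, ?_⟩⟩
  · exact mul_pos (Real.exp_pos _) (hM.prof.m_pos _ (hτ s).le)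
  · rw [hA s, hB s, hF2, hh2]
    have h1 := hM.ball.box.abar_pos (hM.prof.abs_η_lt (hτ s).le) (hM.prof.abs_y_lt (hτ s).le)
    have h2 := hM.ball.box.obar_pos (hM.prof.abs_η_lt (hτ s).le) (hM.prof.abs_y_lt (hτ s).le)
    have h3 := hM.prof.η_pos _ (hτ s).le
    have h4 := hτ s
    positivity
  · rw [hA s, hB s, hF2, hh2]
    refine (((hM.prof.hasDerivAt _ (hτ s).le).comp (h := fun s : ℝ ↦ Real.exp (4 * Real.pi * s)) s
      (hexpd s)).const_mul σ).congr_deriv ?_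
    simp only [hh]
    generalize abar α R (η (Real.exp (4 * Real.pi * s)) ^ 2)
        (Real.exp (4 * Real.pi * s) * m (Real.exp (4 * Real.pi * s)) ^ 2) = A
    generalize obar om R (η (Real.exp (4 * Real.pi * s)) ^ 2)
        (Real.exp (4 * Real.pi * s) * m (Real.exp (4 * Real.pi * s)) ^ 2) = B
    generalize B ^ 2 * (Real.exp (4 * Real.pi * s) * m (Real.exp (4 * Real.pi * s)) ^ 2) +
      2 * A ^ 2 * η (Real.exp (4 * Real.pi * s)) ^ 2 = D
    rw [div_eq_mul_inv, div_eq_mul_inv, mul_inv]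
    ring
  · rw [hlev, ← planeMap_cyl]
    exact hM.planeMap_mem hσ _
  · rw [Function.comp_apply, planeMap_cyl]
  · have hd : ∀ s : ℝ, HasDerivAt
        (fun s ↦ (∫ t in (1 : ℝ)..Real.exp (4 * Real.pi * s), m t ^ 2) / 4)
        (Real.pi * F s ^ 2) s := fun s ↦
      ((hM.hasDerivAt_height (hτ s).le).comp (h := fun s : ℝ ↦ Real.exp (4 * Real.pi * s)) s
        (hexpd s)).congr_deriv (by rw [hF2]; ring)
    have h1 := intervalIntegral.integral_eq_sub_of_hasDerivAt (a := 0) (b := s)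
      (fun s _ ↦ hd s)
      (continuous_const.mul (hsmF.continuous.pow 2)).continuousOn.intervalIntegrable
    rw [intervalIntegral.integral_const_mul] at h1
    rw [h1, planeHeight, sqAbs_cyl]
    simp

/-- For a point of the hemisphere, surjectivity of η yields τ from the value of h; strict
monotonicity of K in y gives f² = τ m², and dividing q₂ - i p₂ by m produces the preimage. -/
lemma range_planeMap (hσ : σ ^ 2 = 1) :
    range (planeMap σ η m) = {z | z ∈ levelSet α om R E δ ∧ z 0 + z 2 = 0 ∧ 0 < σ * z 2} := by
  ext z
  constructor
  · rintro ⟨ζ, rfl⟩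
    refine ⟨hM.planeMap_mem hσ ζ, planeMap_sum σ ζ, ?_⟩
    have h1 : σ * planeMap σ η m ζ 2 = η (sqAbs ζ) := by
      simp [planeMap]; linear_combination η (sqAbs ζ) * hσ
    rw [h1]
    exact hM.prof.η_pos _ (sqAbs_nonneg ζ)
  · rintro ⟨hz, h0, hpos⟩
    have hz0 : z 0 = -z 2 := by linarith
    have hX : actX z = (σ * z 2) ^ 2 := by rw [actX, hz0, mul_pow, hσ]; ring
    have hxb := hM.ball.actX_lt hz.1
    have hyb := hM.ball.actY_lt hz.1
    have hy0 : 0 ≤ actY z := by rw [actY]; positivity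
    have hE := hz.2
    rw [normalForm] at hE
    rw [hX, abs_of_nonneg (sq_nonneg _)] at hxb
    rw [abs_of_nonneg hy0] at hyb
    obtain ⟨τ, hτ, hη⟩ := hM.prof.surj (σ * z 2) (actY z) hpos hy0 hxb hyb (by rw [← hX]; exact hE)
    have hm := hM.prof.m_pos τ hτ
    have hy : actY z = τ * m τ ^ 2 := by
      refine hM.ball.box.eq_of_snd (hM.prof.abs_η_lt hτ) (by rwa [abs_of_nonneg hy0])
        (hM.prof.abs_y_lt hτ) ?_
      rw [hM.prof.level τ hτ, hη, ← hX]
      exact hE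
    refine ⟨⟨z 1 / m τ, -(z 3 / m τ)⟩, ?_⟩
    have hs : sqAbs ⟨z 1 / m τ, -(z 3 / m τ)⟩ = τ := by
      rw [sqAbs]
      simp only
      rw [actY] at hy
      field_simp
      linarith
    have h2 : σ * η τ = z 2 := by rw [hη]; linear_combination z 2 * hσ
    rw [planeMap, hs, h2]
    ext i
    fin_cases i
    · simp [hz0]
    · simp; field_simp
    · simp
    · simp; field_simp

end IsPlaneModel

end Explicit

/-! ### Small energies -/

section Energies

variable {α om : ℝ} {R : ℝ × ℝ → ℝ} {b b₁ δ E x₀ : ℝ} {Y : ℝ → ℝ}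

/-- Coercivity bounds x and y separately by multiples of E. The combination 2x + y is |z|² on {q₁ +
p₁ = 0}, so this locates the sphere inside a small ball. -/
lemma IsGoodBox.le_of_level (h : IsGoodBox α om R b) {x y : ℝ} (hx : 0 ≤ x) (hxb : x < b)
    (hy : 0 ≤ y) (hyb : y < b) (hE : actionEnergy α om R x y = E) :
    α / 2 * x ≤ E ∧ 2 * x + y ≤ (4 / α + 4 / om) * E := by
  have hα := h.alpha_pos
  have hom := h.om_pos
  have h1 := h.lower_bound hx hxb hy hyb
  rw [hE] at h1
  have h2 : α / 2 * x ≤ E := by have : 0 ≤ om / 4 * y := by positivity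
                                linarith
  have h3 : om / 4 * y ≤ E := by have : 0 ≤ α / 2 * x := by positivity
                                 linarith
  refine ⟨h2, ?_⟩
  have h4 : 2 * x = 4 / α * (α / 2 * x) := by field_simp; ring
  have h5 : y = 4 / om * (om / 4 * y) := by field_simp
  rw [add_mul]
  exact add_le_add (h4.le.trans (mul_le_mul_of_nonneg_left h2 (by positivity)))
    (h5.le.trans (mul_le_mul_of_nonneg_left h3 (by positivity)))

/-- The boundary sphere is compact when the energy is small. -/
lemma IsGoodBall.isCompact_sphere (h : IsGoodBall α om R b δ)
    (hEδ : (4 / α + 4 / om) * E < δ ^ 2) :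
    IsCompact {z | z ∈ levelSet α om R E δ ∧ z 0 + z 2 = 0} := by
  -- The sphere lies in the closed ball of radius ρ < δ, so the restriction to the open ball of
  -- radius δ does not spoil closedness.
  set ρ := Real.sqrt ((4 / α + 4 / om) * E) with hρ
  have hρδ : ρ < δ := by
    rw [hρ, Real.sqrt_lt' h.δ_pos]
    exact hEδ
  have hcont : ContinuousOn (normalForm α om R) (Metric.closedBall (0 : E4) ρ) := fun z hz ↦ by
    obtain ⟨D, hD, -⟩ := h.fderiv_normalForm (Metric.closedBall_subset_ball hρδ hz)
    exact hD.continuousAt.continuousWithinAt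
  have hset : {z | z ∈ levelSet α om R E δ ∧ z 0 + z 2 = 0} =
      (Metric.closedBall (0 : E4) ρ ∩ normalForm α om R ⁻¹' {E}) ∩ {z : E4 | z 0 + z 2 = 0} := by
    ext z
    constructor
    · rintro ⟨hz, h0⟩
      refine ⟨⟨?_, hz.2⟩, h0⟩
      have hz2 : z 2 = -z 0 := by linarith
      have hX : actX z = z 0 ^ 2 := by rw [actX, hz2]; ring
      have hY : 0 ≤ actY z := by rw [actY]; positivity
      have h1 := h.box.le_of_level (E := E) (x := actX z) (y := actY z) (by rw [hX]; positivity)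
        (lt_of_abs_lt (h.actX_lt hz.1)) hY (lt_of_abs_lt (h.actY_lt hz.1)) hz.2
      rw [mem_closedBall_zero_iff, hρ]
      refine Real.le_sqrt_of_sq_le ?_
      rw [norm_sq_E4, hz2]
      refine le_trans (le_of_eq ?_) h1.2
      rw [hX, actY]; ring
    · rintro ⟨⟨hz, hE⟩, h0⟩
      exact ⟨⟨Metric.closedBall_subset_ball hρδ hz, hE⟩, h0⟩
  rw [hset]
  refine ((isCompact_closedBall (0 : E4) ρ).of_isClosed_subset
    (hcont.preimage_isClosed_of_isClosed Metric.isClosed_closedBall isClosed_singleton)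
    inter_subset_left).inter_right ?_
  exact isClosed_eq (((coordL 0).continuous).add (coordL 2).continuous) continuous_const

end Energies

end Contact

/-! ### The choice of constants and the conclusion -/

open Contact

theorem mainTheorem6
    (H : E4 → ℝ) (hH : ContDiff ℝ ∞ H) (pc : E4) (φ : OpenPartialHomeomorph E4 E4)
    (α om : ℝ) (R : ℝ × ℝ → ℝ) (hφ : Contact.IsSaddleCenterNormalForm H pc φ α om R) :
    ∃ δ₁ : ℝ, 0 < δ₁ ∧ Metric.ball (0 : E4) δ₁ ⊆ φ.source ∧
    ∀ δ : ℝ, 0 < δ → δ ≤ δ₁ →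
    ∃ E₀ : ℝ, 0 < E₀ ∧ ∀ E : ℝ, 0 < E → E < E₀ →
    ∃ r : ℝ, 0 < r ∧ r < δ ∧
      {z : E4 | z ∈ Contact.localLevel H φ E δ ∧ z 0 = 0 ∧ z 2 = 0} =
        {z : E4 | z 0 = 0 ∧ z 2 = 0 ∧ z 1 ^ 2 + z 3 ^ 2 = r ^ 2} ∧
    ∀ S : Set E4, Contact.IsEnergyBall H φ E δ S →
    ∀ (W : Type*) [TopologicalSpace W] [T2Space W] [CompactSpace W] [ChartedSpace E3 W]
      [IsManifold (𝓡 3) ∞ W] (ι₀ ι₁ : E4 → W) (κ : W → E4),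
      Contact.IsGluedDouble H φ E δ S ι₀ ι₁ κ →
    ∀ lam : Contact.OneForm W, Contact.IsContactForm lam →
      Contact.IsLiouvilleNearBoundary H φ E δ ι₀ ι₁ κ lam →
    Contact.IsPeriodicOrbit lam (Contact.equatorOrbit φ ι₀ ι₁ r (Real.pi * r ^ 2))
      (Real.pi * r ^ 2) ∧
    Contact.IsHyperbolicOrbit lam (Contact.equatorOrbit φ ι₀ ι₁ r (Real.pi * r ^ 2))
      (Real.pi * r ^ 2) ∧
    ∃ J : Contact.EndField W, Contact.IsCompatible lam J ∧
    ∃ (a₁ : ℂ → ℝ) (u₁ : ℂ → W) (a₂ : ℂ → ℝ) (u₂ : ℂ → W),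
      Contact.IsFiniteEnergyPlane lam J a₁ u₁ ∧
      Contact.IsFiniteEnergyPlane lam J a₂ u₂ ∧
      range u₁ = Contact.neck φ ι₀ ι₁ '' Contact.hemisphere₁ H φ E δ ∧
      range u₂ = Contact.neck φ ι₀ ι₁ '' Contact.hemisphere₂ H φ E δ ∧
      Contact.IsAsymptoticTo a₁ u₁ (Contact.equatorOrbit φ ι₀ ι₁ r (Real.pi * r ^ 2))
        (Real.pi * r ^ 2) ∧
      Contact.IsAsymptoticTo a₂ u₂ (Contact.equatorOrbit φ ι₀ ι₁ r (Real.pi * r ^ 2))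
        (Real.pi * r ^ 2) ∧
      Contact.IsExplicitPlane H φ α om R E δ ι₀ ι₁ a₁ u₁ ∧
      Contact.IsExplicitPlane H φ α om R E δ ι₀ ι₁ a₂ u₂ := by
  have hα := hφ.alpha_pos
  have hom := hφ.omega_pos
  obtain ⟨b, hbox⟩ := hφ.exists_goodBox
  have hb := hbox.b_pos
  obtain ⟨b₁, hb₁, E₁, hE₁, hgraph⟩ := hbox.exists_levelGraph
  obtain ⟨δ₀, hδ₀, hsource⟩ := Metric.isOpen_iff.1 φ.open_source 0 hφ.zero_mem
  set c := 4 / α + 4 / om with hc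
  have hc0 : 0 < c := by positivity
  -- The radius √b keeps the actions of points of the ball inside the box on which R is controlled.
  refine ⟨min δ₀ (Real.sqrt b), lt_min hδ₀ (Real.sqrt_pos.2 hb),
    (Metric.ball_subset_ball (min_le_left _ _)).trans hsource, fun δ hδ hδ₁ ↦ ?_⟩
  have hball : IsGoodBall α om R b δ := ⟨hbox, hδ, by
    calc δ ^ 2 ≤ Real.sqrt b ^ 2 := pow_le_pow_left₀ hδ.le (hδ₁.trans (min_le_right _ _)) 2
      _ = b := Real.sq_sqrt hb.le⟩
  -- E₁ provides the graph Y, the second bound forces x < b₁ on the level curve in the quadrant, and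
  -- δ²/c keeps the sphere and the planes in the ball. None of them involves S, W or λ.
  refine ⟨min E₁ (min (α / 2 * b₁) (δ ^ 2 / c)), by positivity, fun E hE hE₀ ↦ ?_⟩
  have hEb₁ : E < α / 2 * b₁ := hE₀.trans_le ((min_le_right _ _).trans (min_le_left _ _))
  have hEδ : c * E < δ ^ 2 := by
    have : E < δ ^ 2 / c := hE₀.trans_le ((min_le_right _ _).trans (min_le_right _ _))
    rw [lt_div_iff₀ hc0] at this
    linarith
  obtain ⟨Y, x₀, hY⟩ := hgraph E hE (hE₀.trans_le (min_le_left _ _))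
  obtain ⟨η, m, hprof⟩ := hY.exists_profile hbox fun x hx hxb y hy hyb he ↦ by
    have := (hbox.le_of_level hx hxb hy hyb he).1
    nlinarith
  have hM : IsPlaneModel α om R b δ E Y η m := ⟨hball, hprof, fun τ hτ ↦
    (hbox.le_of_level (sq_nonneg _) (hprof.η_lt τ hτ) (by positivity) (hprof.y_lt τ hτ)
      (hprof.level τ hτ)).2.trans_lt hEδ⟩
  have h00 : |(0 : ℝ)| < b₁ := by simpa
  have hY0 : 0 < Y 0 := by
    have h1 := hY.strictAnti hbox h00 (by rw [abs_of_pos hY.x₀_pos]; exact hY.x₀_lt) hY.x₀_pos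
    rwa [hY.Y_x₀] at h1
  have hY0δ : Y 0 < δ ^ 2 := by
    have h1 := (hbox.le_of_level le_rfl hb hY0.le (lt_of_abs_lt (hY.lt 0 h00))
      (hY.level 0 h00)).2
    linarith
  set r := Real.sqrt (Y 0) with hr
  have hr0 : 0 < r := Real.sqrt_pos.2 hY0
  have hr2 : r ^ 2 = Y 0 := Real.sq_sqrt hY0.le
  have hrδ : r < δ := by rwa [hr, Real.sqrt_lt' hδ]
  have hlev : localLevel H φ E δ = levelSet α om R E δ := by
    ext z
    refine and_congr_right fun hz ↦ ?_
    rw [hφ.normal_form z (hsource (Metric.ball_subset_ball (hδ₁.trans (min_le_left _ _)) hz)),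
      normalForm, actionEnergy, actX, actY, neg_neg, neg_mul, mul_neg]
  have hequator : ∀ z : E4, z 0 = 0 → z 2 = 0 → actY z = r ^ 2 → z ∈ levelSet α om R E δ := by
    intro z h0 h2 hz
    refine ⟨?_, ?_⟩
    · rw [mem_ball_E4 hδ, h0, h2]
      rw [actY] at hz
      nlinarith
    · rw [normalForm, hz, hr2, actX, h0]
      simpa using hY.level 0 h00
  refine ⟨r, hr0, hrδ, ?_, ?_⟩
  · ext z
    simp only [mem_ofPred_eq, hlev]
    constructor
    · rintro ⟨hz, h0, h2⟩
      refine ⟨h0, h2, ?_⟩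
      rw [hr2]
      have h3 := hz.2
      rw [normalForm, actX, h0, zero_mul, neg_zero] at h3
      exact hY.eq_of_level hbox h00 (hball.actY_lt hz.1) h3
    · rintro ⟨h0, h2, hz⟩
      exact ⟨hequator z h0 h2 hz, h0, h2⟩
  intro S _ W _ _ _ _ _ ι₀ ι₁ κ hglue lam hlam hliou
  have hcollar := hglue.collar
  obtain ⟨O, hO, hsub, hOform⟩ := eventually_nhdsSet_iff_exists.1 hliou
  have hsphere : boundarySphere H φ E δ = {z | z ∈ levelSet α om R E δ ∧ z 0 + z 2 = 0} := by
    rw [boundarySphere, hlev]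
  rw [hsphere] at hsub
  rw [hlev] at hcollar
  -- λ is the Liouville form only near the sphere, so the working set is that neighbourhood
  -- intersected with the collar.
  have h : IsLevelCollar α om R b δ E (neck φ ι₀ ι₁) κ lam
      (O ∩ neck φ ι₀ ι₁ '' levelSet α om R E δ) :=
    ⟨hball, ⟨hcollar, hlam, hO.inter hcollar.isOpen_image, inter_subset_right,
      fun x hx v ↦ hOform x hx.1 v⟩,
      fun z hz h0 ↦ ⟨hsub ⟨z, ⟨hz, h0⟩, rfl⟩, ⟨z, hz, rfl⟩⟩⟩
  have hclosed : IsClosed (neck φ ι₀ ι₁ '' {z | z ∈ levelSet α om R E δ ∧ z 0 + z 2 = 0}) :=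
    ((hball.isCompact_sphere hEδ).image_of_continuousOn
      (hcollar.continuousOn.mono fun z hz ↦ hz.1)).isClosed
  obtain ⟨g, hgs, hgp, hgn⟩ := h.exists_metric hE.ne' hclosed
  have h1 : (1 : ℝ) ^ 2 = 1 := by norm_num
  have h2 : (-1 : ℝ) ^ 2 = 1 := by norm_num
  -- One J serves both planes, since `neckMetric` is conformal along the planes for either sign σ.
  -- As q₁ = -σ η with η > 0, σ = 1 gives the hemisphere q₁ < 0 and σ = -1 the other one.
  refine ⟨h.isPeriodicOrbit hr0 hequator, h.isHyperbolicOrbit hr0 hequator, metricJ lam g,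
    hlam.isCompatible_metricJ hgs hgp, planeHeight m, neck φ ι₀ ι₁ ∘ planeMap 1 η m,
    planeHeight m, neck φ ι₀ ι₁ ∘ planeMap (-1) η m, hM.isFiniteEnergyPlane h h1 hgp hgn,
    hM.isFiniteEnergyPlane h h2 hgp hgn, ?_, ?_, hM.isAsymptoticTo h h1 hY hr0 hr2.symm hrδ,
    hM.isAsymptoticTo h h2 hY hr0 hr2.symm hrδ, hM.isExplicitPlane h1 hlev ι₀ ι₁,
    hM.isExplicitPlane h2 hlev ι₀ ι₁⟩
  · rw [range_comp, hM.range_planeMap h1, hemisphere₁, hlev]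
    congr 1
    ext z
    exact and_congr_right fun _ ↦ and_congr_right fun h0 ↦
      ⟨fun h ↦ by linarith, fun h ↦ by linarith⟩
  · rw [range_comp, hM.range_planeMap h2, hemisphere₂, hlev]
    congr 1
    ext z
    exact and_congr_right fun _ ↦ and_congr_right fun h0 ↦
      ⟨fun h ↦ by linarith, fun h ↦ by linarith⟩

end
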